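/- Let $d\ge 1$ and let $\Omega\subset\mathbb R^d$ be bounded with $\Omega=\operatorname{int}\overline\Omega$ (for instance a bounded Lipschitz domain). Write $\langle\cdot,\cdot\rangle$ and $\|\cdot\|$ for the inner product and norm of $L^2(\Omega)$ or $L^2(\Omega)^d$. A mesh $\mathcal T_h$ of $\Omega$ is a finite conforming decomposition of $\overline\Omega$ into closed $d$-simplices; it is $\sigma$-shape-regular if $h_T\le\sigma\rho_T$ for every $T\in\mathcal T_h$, where $h_T$ is the diameter of $T$ and $\rho_T$ the diameter of the largest ball contained in $T$. Let $W_h\subset L^2(\Omega)$ be the space of functions that are constant on every $T\in\mathcal T_h$, and $V_h=\{\mathbf v\in H(\mathrm{div};\Omega): \mathbf v|_T(\mathbf x)=\mathbf a_T+b_T\mathbf x,\ \mathbf a_T\in\mathbb R^d,\ b_T\in\mathbb R,\ \text{for all } T\in\mathcal T_h\}$. Let $s,a,f_w,f_2:\mathbb R\to\mathbb R$ and $\mathbf f_1,\mathbf f_3:\mathbb R\to\mathbb R^d$ be Lipschitz continuous with Lipschitz constants $L_s,L_a,L_{f_w},L_{f_2},L_{\mathbf f_1},L_{\mathbf f_3}$;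 let $s$ be nondecreasing with values in $[0,1]$, $0<a_\star\le a\le a^\star<\infty$ and $|f_w|\le M_{f_w}$. Let $L\ge L_s$, $L>0$, $\tau>0$, and let $\Theta^{n-1}_h\in L^2(\Omega)$ be given. Problem $P_h^n$: find $(\Theta,\mathbf q,p,\mathbf u)\in W_h\times V_h\times W_h\times V_h$ such that, for all $w\in W_h$ and $\mathbf v\in V_h$, $$\langle s(\Theta)-s(\Theta^{n-1}_h),w\rangle+\tau\langle\nabla\cdot\mathbf q,w\rangle=0,$$ $$\langle\mathbf q,\mathbf v\rangle-\langle\Theta,\nabla\cdot\mathbf v\rangle-\langle f_w(s(\Theta))\mathbf u,\mathbf v\rangle=\langle\mathbf f_1(s(\Theta)),\mathbf v\rangle,$$ $$\langle\nabla\cdot\mathbf u,w\rangle=\langle f_2(s(\Theta)),w\rangle,$$ $$\langle a(s(\Theta))\mathbf u,\mathbf v\rangle-\langle p,\nabla\cdot\mathbf v\rangle+\langle\mathbf f_3(s(\Theta)),\mathbf v\rangle=0.$$ Problem $P_h^{n,i}$ ($i\ge1$, the $L$-scheme): given $\Theta^{i-1}\in W_h$ and $s^{i-1}=s(\Theta^{i-1})$,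 find $(\Theta^i,\mathbf q^i,p^i,\mathbf u^i)\in W_h\times V_h\times W_h\times V_h$ such that, for all $w\in W_h$ and $\mathbf v\in V_h$, $$\langle L(\Theta^i-\Theta^{i-1})+s^{i-1},w\rangle+\tau\langle\nabla\cdot\mathbf q^i,w\rangle=\langle s(\Theta^{n-1}_h),w\rangle,$$ $$\langle\mathbf q^i,\mathbf v\rangle-\langle\Theta^i,\nabla\cdot\mathbf v\rangle-\langle f_w(s^{i-1})\mathbf u^i,\mathbf v\rangle=\langle\mathbf f_1(s^{i-1}),\mathbf v\rangle,$$ $$\langle\nabla\cdot\mathbf u^i,w\rangle=\langle f_2(s^{i-1}),w\rangle,$$ $$\langle a(s^{i-1})\mathbf u^i,\mathbf v\rangle-\langle p^i,\nabla\cdot\mathbf v\rangle+\langle\mathbf f_3(s^{i-1}),\mathbf v\rangle=0.$$ For constants $C>0$ and $M_{\mathbf u}\ge0$ put $$C_1=\frac{4\left(M_{\mathbf u}^2L_a^2+L_{\mathbf f_3}^2+2(a^\star)^2C^2L_{f_2}^2\right)}{a_\star^2}+\frac{(M_{\mathbf u}L_a+L_{\mathbf f_3})^2}{(a^\star)^2},\qquad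 C_2=2C^2(a^\star)^2C_1+2C^2(M_{\mathbf u}L_a+L_{\mathbf f_3})^2,$$ $$C_3=M_{f_w}^2C_1+(M_{\mathbf u}L_{f_w}+L_{\mathbf f_1})^2,\qquad K=C_3+4L_{\mathbf f_1}^2+8L_{f_w}^2M_{\mathbf u}^2+8C_1M_{f_w}^2 .$$ **Theorem.** For every $\sigma$ there is a constant $C>0$, depending only on $d,\Omega,\sigma$, such that for every $\sigma$-shape-regular mesh of $\Omega$ every $w\in W_h$ equals $\nabla\cdot\mathbf v$ for some $\mathbf v\in V_h$ with $\|\mathbf v\|\le C\|w\|$, and such that, for all data as above with $\tau LK\le1$, the following holds. 1. Problem $P_h^{n,i}$ has exactly one solution for every $\Theta^{i-1}\in W_h$. 2. Let $\Theta^0\in W_h$ be arbitrary, let $(\Theta^i,\mathbf q^i,p^i,\mathbf u^i)_{i\ge1}$ be the iterates, and assume $\|\mathbf u^i\|_{L^\infty(\Omega)}\le M_{\mathbf u}$ for all $i\ge1$. With $e_\Theta^i=\Theta^i-\Theta^{i-1}$, $e_s^i=s(\Theta^i)-s(\Theta^{i-1})$, and $e_{\mathbf q}^i,e_p^i,e_{\mathbf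 u}^i$ defined likewise, one has for all $i\ge2$ $$\|e_{\mathbf u}^i\|^2\le C_1\|e_s^{i-1}\|^2,\quad \|\nabla\cdot e_{\mathbf u}^i\|^2\le L_{f_2}^2\|e_s^{i-1}\|^2,\quad \|e_p^i\|^2\le C_2\|e_s^{i-1}\|^2,\quad \|e_{\mathbf q}^i\|^2\ge\frac{1}{3C^2}\|e_\Theta^i\|^2-C_3\|e_s^{i-1}\|^2,$$ $$\|e_\Theta^i\|^2+\frac{3C^2\tau}{2(3C^2L+\tau)}\|e_{\mathbf q}^i\|^2+\frac{3C^2(1-\tau LK)}{L(3C^2L+\tau)}\|e_s^{i-1}\|^2\le\frac{3C^2L}{3C^2L+\tau}\|e_\Theta^{i-1}\|^2 ,$$ and in particular the same inequality without the (nonnegative) third term. 3. In the situation of 2, the iterates converge in $L^2$, in all four components, to a solution $(\Theta,\mathbf q,p,\mathbf u)$ of Problem $P_h^n$. The convergence is linear: for all $i\ge1$ the estimates of 2 also hold with $e_\Theta^i,e_{\mathbf q}^i,e_p^i,e_{\mathbf u}^i,e_s^{i-1},e_\Theta^{i-1}$ replaced by the errors $\Theta^i-\Theta$, $\mathbf q^i-\mathbf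 q$, $p^i-p$, $\mathbf u^i-\mathbf u$, $s(\Theta^{i-1})-s(\Theta)$, $\Theta^{i-1}-\Theta$; in particular $$\|\Theta^i-\Theta\|^2+\frac{3C^2\tau}{2(3C^2L+\tau)}\|\mathbf q^i-\mathbf q\|^2\le\frac{3C^2L}{3C^2L+\tau}\|\Theta^{i-1}-\Theta\|^2 .$$ -/

import Mathlib

open MeasureTheory Filter Topology
open scoped NNReal ENNReal ContDiff

noncomputable section

namespace TwoPhase

/-- Euclidean space `ℝ^d`. -/
abbrev Pt (d : ℕ) := EuclideanSpace ℝ (Fin d)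

/-- `L²(Ω)`. -/
abbrev L2 {d : ℕ} (Ω : Set (Pt d)) := Lp ℝ 2 (volume.restrict Ω)

/-- `(L²(Ω))^d`. -/
abbrev L2v {d : ℕ} (Ω : Set (Pt d)) := Lp (Pt d) 2 (volume.restrict Ω)

/-! ### Weak divergence and `H(div; Ω)` -/

/-- `g` is the weak divergence of `v` on `Ω`: `∫_Ω v · ∇φ = - ∫_Ω g φ` for every test function
`φ ∈ C_c^∞(Ω)`. -/
def HasWeakDiv {d : ℕ} {Ω : Set (Pt d)} (v : L2v Ω) (g : L2 Ω) : Prop :=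
  ∀ φ : Pt d → ℝ, ContDiff ℝ ∞ φ → HasCompactSupport φ → tsupport φ ⊆ Ω →
    ∫ x in Ω, fderiv ℝ φ x (v x) = - ∫ x in Ω, g x * φ x

/-- `H(div; Ω)`: the square integrable vector fields with a square integrable weak divergence. -/
def Hdiv {d : ℕ} (Ω : Set (Pt d)) : Set (L2v Ω) := {v | ∃ g : L2 Ω, HasWeakDiv v g}

open Classical in
/-- The weak divergence of a field in `H(div; Ω)` (and `0` for a field outside this space). -/
def weakDiv {d : ℕ} {Ω : Set (Pt d)} (v : L2v Ω) : L2 Ω :=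
  if h : ∃ g : L2 Ω, HasWeakDiv v g then h.choose else 0

/-- On an open set the weak divergence is unique. -/
theorem HasWeakDiv.unique {d : ℕ} {Ω : Set (Pt d)} (hΩ : IsOpen Ω) {v : L2v Ω} {g g' : L2 Ω}
    (h : HasWeakDiv v g) (h' : HasWeakDiv v g') : g = g' := by
  have hmem : MemLp (fun x => g x - g' x) 2 (volume.restrict Ω) := (Lp.memLp g).sub (Lp.memLp g')
  have hloc : LocallyIntegrable (fun x => g x - g' x) (volume.restrict Ω) :=
    hmem.locallyIntegrable (by norm_num)
  have key : ∀ᵐ x ∂(volume.restrict Ω), x ∈ Ω → g x - g' x = 0 := by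
    refine hΩ.ae_eq_zero_of_integral_contDiff_smul_eq_zero (hloc.locallyIntegrableOn Ω) ?_
    intro φ h1 h2 h3
    have e := (h φ h1 h2 h3).symm.trans (h' φ h1 h2 h3)
    have hφ : MemLp φ 2 (volume.restrict Ω) := h1.continuous.memLp_of_hasCompactSupport h2
    have i1 : Integrable (fun x => g x * φ x) (volume.restrict Ω) := (Lp.memLp g).integrable_mul hφ
    have i2 : Integrable (fun x => g' x * φ x) (volume.restrict Ω) :=
      (Lp.memLp g').integrable_mul hφ
    have : ∀ x, φ x • (g x - g' x) = g x * φ x - g' x * φ x := fun x => by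
      simp only [smul_eq_mul]; ring
    simp only [this]
    rw [integral_sub i1 i2]
    linarith
  refine Lp.ext ?_
  filter_upwards [key, ae_restrict_mem hΩ.measurableSet] with x hx hm
  linarith [hx hm]

/-- `weakDiv v` is the weak divergence of `v`, whenever there is one. -/
theorem HasWeakDiv.weakDiv_eq {d : ℕ} {Ω : Set (Pt d)} (hΩ : IsOpen Ω) {v : L2v Ω} {g : L2 Ω}
    (h : HasWeakDiv v g) : weakDiv v = g := by
  have hex : ∃ g : L2 Ω, HasWeakDiv v g := ⟨g, h⟩
  rw [weakDiv, dif_pos hex]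
  exact HasWeakDiv.unique hΩ hex.choose_spec h

/-! ### Meshes and the lowest order Raviart–Thomas spaces -/

/-- A decomposition of `Ω` into closed `d`-simplices: a finite simplicial complex (so any two
simplices meet in a common face or not at all) whose `d`-simplices cover `closure Ω` exactly. -/
structure Mesh {d : ℕ} (Ω : Set (Pt d)) where
  cplx : Geometry.SimplicialComplex ℝ (Pt d)
  finite_faces : cplx.faces.Finite
  cover : ⋃ T ∈ {T ∈ cplx.faces | T.card = d + 1}, convexHull ℝ (T : Set (Pt d)) = closure Ω

namespace Mesh

variable {d : ℕ} {Ω : Set (Pt d)}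

/-- The elements of the mesh, given by their sets of `d + 1` vertices. -/
def cells (𝒯 : Mesh Ω) : Set (Finset (Pt d)) := {T ∈ 𝒯.cplx.faces | T.card = d + 1}

/-- Shape regularity with parameter `σ`: `h_T ≤ σ ρ_T` for every element `T`, where `h_T` is the
diameter of `T` and `ρ_T` the diameter of the largest ball inside `T`. -/
def ShapeRegular (𝒯 : Mesh Ω) (σ : ℝ) : Prop :=
  ∀ T ∈ 𝒯.cells, ∃ z : Pt d, ∃ r : ℝ, 0 < r ∧
    Metric.closedBall z r ⊆ convexHull ℝ (T : Set (Pt d)) ∧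
    Metric.diam (convexHull ℝ (T : Set (Pt d))) ≤ σ * (2 * r)

/-- `W_h`: the piecewise constant functions. -/
def W (𝒯 : Mesh Ω) : Set (L2 Ω) :=
  {w | ∀ T ∈ 𝒯.cells, ∃ c : ℝ,
    ∀ᵐ x ∂(volume.restrict Ω), x ∈ convexHull ℝ (T : Set (Pt d)) → w x = c}

/-- `V_h`: the fields in `H(div; Ω)` of the form `a_T + b_T x` on every element `T`. -/
def V (𝒯 : Mesh Ω) : Set (L2v Ω) :=
  {v | v ∈ Hdiv Ω ∧ ∀ T ∈ 𝒯.cells, ∃ (a : Pt d) (b : ℝ),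
    ∀ᵐ x ∂(volume.restrict Ω), x ∈ convexHull ℝ (T : Set (Pt d)) → v x = a + b • x}

end Mesh

/-! ### Coefficient functions and assumptions -/

/-- The coefficient functions of the model. -/
structure Coeffs (d : ℕ) where
  s : ℝ → ℝ
  a : ℝ → ℝ
  fw : ℝ → ℝ
  f1 : ℝ → Pt d
  f2 : ℝ → ℝ
  f3 : ℝ → Pt d

/-- Lipschitz constants and bounds. -/
structure Consts where
  Ls : ℝ≥0
  La : ℝ≥0
  Lfw : ℝ≥0
  Lf1 : ℝ≥0
  Lf2 : ℝ≥0
  Lf3 : ℝ≥0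
  /-- lower bound of `a` -/
  aLow : ℝ
  /-- upper bound of `a` -/
  aUp : ℝ
  /-- bound of `|f_w|` -/
  Mfw : ℝ≥0
  /-- bound of the total fluxes in `L^∞` -/
  Mu : ℝ≥0

/-- The assumptions on the coefficient functions. -/
structure Coeffs.Admissible {d : ℕ} (c : Coeffs d) (B : Consts) : Prop where
  s_mem : ∀ y, c.s y ∈ Set.Icc (0 : ℝ) 1
  s_mono : Monotone c.s
  s_lip : LipschitzWith B.Ls c.s
  a_lip : LipschitzWith B.La c.a
  aLow_pos : 0 < B.aLow
  a_ge : ∀ y, B.aLow ≤ c.a y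
  a_le : ∀ y, c.a y ≤ B.aUp
  f1_lip : LipschitzWith B.Lf1 c.f1
  f2_lip : LipschitzWith B.Lf2 c.f2
  f3_lip : LipschitzWith B.Lf3 c.f3
  fw_lip : LipschitzWith B.Lfw c.fw
  fw_bdd : ∀ y, |c.fw y| ≤ B.Mfw

namespace Consts

/-- The constant `C₁`; here and below `C` is the stability constant of the divergence. -/
def C1 (B : Consts) (C : ℝ) : ℝ :=
  4 * ((B.Mu : ℝ) ^ 2 * (B.La : ℝ) ^ 2 + (B.Lf3 : ℝ) ^ 2
      + 2 * B.aUp ^ 2 * C ^ 2 * (B.Lf2 : ℝ) ^ 2) / B.aLow ^ 2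
    + ((B.Mu : ℝ) * B.La + B.Lf3) ^ 2 / B.aUp ^ 2

/-- The constant `C₂`. -/
def C2 (B : Consts) (C : ℝ) : ℝ :=
  2 * C ^ 2 * B.aUp ^ 2 * B.C1 C + 2 * C ^ 2 * ((B.Mu : ℝ) * B.La + B.Lf3) ^ 2

/-- The constant `C₃`. -/
def C3 (B : Consts) (C : ℝ) : ℝ :=
  (B.Mfw : ℝ) ^ 2 * B.C1 C + ((B.Mu : ℝ) * B.Lfw + B.Lf1) ^ 2

/-- The constant `K` in the time step restriction `τ ≤ 1 / (L K)`. -/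
def K (B : Consts) (C : ℝ) : ℝ :=
  B.C3 C + 4 * (B.Lf1 : ℝ) ^ 2 + 8 * (B.Lfw : ℝ) ^ 2 * (B.Mu : ℝ) ^ 2
    + 8 * B.C1 C * (B.Mfw : ℝ) ^ 2

end Consts

/-! ### The discrete problems -/

/-- A quadruple `(Θ, q, p, u)`. -/
@[ext]
structure State {d : ℕ} (Ω : Set (Pt d)) where
  Θ : L2 Ω
  q : L2v Ω
  p : L2 Ω
  u : L2v Ω

/-- The quadruple lies in `W_h × V_h × W_h × V_h`. -/
def State.Mem {d : ℕ} {Ω : Set (Pt d)} (X : State Ω) (𝒯 : Mesh Ω) : Prop :=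
  X.Θ ∈ 𝒯.W ∧ X.q ∈ 𝒯.V ∧ X.p ∈ 𝒯.W ∧ X.u ∈ 𝒯.V

/-- Problem `P_h^n`: `X` solves the nonlinear fully discrete problem with time step `τ` and
complementary pressure `Θprev` at the previous time. -/
def SolvesNonlinear {d : ℕ} {Ω : Set (Pt d)} (𝒯 : Mesh Ω) (c : Coeffs d) (τ : ℝ)
    (Θprev : L2 Ω) (X : State Ω) : Prop :=
  X.Mem 𝒯 ∧
  (∀ w ∈ 𝒯.W, (∫ x in Ω, (c.s (X.Θ x) - c.s (Θprev x)) * w x)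
      + τ * (∫ x in Ω, weakDiv X.q x * w x) = 0) ∧
  (∀ v ∈ 𝒯.V, (∫ x in Ω, inner ℝ (X.q x) (v x)) - (∫ x in Ω, X.Θ x * weakDiv v x)
      - (∫ x in Ω, inner ℝ (c.fw (c.s (X.Θ x)) • X.u x) (v x))
      = (∫ x in Ω, inner ℝ (c.f1 (c.s (X.Θ x))) (v x))) ∧
  (∀ w ∈ 𝒯.W, (∫ x in Ω, weakDiv X.u x * w x) = (∫ x in Ω, c.f2 (c.s (X.Θ x)) * w x)) ∧
  (∀ v ∈ 𝒯.V, (∫ x in Ω, inner ℝ (c.a (c.s (X.Θ x)) • X.u x) (v x))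
      - (∫ x in Ω, X.p x * weakDiv v x)
      + (∫ x in Ω, inner ℝ (c.f3 (c.s (X.Θ x))) (v x)) = 0)

/-- Problem `P_h^{n,i}`: `X` solves the linear problem of one step of the `L`-scheme, `Θold` being
the complementary pressure of the previous iterate. -/
def SolvesLStep {d : ℕ} {Ω : Set (Pt d)} (𝒯 : Mesh Ω) (c : Coeffs d) (L τ : ℝ)
    (Θprev Θold : L2 Ω) (X : State Ω) : Prop :=
  X.Mem 𝒯 ∧
  (∀ w ∈ 𝒯.W, (∫ x in Ω, (L * (X.Θ x - Θold x) + c.s (Θold x)) * w x)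
      + τ * (∫ x in Ω, weakDiv X.q x * w x) = (∫ x in Ω, c.s (Θprev x) * w x)) ∧
  (∀ v ∈ 𝒯.V, (∫ x in Ω, inner ℝ (X.q x) (v x)) - (∫ x in Ω, X.Θ x * weakDiv v x)
      - (∫ x in Ω, inner ℝ (c.fw (c.s (Θold x)) • X.u x) (v x))
      = (∫ x in Ω, inner ℝ (c.f1 (c.s (Θold x))) (v x))) ∧
  (∀ w ∈ 𝒯.W, (∫ x in Ω, weakDiv X.u x * w x) = (∫ x in Ω, c.f2 (c.s (Θold x)) * w x)) ∧
  (∀ v ∈ 𝒯.V, (∫ x in Ω, inner ℝ (c.a (c.s (Θold x)) • X.u x) (v x))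
      - (∫ x in Ω, X.p x * weakDiv v x)
      + (∫ x in Ω, inner ℝ (c.f3 (c.s (Θold x))) (v x)) = 0)

/-- `‖s(Θ) - s(Θ')‖²` in `L²(Ω)`. -/
def satDistSq {d : ℕ} {Ω : Set (Pt d)} (c : Coeffs d) (Θ Θ' : L2 Ω) : ℝ :=
  ∫ x in Ω, (c.s (Θ x) - c.s (Θ' x)) ^ 2

/-- The error bounds: `X, Y` are two quadruples whose difference is estimated by the difference of
the complementary pressures `Θ, Θ'` from which they were obtained. -/
structure ErrorBounds {d : ℕ} {Ω : Set (Pt d)} (c : Coeffs d) (B : Consts) (C L τ : ℝ)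
    (Θ Θ' : L2 Ω) (X Y : State Ω) : Prop where
  u_bound : ‖X.u - Y.u‖ ^ 2 ≤ B.C1 C * satDistSq c Θ Θ'
  div_u_bound : ‖weakDiv (X.u - Y.u)‖ ^ 2 ≤ (B.Lf2 : ℝ) ^ 2 * satDistSq c Θ Θ'
  p_bound : ‖X.p - Y.p‖ ^ 2 ≤ B.C2 C * satDistSq c Θ Θ'
  q_lower : 1 / (3 * C ^ 2) * ‖X.Θ - Y.Θ‖ ^ 2 - B.C3 C * satDistSq c Θ Θ' ≤ ‖X.q - Y.q‖ ^ 2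
  contraction :
    ‖X.Θ - Y.Θ‖ ^ 2 + 3 * C ^ 2 * τ / (2 * (3 * C ^ 2 * L + τ)) * ‖X.q - Y.q‖ ^ 2
      + 3 * C ^ 2 * (1 - τ * L * B.K C) / (L * (3 * C ^ 2 * L + τ)) * satDistSq c Θ Θ'
    ≤ 3 * C ^ 2 * L / (3 * C ^ 2 * L + τ) * ‖Θ - Θ'‖ ^ 2

end TwoPhase

end

/-!
Stability of the divergence. By Gauss' theorem on the cells, the fields of `V_h` are the flows on
the dual graph of the mesh, whose vertices are the cells and whose edges are the facets: the fluxes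
through the facets of a cell are prescribed, and the divergence is their sum divided by the volume.
A right inverse of the divergence is thus provided by the graph Laplacian, and its norm is
controlled by a discrete Poincaré inequality. No extension operator or regularity theory is needed
for the latter: testing with an explicit flow that has positive sources in all cells, a perturbation
of the field `x ↦ x / d`, gives a constant depending only on `d`, `σ` and the radius of a ball
containing `Ω`.

The scheme. Each step decouples into two linear mixed problems on the finite-dimensional spaces,
for `(p, u)` and for `(Θ, q)`. The equations for the difference of two steps, tested with the
differences themselves, bound the fluxes and pressures by the difference of the saturations; with
`L ≥ L_s`, monotonicity of `s` yields `‖e_s‖² ≤ L ⟨e_s, e_Θ⟩`, which absorbs these bounds as soon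
as `τ L K ≤ 1`. So the step contracts in `Θ`. One more step started from the limit of the `Θ^i` is
a solution of the nonlinear problem, and comparing the iterates with it gives the error estimates.
-/

noncomputable section

namespace TwoPhase

section Simplex

variable {E : Type*} [AddCommGroup E] [Module ℝ E] {T T' : Finset E} {z z' : E}

/-- `T` is the vertex set of a nondegenerate simplex of full dimension. -/
structure IsSimplex (T : Finset E) : Prop where
  indep : AffineIndependent ℝ ((↑) : T → E)
  span_eq_top : affineSpan ℝ (T : Set E) = ⊤

/-- The vertices of a simplex of full dimension as an affine basis. -/
def IsSimplex.affineBasis (hT : IsSimplex T) : AffineBasis T ℝ E where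
  toFun := (↑)
  ind' := hT.indep
  tot' := by rw [Subtype.range_coe_subtype]; exact hT.span_eq_top

open Classical in
/-- The barycentric coordinate of the vertex `z` of the simplex `T`, as a total function of `T` and
`z`: it is `0` unless `T` is a simplex and `z` one of its vertices. -/
def baryCoord (T : Finset E) (z : E) : E →ᵃ[ℝ] ℝ :=
  if h : IsSimplex T ∧ z ∈ T then h.1.affineBasis.coord ⟨z, h.2⟩ else 0

namespace IsSimplex

theorem range_affineBasis (hT : IsSimplex T) : Set.range hT.affineBasis = T :=
  Subtype.range_coe

theorem baryCoord_eq_coord (hT : IsSimplex T) (hz : z ∈ T) :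
    baryCoord T z = hT.affineBasis.coord ⟨z, hz⟩ := by
  rw [baryCoord, dif_pos ⟨hT, hz⟩]

theorem baryCoord_self (hT : IsSimplex T) (hz : z ∈ T) : baryCoord T z z = 1 := by
  rw [hT.baryCoord_eq_coord hz]
  exact hT.affineBasis.coord_apply_eq ⟨z, hz⟩

theorem baryCoord_of_mem_erase (hT : IsSimplex T) (hz : z ∈ T) {y : E} [DecidableEq E]
    (hy : y ∈ T.erase z) : baryCoord T z y = 0 := by
  obtain ⟨hne, hyT⟩ := Finset.mem_erase.1 hy
  rw [hT.baryCoord_eq_coord hz]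
  exact hT.affineBasis.coord_apply_ne (i := ⟨z, hz⟩) (j := ⟨y, hyT⟩) (by simpa using hne.symm)

theorem sum_baryCoord (hT : IsSimplex T) (x : E) : ∑ z ∈ T, baryCoord T z x = 1 := by
  rw [← Finset.sum_coe_sort, ← hT.affineBasis.sum_coord_apply_eq_one x]
  exact Finset.sum_congr rfl fun z _ => by rw [hT.baryCoord_eq_coord z.2]

theorem sum_baryCoord_smul (hT : IsSimplex T) (x : E) : ∑ z ∈ T, baryCoord T z x • z = x := by
  rw [← Finset.sum_coe_sort]
  conv_rhs => rw [← hT.affineBasis.linear_combination_coord_eq_self x]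
  exact Finset.sum_congr rfl fun z _ => by rw [hT.baryCoord_eq_coord z.2]; rfl

theorem mem_convexHull_iff (hT : IsSimplex T) {x : E} :
    x ∈ convexHull ℝ (T : Set E) ↔ ∀ z ∈ T, 0 ≤ baryCoord T z x := by
  rw [← hT.range_affineBasis, hT.affineBasis.convexHull_eq_nonneg_coord]
  exact ⟨fun h z hz => hT.baryCoord_eq_coord hz ▸ h ⟨z, hz⟩,
    fun h i => hT.baryCoord_eq_coord i.2 ▸ h i i.2⟩

theorem baryCoord_mem_Icc (hT : IsSimplex T) (hz : z ∈ T) {x : E}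
    (hx : x ∈ convexHull ℝ (T : Set E)) : baryCoord T z x ∈ Set.Icc (0 : ℝ) 1 := by
  refine ⟨hT.mem_convexHull_iff.1 hx z hz, ?_⟩
  rw [← hT.sum_baryCoord x]
  exact Finset.single_le_sum (f := fun z => baryCoord T z x) (hT.mem_convexHull_iff.1 hx) hz

theorem baryCoord_eq_zero_of_mem_convexHull (hT : IsSimplex T) {S : Finset E} (hS : S ⊆ T)
    (hz : z ∈ T) (hzS : z ∉ S) {x : E} (hx : x ∈ convexHull ℝ (S : Set E)) :
    baryCoord T z x = 0 := by
  classical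
  have hconv : Convex ℝ (baryCoord T z ⁻¹' {0}) := (convex_singleton (0 : ℝ)).affine_preimage _
  exact convexHull_min (fun y hy => hT.baryCoord_of_mem_erase hz
    (Finset.mem_erase.2 ⟨ne_of_mem_of_not_mem hy hzS, hS hy⟩)) hconv hx

theorem erase_nonempty [Nontrivial E] [DecidableEq E] (hT : IsSimplex T) (z : E) :
    (T.erase z).Nonempty := by
  rw [Finset.nonempty_iff_ne_empty, Ne, Finset.erase_eq_empty_iff]
  intro h
  have hsub : (T : Set E).Subsingleton := by
    rcases h with rfl | rfl <;> simp
  have := AffineSubspace.subsingleton_of_subsingleton_span_eq_top hsub hT.span_eq_top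
  exact not_subsingleton E this

theorem exists_pos_of_mem_face [Nontrivial E] [DecidableEq E] (hT : IsSimplex T) (z : E) :
    ∃ y ∈ convexHull ℝ ((T.erase z : Finset E) : Set E), ∀ w ∈ T.erase z, 0 < baryCoord T w y := by
  set S := (T.erase z).subtype (· ∈ T)
  have hS : S.map (Function.Embedding.subtype _) = T.erase z :=
    Finset.subtype_map_of_mem fun _ => Finset.mem_of_mem_erase
  have hcentroid : (T.erase z).centroid ℝ id = S.centroid ℝ hT.affineBasis := by
    rw [← hS, Finset.centroid_map]; rfl
  refine ⟨_, Finset.centroid_mem_convexHull _ (hT.erase_nonempty z), fun w hw => ?_⟩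
  have hwT := Finset.mem_of_mem_erase hw
  have hwS : (⟨w, hwT⟩ : T) ∈ S := Finset.mem_subtype.2 hw
  rw [hcentroid, hT.baryCoord_eq_coord hwT, AffineBasis.coord_apply_centroid _ hwS]
  exact inv_pos.2 (Nat.cast_pos.2 (Finset.card_pos.2 ⟨_, hwS⟩))

theorem exists_sum_smul_sub_eq (hT : IsSimplex T) (a : E) (b : ℝ) :
    ∃ c : T → ℝ, ∑ z, c z = b ∧ ∀ x, ∑ z, c z • (x - (z : E)) = a + b • x := by
  let c (z : E) : ℝ := b * baryCoord T z 0 - (baryCoord T z a - baryCoord T z 0)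
  refine ⟨fun z => c z, ?_, fun x => ?_⟩
  · rw [Finset.sum_coe_sort T c]
    simp only [c, Finset.sum_sub_distrib, ← Finset.mul_sum, hT.sum_baryCoord]
    ring
  · rw [Finset.sum_coe_sort T fun z => c z • (x - z)]
    simp only [c, smul_sub, sub_smul, mul_smul, Finset.sum_sub_distrib, ← Finset.smul_sum,
      hT.sum_baryCoord_smul, ← Finset.sum_smul, hT.sum_baryCoord]
    module

end IsSimplex

variable [DecidableEq E]

/-- The simplices `T` and `T'` share the face that is opposite to the vertex `z` in `T` and opposite
to the vertex `z'` in `T'`. -/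
structure ShareFace (T : Finset E) (z : E) (T' : Finset E) (z' : E) : Prop where
  left : IsSimplex T
  right : IsSimplex T'
  mem_left : z ∈ T
  mem_right : z' ∈ T'
  erase_eq : T'.erase z' = T.erase z

namespace ShareFace

theorem symm (h : ShareFace T z T' z') : ShareFace T' z' T z :=
  ⟨h.right, h.left, h.mem_right, h.mem_left, h.erase_eq.symm⟩

theorem notMem_of_ne (h : ShareFace T z T' z') (hne : T' ≠ T) : z ∉ T' := by
  intro hz
  have hzz' : z' = z := by
    by_contra hne'
    have := Finset.mem_erase.2 ⟨Ne.symm hne', hz⟩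
    rw [h.erase_eq] at this
    exact Finset.notMem_erase _ _ this
  apply hne
  rw [← Finset.insert_erase h.mem_right, h.erase_eq, hzz', Finset.insert_erase h.mem_left]

theorem convexHull_erase_subset_right (h : ShareFace T z T' z') :
    convexHull ℝ ((T.erase z : Finset E) : Set E) ⊆ convexHull ℝ (T' : Set E) := by
  rw [← h.erase_eq]
  exact convexHull_mono (Finset.coe_subset.2 (Finset.erase_subset z' T'))

theorem baryCoord_eq_mul (h : ShareFace T z T' z') (x : E) :
    baryCoord T z x = baryCoord T z z' * baryCoord T' z' x := by
  suffices baryCoord T z = baryCoord T z z' • baryCoord T' z' from DFunLike.congr_fun this x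
  refine AffineMap.ext_on h.right.span_eq_top fun y hy => ?_
  by_cases hyz : y = z'
  · simp [hyz, h.right.baryCoord_self h.mem_right]
  · have hyT' : y ∈ T'.erase z' := Finset.mem_erase.2 ⟨hyz, hy⟩
    have hyT : y ∈ T.erase z := h.erase_eq ▸ hyT'
    simp [h.left.baryCoord_of_mem_erase h.mem_left hyT,
      h.right.baryCoord_of_mem_erase h.mem_right hyT']

theorem baryCoord_ne_zero (h : ShareFace T z T' z') : baryCoord T z z' ≠ 0 := fun h0 => by
  simpa [h.left.baryCoord_self h.mem_left, h0] using h.baryCoord_eq_mul z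

end ShareFace

end Simplex

section NormedSimplex

variable {E : Type*} [NormedAddCommGroup E] [NormedSpace ℝ E] {T : Finset E} {z : E}

theorem isCompact_convexHull_finset (T : Finset E) : IsCompact (convexHull ℝ (T : Set E)) :=
  T.finite_toSet.isCompact_convexHull (𝕜 := ℝ)

namespace IsSimplex

theorem mem_interior_convexHull_iff (hT : IsSimplex T) {x : E} :
    x ∈ interior (convexHull ℝ (T : Set E)) ↔ ∀ z ∈ T, 0 < baryCoord T z x := by
  rw [← hT.range_affineBasis, hT.affineBasis.interior_convexHull]
  exact ⟨fun h z hz => hT.baryCoord_eq_coord hz ▸ h ⟨z, hz⟩,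
    fun h i => hT.baryCoord_eq_coord i.2 ▸ h i i.2⟩

theorem interior_nonempty [FiniteDimensional ℝ E] (hT : IsSimplex T) :
    (interior (convexHull ℝ (T : Set E))).Nonempty :=
  interior_convexHull_nonempty_iff_affineSpan_eq_top.2 hT.span_eq_top

theorem addHaar_real_pos [FiniteDimensional ℝ E] [MeasurableSpace E] (μ : Measure E)
    [μ.IsOpenPosMeasure] [IsFiniteMeasureOnCompacts μ] (hT : IsSimplex T) :
    0 < μ.real (convexHull ℝ (T : Set E)) :=
  ENNReal.toReal_pos (Measure.measure_pos_of_nonempty_interior μ hT.interior_nonempty).ne'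
    (isCompact_convexHull_finset T).measure_ne_top

end IsSimplex

theorem abs_linear_mul_le_norm {f : E →ᵃ[ℝ] ℝ} {w : E} {r : ℝ} (hr : 0 ≤ r)
    (hf : ∀ x ∈ Metric.closedBall w r, f x ∈ Set.Icc (0 : ℝ) 1) (v : E) :
    |f.linear v| * (2 * r) ≤ ‖v‖ := by
  rcases eq_or_ne v 0 with rfl | hv
  · simp
  have hv' : 0 < ‖v‖ := norm_pos_iff.2 hv
  have hmem : ∀ t : ℝ, |t| ≤ r → f (w + (t / ‖v‖) • v) ∈ Set.Icc (0 : ℝ) 1 := fun t ht =>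
    hf _ (by simpa [norm_smul, hv'.ne'] using ht)
  have hdiff : f (w + (r / ‖v‖) • v) - f (w + (-r / ‖v‖) • v) = f.linear v * (2 * r) / ‖v‖ := by
    rw [← vsub_eq_sub, ← f.linearMap_vsub, vsub_eq_sub, add_sub_add_left_eq_sub, ← sub_smul,
      map_smul, smul_eq_mul]
    ring
  have hplus := hmem r (abs_of_nonneg hr).le
  have hminus := hmem (-r) (by rw [abs_neg, abs_of_nonneg hr])
  have habs : |f.linear v * (2 * r) / ‖v‖| ≤ 1 := by
    rw [← hdiff]
    exact abs_sub_le_of_le_of_le hplus.1 hplus.2 hminus.1 hminus.2 |>.trans (by simp)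
  rwa [abs_div, abs_norm, div_le_one hv', abs_mul, abs_of_nonneg (mul_nonneg zero_le_two hr)]
    at habs

theorem IsSimplex.abs_baryCoord_sub_mul_le (hT : IsSimplex T) (hz : z ∈ T) {w : E} {r : ℝ}
    (hr : 0 ≤ r) (hball : Metric.closedBall w r ⊆ convexHull ℝ (T : Set E)) (x y : E) :
    |baryCoord T z x - baryCoord T z y| * (2 * r) ≤ dist x y := by
  rw [← vsub_eq_sub, ← AffineMap.linearMap_vsub, vsub_eq_sub, dist_eq_norm]
  exact abs_linear_mul_le_norm hr (fun _ hx => hT.baryCoord_mem_Icc hz (hball hx)) _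

theorem IsSimplex.two_mul_le_dist (hT : IsSimplex T) {a b : E} (ha : a ∈ T) (hb : b ∈ T)
    (hab : a ≠ b) {w : E} {r : ℝ} (hr : 0 ≤ r)
    (hball : Metric.closedBall w r ⊆ convexHull ℝ (T : Set E)) : 2 * r ≤ dist a b := by
  classical
  have h := hT.abs_baryCoord_sub_mul_le ha hr hball a b
  rwa [hT.baryCoord_self ha, hT.baryCoord_of_mem_erase ha (Finset.mem_erase.2 ⟨hab.symm, hb⟩),
    sub_zero, abs_one, one_mul] at h

end NormedSimplex

theorem hasDerivAt_setIntegral_of_continuous {X : Type*} [TopologicalSpace X] [T2Space X]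
    [MeasurableSpace X] [OpensMeasurableSpace X] {μ : Measure X} [IsFiniteMeasureOnCompacts μ]
    {K : Set X} (hK : IsCompact K) {F F' : ℝ → X → ℝ} (hF : Continuous (Function.uncurry F))
    (hF' : Continuous (Function.uncurry F')) (h : ∀ t x, HasDerivAt (F · x) (F' t x) t) (t₀ : ℝ) :
    HasDerivAt (fun t => ∫ x in K, F t x ∂μ) (∫ x in K, F' t₀ x ∂μ) t₀ := by
  have hInt : ∀ {G : ℝ → X → ℝ}, Continuous (Function.uncurry G) → ∀ t, IntegrableOn (G t) K μ :=
    fun hG t => (hG.comp (Continuous.prodMk_right t)).continuousOn.integrableOn_compact' hK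
      hK.measurableSet
  obtain ⟨M, hM⟩ := ((isCompact_closedBall t₀ 1).prod hK).exists_bound_of_continuousOn
    hF'.continuousOn
  refine (hasDerivAt_integral_of_dominated_loc_of_deriv_le (bound := fun _ => M)
    (Metric.closedBall_mem_nhds t₀ one_pos)
    (Eventually.of_forall fun t => (hInt hF t).aestronglyMeasurable) (hInt hF t₀)
    (hInt hF' t₀).aestronglyMeasurable ?_ (integrableOn_const hK.measure_ne_top)
    (ae_of_all _ fun x t _ => h t x)).2
  filter_upwards [ae_restrict_mem hK.measurableSet] with x hx t ht using hM (t, x) ⟨ht, hx⟩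

section AffineMap

variable {E F : Type*} [NormedAddCommGroup E] [NormedSpace ℝ E] [FiniteDimensional ℝ E]
  [NormedAddCommGroup F] [NormedSpace ℝ F]

theorem hasFDerivAt_affineMap (f : E →ᵃ[ℝ] F) (x : E) :
    HasFDerivAt f (LinearMap.toContinuousLinearMap f.linear) x :=
  (⟨f, f.continuous_of_finiteDimensional⟩ : E →ᴬ[ℝ] F).hasFDerivAt

theorem contDiff_affineMap (f : E →ᵃ[ℝ] F) {n : WithTop ℕ∞} : ContDiff ℝ n f :=
  (⟨f, f.continuous_of_finiteDimensional⟩ : E →ᴬ[ℝ] F).contDiff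

variable [MeasurableSpace E] [BorelSpace E] (μ : Measure E) [μ.IsAddHaarMeasure]

theorem setIntegral_image_affineMap (f : E →ᵃ[ℝ] E) (hf : f.linear.det ≠ 0) {s : Set E}
    (hs : MeasurableSet s) (g : E → ℝ) :
    ∫ x in f '' s, g x ∂μ = |f.linear.det| * ∫ x in s, g (f x) ∂μ := by
  have hinj : Function.Injective f := f.linear_injective_iff.1 <| LinearMap.ker_eq_bot.1 <|
    (LinearMap.isUnit_iff_ker_eq_bot _).1 <| (LinearMap.isUnit_iff_isUnit_det _).2 hf.isUnit
  rw [integral_image_eq_integral_abs_det_fderiv_smul μ hs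
    (fun x _ => (hasFDerivAt_affineMap f x).hasFDerivWithinAt) hinj.injOn]
  simp only [LinearMap.det_toContinuousLinearMap, smul_eq_mul, integral_const_mul]

end AffineMap

section Cone

variable {E : Type*} [NormedAddCommGroup E] [NormedSpace ℝ E] {S : Set E} {z : E}

theorem exists_mem_convexHull_dist_le {t : ℝ} (ht : 0 < t) {x : E} (hS : S.Nonempty)
    (hx : x ∈ convexHull ℝ (insert z S))
    (hxt : x ∉ AffineMap.homothety z t '' convexHull ℝ (insert z S)) :
    ∃ y ∈ convexHull ℝ S, dist x y ≤ (1 - t) * dist z y := by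
  rw [convexHull_insert hS, mem_convexJoin] at hx
  obtain ⟨_, rfl, y, hy, hxseg⟩ := hx
  rename_i z
  rw [segment_eq_image_lineMap] at hxseg
  obtain ⟨b, ⟨hb0, hb1⟩, rfl⟩ := hxseg
  refine ⟨y, hy, ?_⟩
  rw [dist_lineMap_right, Real.norm_of_nonneg (sub_nonneg.2 hb1)]
  refine mul_le_mul_of_nonneg_right (sub_le_sub_left (le_of_not_gt fun hbt => hxt ?_) 1) dist_nonneg
  refine ⟨AffineMap.lineMap z y (b / t), ?_, ?_⟩
  · exact (convex_convexHull ℝ _).lineMap_mem (subset_convexHull ℝ _ (Set.mem_insert _ _))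
      (convexHull_mono (Set.subset_insert _ _) hy) ⟨by positivity, (div_le_one ht).2 hbt.le⟩
  · rw [AffineMap.homothety_eq_lineMap, AffineMap.lineMap_apply_module',
      AffineMap.lineMap_apply_module', add_sub_cancel_right, smul_smul, mul_div_cancel₀ _ ht.ne',
      ← AffineMap.lineMap_apply_module']

theorem exists_abs_le_of_notMem_homothety_image (hSfin : S.Finite) (hS : S.Nonempty) {ψ : E → ℝ}
    (hψ : ContDiff ℝ 1 ψ) (h0 : ∀ y ∈ convexHull ℝ S, ψ y = 0) :
    ∃ M : ℝ, ∀ t ∈ Set.Ioo (0 : ℝ) 1, ∀ x ∈ convexHull ℝ (insert z S),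
      x ∉ AffineMap.homothety z t '' convexHull ℝ (insert z S) → |ψ x| ≤ M * (1 - t) := by
  set K := convexHull ℝ (insert z S)
  have hK : IsCompact K := (hSfin.insert z).isCompact_convexHull (𝕜 := ℝ)
  obtain ⟨M, hM⟩ := hψ.contDiffOn.exists_lipschitzOnWith one_ne_zero (convex_convexHull ℝ _) hK
  refine ⟨M * Metric.diam K, fun t ht x hx hxt => ?_⟩
  obtain ⟨y, hy, hxy⟩ := exists_mem_convexHull_dist_le ht.1 hS hx hxt
  have hyK : y ∈ K := convexHull_mono (Set.subset_insert _ _) hy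
  have hzy := Metric.dist_le_diam_of_mem hK.isBounded
    (subset_convexHull ℝ _ (Set.mem_insert z S)) hyK
  calc |ψ x| = dist (ψ x) (ψ y) := by rw [h0 y hy, Real.dist_0_eq_abs]
    _ ≤ M * dist x y := hM.dist_le_mul x hx y hyK
    _ ≤ M * ((1 - t) * Metric.diam K) := by
      have := sub_pos.2 ht.2
      gcongr
      exact hxy.trans (by gcongr)
    _ = M * Metric.diam K * (1 - t) := by ring

/-- The divergence of the field `x ↦ φ x • (x - z)`. -/
def radialDiv (φ : E → ℝ) (z x : E) : ℝ := Module.finrank ℝ E * φ x + fderiv ℝ φ x (x - z)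

theorem continuous_radialDiv {φ : E → ℝ} (hφ : ContDiff ℝ 1 φ) (z : E) :
    Continuous (radialDiv φ z) := by
  have hc := hφ.continuous
  have hd : Continuous fun x => fderiv ℝ φ x (x - z) :=
    (hφ.continuous_fderiv one_ne_zero).clm_apply (continuous_sub_right z)
  unfold radialDiv
  fun_prop

variable [MeasurableSpace E] [BorelSpace E] (μ : Measure E)

theorem hasDerivAt_integral_homothety [IsFiniteMeasureOnCompacts μ] {K : Set E} (hK : IsCompact K)
    {ψ : E → ℝ} (hψ : ContDiff ℝ 1 ψ) (z : E) :
    HasDerivAt (fun t : ℝ => ∫ x in K, t ^ Module.finrank ℝ E * ψ (AffineMap.homothety z t x) ∂μ)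
      (∫ x in K, radialDiv ψ z x ∂μ) 1 := by
  set n := Module.finrank ℝ E with hn
  have hψc := hψ.continuous
  have hψd : Continuous fun q : ℝ × E => fderiv ℝ ψ (q.1 • (q.2 - z) + z) (q.2 - z) :=
    ((hψ.continuous_fderiv one_ne_zero).comp (by fun_prop)).clm_apply (by fun_prop)
  have hderiv : ∀ (t : ℝ) (x : E), HasDerivAt (fun t : ℝ => t ^ n * ψ (t • (x - z) + z))
      (n * t ^ (n - 1) * ψ (t • (x - z) + z) + t ^ n * fderiv ℝ ψ (t • (x - z) + z) (x - z)) t := by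
    intro t x
    have hline : HasDerivAt (fun t : ℝ => t • (x - z) + z) (x - z) t := by
      simpa using ((hasDerivAt_id t).smul_const (x - z)).add_const z
    exact (hasDerivAt_pow n t).mul
      ((hψ.differentiable one_ne_zero _).hasFDerivAt.comp_hasDerivAt t hline)
  have := hasDerivAt_setIntegral_of_continuous (μ := μ) hK
    (F := fun t x => t ^ n * ψ (t • (x - z) + z))
    (F' := fun t x => n * t ^ (n - 1) * ψ (t • (x - z) + z)
      + t ^ n * fderiv ℝ ψ (t • (x - z) + z) (x - z))
    (by unfold Function.uncurry; fun_prop) (by unfold Function.uncurry; fun_prop) hderiv 1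
  simpa [radialDiv, AffineMap.homothety_apply, hn] using this

variable [FiniteDimensional ℝ E] [μ.IsAddHaarMeasure]

theorem abs_integral_homothety_sub_le {K : Set E} (hK : IsCompact K) (hconv : Convex ℝ K)
    (hz : z ∈ K) {ψ : E → ℝ} (hψ : Continuous ψ) {t b : ℝ} (ht : t ∈ Set.Ioo (0 : ℝ) 1)
    (hb : ∀ x ∈ K, x ∉ AffineMap.homothety z t '' K → |ψ x| ≤ b) :
    |(∫ x in K, t ^ Module.finrank ℝ E * ψ (AffineMap.homothety z t x) ∂μ) - ∫ x in K, ψ x ∂μ|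
      ≤ b * ((1 - t ^ Module.finrank ℝ E) * μ.real K) := by
  set n := Module.finrank ℝ E with hn
  have ht0 : 0 < t ^ n := pow_pos ht.1 n
  set Kt := AffineMap.homothety z t '' K
  have hsub : Kt ⊆ K := by
    rintro _ ⟨x, hx, rfl⟩
    exact AffineMap.homothety_eq_lineMap z t x ▸
      hconv.lineMap_mem hz hx (Set.Ioo_subset_Icc_self ht)
  have hdet : (AffineMap.homothety z t : E →ᵃ[ℝ] E).linear.det = t ^ n := by simp [hn]
  have hKt : MeasurableSet Kt :=
    (hK.image (AffineMap.homothety z t).continuous_of_finiteDimensional).measurableSet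
  have hscale : ∀ g : E → ℝ, ∫ x in Kt, g x ∂μ
      = t ^ n * ∫ x in K, g (AffineMap.homothety z t x) ∂μ := fun g => by
    rw [setIntegral_image_affineMap μ _ (hdet ▸ ht0.ne') hK.measurableSet, hdet, abs_of_pos ht0]
  have hvol : μ.real (K \ Kt) = (1 - t ^ n) * μ.real K := by
    have := hscale fun _ => 1
    simp only [integral_const, measureReal_restrict_apply_univ, smul_eq_mul, mul_one] at this
    rw [measureReal_sdiff hsub hKt hK.measure_ne_top, this]
    ring
  rw [integral_const_mul, ← hscale, abs_sub_comm,
    ← setIntegral_sdiff hKt (hψ.continuousOn.integrableOn_compact hK) hsub, ← hvol,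
    ← Real.norm_eq_abs]
  exact norm_setIntegral_le_of_norm_le_const
    ((measure_mono Set.sdiff_subset).trans_lt hK.measure_lt_top) fun x hx => hb x hx.1 hx.2

/-- Gauss' theorem on a cone for a field tangential to the lateral boundary. The derivative
at `t = 1` of the integral of `ψ` over the cone contracted by the factor `t` is computed in two
ways. -/
theorem integral_radialDiv_eq_zero (hSfin : S.Finite) (hS : S.Nonempty) (z : E) {ψ : E → ℝ}
    (hψ : ContDiff ℝ 1 ψ) (h0 : ∀ y ∈ convexHull ℝ S, ψ y = 0) :
    ∫ x in convexHull ℝ (insert z S), radialDiv ψ z x ∂μ = 0 := by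
  set K := convexHull ℝ (insert z S)
  have hK : IsCompact K := (hSfin.insert z).isCompact_convexHull (𝕜 := ℝ)
  obtain ⟨M, hM⟩ := exists_abs_le_of_notMem_homothety_image (z := z) hSfin hS hψ h0
  set n := Module.finrank ℝ E
  set I : ℝ → ℝ := fun t => ∫ x in K, t ^ n * ψ (AffineMap.homothety z t x) ∂μ with hI
  have hI1 : I 1 = ∫ x in K, ψ x ∂μ := by simp [hI]
  have hzero : HasDerivWithinAt I 0 (Set.Iio 1) 1 := by
    rw [hasDerivWithinAt_iff_tendsto_slope' Set.self_notMem_Iio]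
    refine squeeze_zero_norm' (a := fun t => M * ((1 - t ^ n) * μ.real K)) ?_ ?_
    · filter_upwards [Ioo_mem_nhdsLT (zero_lt_one (α := ℝ))] with t ht
      have h1t : 0 < 1 - t := sub_pos.2 ht.2
      rw [slope_def_field, Real.norm_eq_abs, abs_div, abs_sub_comm t 1, abs_of_pos h1t,
        div_le_iff₀ h1t, hI1]
      refine (abs_integral_homothety_sub_le μ hK (convex_convexHull ℝ _)
        (subset_convexHull ℝ _ (Set.mem_insert _ _)) hψ.continuous ht (hM t ht)).trans_eq ?_
      ring
    · refine Tendsto.mono_left (Continuous.tendsto' (by fun_prop) _ _ ?_) nhdsWithin_le_nhds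
      simp
  exact (uniqueDiffWithinAt_Iio (1 : ℝ)).eq_deriv _
    (hasDerivAt_integral_homothety μ hK hψ z).hasDerivWithinAt hzero

end Cone

section FaceMap

variable {E : Type*} [AddCommGroup E] [Module ℝ E]

/-- The affine map that fixes the face of the simplex `T` opposite to `z` and sends `z` to `z'`. -/
def faceMap (T : Finset E) (z z' : E) : E →ᵃ[ℝ] E :=
  AffineMap.id ℝ E + (LinearMap.toSpanSingleton ℝ E (z' - z)).toAffineMap.comp (baryCoord T z)

theorem faceMap_apply (T : Finset E) (z z' x : E) :
    faceMap T z z' x = x + baryCoord T z x • (z' - z) := by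
  simp [faceMap]

theorem faceMap_linear (T : Finset E) (z z' : E) :
    (faceMap T z z').linear = LinearMap.transvection (baryCoord T z).linear (z' - z) := by
  ext x
  simp [faceMap, LinearMap.transvection.apply]

variable {T T' : Finset E} {z z' : E}

namespace IsSimplex

theorem faceMap_self (hT : IsSimplex T) (hz : z ∈ T) : faceMap T z z' z = z' := by
  rw [faceMap_apply, hT.baryCoord_self hz, one_smul, add_sub_cancel]

theorem det_faceMap_linear [FiniteDimensional ℝ E] (hT : IsSimplex T) (hz : z ∈ T) :
    (faceMap T z z').linear.det = baryCoord T z z' := by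
  rw [faceMap_linear, LinearMap.transvection.det, ← vsub_eq_sub z', AffineMap.linearMap_vsub,
    hT.baryCoord_self hz, vsub_eq_sub, add_sub_cancel]

end IsSimplex

variable [DecidableEq E]

theorem ShareFace.faceMap_image (h : ShareFace T z T' z') :
    faceMap T z z' '' convexHull ℝ (T : Set E) = convexHull ℝ (T' : Set E) := by
  have hfix : ∀ y ∈ T.erase z, faceMap T z z' y = y := fun y hy => by
    rw [faceMap_apply, h.left.baryCoord_of_mem_erase h.mem_left hy, zero_smul, add_zero]
  have himage : faceMap T z z' '' T = T' := calc
    faceMap T z z' '' T = insert (faceMap T z z' z) (faceMap T z z' '' (T.erase z : Finset E)) := by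
      rw [← Set.image_insert_eq, ← Finset.coe_insert, Finset.insert_erase h.mem_left]
    _ = insert z' ((T.erase z : Finset E) : Set E) := by
      rw [h.left.faceMap_self h.mem_left, Set.EqOn.image_eq_self hfix]
    _ = T' := by rw [← h.erase_eq, ← Finset.coe_insert, Finset.insert_erase h.mem_right]
  rw [AffineMap.image_convexHull, himage]

end FaceMap

section MeanRadialDiv

variable {E : Type*} [NormedAddCommGroup E] [NormedSpace ℝ E] {T T' : Finset E} {z z' : E}

theorem IsSimplex.radialDiv_comp_faceMap [FiniteDimensional ℝ E] (hT : IsSimplex T)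
    (hz : z ∈ T) {φ : E → ℝ} (hφ : Differentiable ℝ φ) (x : E) :
    radialDiv (φ ∘ faceMap T z z') z x = radialDiv φ z' (faceMap T z z' x) := by
  rw [radialDiv, ((hφ _).hasFDerivAt.comp x (hasFDerivAt_affineMap _ x)).fderiv, radialDiv,
    ContinuousLinearMap.comp_apply, LinearMap.coe_toContinuousLinearMap', ← vsub_eq_sub x,
    AffineMap.linearMap_vsub, hT.faceMap_self hz, vsub_eq_sub, Function.comp_apply]

/-- The mean over the simplex `T` of the divergence of the field `φ x • (x - z)`. By Gauss' theorem
it is, up to a constant factor, the mean of `φ` over the face of `T` opposite to `z`. -/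
def meanRadialDiv [MeasurableSpace E] (μ : Measure E) (φ : E → ℝ) (T : Finset E) (z : E) : ℝ :=
  ⨍ x in convexHull ℝ (T : Set E), radialDiv φ z x ∂μ

variable [FiniteDimensional ℝ E] [MeasurableSpace E] [BorelSpace E] (μ : Measure E)
  [μ.IsAddHaarMeasure] [DecidableEq E]

theorem ShareFace.setIntegral_eq (h : ShareFace T z T' z') (g : E → ℝ) :
    ∫ x in convexHull ℝ (T' : Set E), g x ∂μ
      = |baryCoord T z z'| * ∫ x in convexHull ℝ (T : Set E), g (faceMap T z z' x) ∂μ := by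
  have hdet := h.left.det_faceMap_linear (z' := z') h.mem_left
  rw [← h.faceMap_image, setIntegral_image_affineMap μ _ (hdet ▸ h.baryCoord_ne_zero)
    (isCompact_convexHull_finset T).measurableSet, hdet]

theorem ShareFace.measureReal_eq (h : ShareFace T z T' z') :
    μ.real (convexHull ℝ (T' : Set E))
      = |baryCoord T z z'| * μ.real (convexHull ℝ (T : Set E)) := by
  simpa using h.setIntegral_eq μ fun _ => 1

theorem IsSimplex.meanRadialDiv_congr [Nontrivial E] (hT : IsSimplex T) (hz : z ∈ T) {φ ψ : E → ℝ}
    (hφ : ContDiff ℝ 1 φ) (hψ : ContDiff ℝ 1 ψ)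
    (heq : Set.EqOn φ ψ (convexHull ℝ ((T.erase z : Finset E) : Set E))) :
    meanRadialDiv μ φ T z = meanRadialDiv μ ψ T z := by
  have hK : IsCompact (convexHull ℝ (T : Set E)) := isCompact_convexHull_finset T
  have hzero := integral_radialDiv_eq_zero μ (T.erase z).finite_toSet (hT.erase_nonempty z) z
    (hφ.sub hψ) fun y hy => sub_eq_zero.2 (heq hy)
  rw [← Finset.coe_insert, Finset.insert_erase hz] at hzero
  have hsub : ∀ x, radialDiv (fun y => φ y - ψ y) z x = radialDiv φ z x - radialDiv ψ z x := by
    intro x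
    rw [radialDiv, fderiv_fun_sub (hφ.differentiable one_ne_zero x)
      (hψ.differentiable one_ne_zero x)]
    simp only [radialDiv, sub_apply]
    ring
  simp only [hsub] at hzero
  rw [integral_sub ((continuous_radialDiv hφ z).continuousOn.integrableOn_compact hK)
    ((continuous_radialDiv hψ z).continuousOn.integrableOn_compact hK), sub_eq_zero] at hzero
  rw [meanRadialDiv, meanRadialDiv, setAverage_eq, setAverage_eq, hzero]

theorem ShareFace.meanRadialDiv_eq [Nontrivial E] (h : ShareFace T z T' z') {φ : E → ℝ}
    (hφ : ContDiff ℝ 1 φ) : meanRadialDiv μ φ T' z' = meanRadialDiv μ φ T z := by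
  calc meanRadialDiv μ φ T' z' = meanRadialDiv μ (φ ∘ faceMap T z z') T z := by
        rw [meanRadialDiv, meanRadialDiv, setAverage_eq, setAverage_eq, h.setIntegral_eq μ,
          h.measureReal_eq μ, smul_eq_mul, smul_eq_mul]
        simp only [h.left.radialDiv_comp_faceMap h.mem_left (hφ.differentiable one_ne_zero)]
        have := abs_ne_zero.2 h.baryCoord_ne_zero
        field_simp
    _ = meanRadialDiv μ φ T z := by
        refine h.left.meanRadialDiv_congr μ h.mem_left (hφ.comp (contDiff_affineMap _)) hφ
          fun y hy => ?_
        rw [Function.comp_apply, faceMap_apply, h.left.baryCoord_eq_zero_of_mem_convexHull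
          (Finset.erase_subset z T) h.mem_left (Finset.notMem_erase z T) hy, zero_smul, add_zero]

end MeanRadialDiv

/-! ### Faces of a mesh -/

theorem tendsto_lineMap_nhds {E : Type*} [NormedAddCommGroup E] [NormedSpace ℝ E] (y x : E)
    (s : Set ℝ) : Tendsto (AffineMap.lineMap y x : ℝ → E) (𝓝[s] 0) (𝓝 y) := by
  have h : Tendsto (AffineMap.lineMap y x : ℝ → E) (𝓝 0) (𝓝 (AffineMap.lineMap y x (0 : ℝ))) :=
    AffineMap.lineMap_continuous.tendsto 0
  rw [AffineMap.lineMap_apply_zero] at h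
  exact h.mono_left nhdsWithin_le_nhds

namespace Mesh

variable {d : ℕ} {Ω : Set (Pt d)} (𝒯 : Mesh Ω) {T T' : Finset (Pt d)}

theorem isSimplex (hT : T ∈ 𝒯.cells) : IsSimplex T := by
  have hind := 𝒯.cplx.indep hT.1
  have hspan := hind.affineSpan_eq_top_iff_card_eq_finrank_add_one.2 (by simp [hT.2])
  exact ⟨hind, by simpa using hspan⟩

theorem finite_cells : 𝒯.cells.Finite := 𝒯.finite_faces.subset fun _ h => h.1

theorem iUnion_convexHull_cells :
    ⋃ T ∈ 𝒯.cells, convexHull ℝ (T : Set (Pt d)) = closure Ω := 𝒯.cover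

theorem baryCoord_eq_zero_of_mem_inter (hT : T ∈ 𝒯.cells) (hT' : T' ∈ 𝒯.cells) {x : Pt d}
    (hx : x ∈ convexHull ℝ (T : Set (Pt d))) (hx' : x ∈ convexHull ℝ (T' : Set (Pt d)))
    {z : Pt d} (hz : z ∈ T) (hz' : z ∉ T') : baryCoord T z x = 0 := by
  refine (𝒯.isSimplex hT).baryCoord_eq_zero_of_mem_convexHull
    (S := T ∩ T') Finset.inter_subset_left hz (by simp [hz']) ?_
  rw [Finset.coe_inter]
  exact 𝒯.cplx.inter_subset_convexHull hT.1 hT'.1 ⟨hx, hx'⟩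

theorem baryCoord_opposite_neg [NeZero d] (hT : T ∈ 𝒯.cells) (hT' : T' ∈ 𝒯.cells) (hne : T' ≠ T)
    {z z' : Pt d} (h : ShareFace T z T' z') : baryCoord T z z' < 0 := by
  by_contra! hnonneg
  have hcoord : 0 < baryCoord T z z' := hnonneg.lt_of_ne' h.baryCoord_ne_zero
  obtain ⟨y, hy, hpos⟩ := h.left.exists_pos_of_mem_face z
  have hevent : ∀ᶠ t in 𝓝[>] (0 : ℝ), ∀ w ∈ T.erase z,
      0 < baryCoord T w (AffineMap.lineMap y z' t) := by
    rw [eventually_all_finset]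
    exact fun w hw => (((baryCoord T w).continuous_of_finiteDimensional.tendsto y).comp
      (tendsto_lineMap_nhds y z' _)).eventually_const_lt (hpos w hw)
  obtain ⟨t, ht, ht01⟩ := (hevent.and (Ioo_mem_nhdsGT (zero_lt_one (α := ℝ)))).exists
  set x := AffineMap.lineMap y z' t
  have hxz : 0 < baryCoord T z x := by
    rw [AffineMap.apply_lineMap, AffineMap.lineMap_apply_ring',
      h.left.baryCoord_eq_zero_of_mem_convexHull (Finset.erase_subset z T) h.mem_left
        (Finset.notMem_erase z T) hy, sub_zero, add_zero]
    exact mul_pos ht01.1 hcoord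
  have hxT : x ∈ convexHull ℝ (T : Set (Pt d)) := by
    refine h.left.mem_convexHull_iff.2 fun w hw => ?_
    obtain rfl | hwz := eq_or_ne w z
    · exact hxz.le
    · exact (ht w (Finset.mem_erase.2 ⟨hwz, hw⟩)).le
  have hxT' : x ∈ convexHull ℝ (T' : Set (Pt d)) :=
    (convex_convexHull ℝ _).lineMap_mem (h.convexHull_erase_subset_right hy)
      (subset_convexHull ℝ _ h.mem_right) (Set.Ioo_subset_Icc_self ht01)
  exact hxz.ne'
    (𝒯.baryCoord_eq_zero_of_mem_inter hT hT' hxT hxT' h.mem_left (h.notMem_of_ne hne))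

theorem opposite_unique [NeZero d] {T₁ T₂ : Finset (Pt d)} {z z₁ z₂ : Pt d} (hT : T ∈ 𝒯.cells)
    (hT₁ : T₁ ∈ 𝒯.cells) (hT₂ : T₂ ∈ 𝒯.cells) (hne₁ : T₁ ≠ T) (hne₂ : T₂ ≠ T)
    (h₁ : ShareFace T z T₁ z₁) (h₂ : ShareFace T z T₂ z₂) : T₁ = T₂ ∧ z₁ = z₂ := by
  have h₁₂ : ShareFace T₁ z₁ T₂ z₂ :=
    ⟨h₁.right, h₂.right, h₁.mem_right, h₂.mem_right, h₂.erase_eq.trans h₁.erase_eq.symm⟩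
  have hTT : T₁ = T₂ := by
    by_contra hne
    have hneg := 𝒯.baryCoord_opposite_neg hT₁ hT₂ (Ne.symm hne) h₁₂
    rw [h₁.symm.baryCoord_eq_mul] at hneg
    exact hneg.not_gt (mul_pos_of_neg_of_neg (𝒯.baryCoord_opposite_neg hT₁ hT hne₁.symm h₁.symm)
      (𝒯.baryCoord_opposite_neg hT hT₂ hne₂ h₂))
  refine ⟨hTT, ?_⟩
  subst hTT
  by_contra hne
  have hmem : z₁ ∈ T₁.erase z₂ := Finset.mem_erase.2 ⟨hne, h₁.mem_right⟩
  rw [h₁₂.erase_eq] at hmem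
  exact Finset.notMem_erase _ _ hmem

theorem eventually_mem_cell_imp (y : Pt d) :
    ∀ᶠ x in 𝓝 y, ∀ T ∈ 𝒯.cells, x ∈ convexHull ℝ (T : Set (Pt d)) →
      y ∈ convexHull ℝ (T : Set (Pt d)) := by
  rw [eventually_all_finite 𝒯.finite_cells]
  intro T _
  by_cases hy : y ∈ convexHull ℝ (T : Set (Pt d))
  · exact Eventually.of_forall fun _ _ => hy
  · filter_upwards [(isCompact_convexHull_finset T).isClosed.isOpen_compl.mem_nhds hy] with x hx hx'
    exact absurd hx' hx

theorem notMem_of_pos_of_boundary_face (hΩ : IsOpen Ω) (hT : T ∈ 𝒯.cells) {z : Pt d} (hz : z ∈ T)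
    (hbd : ∀ T' ∈ 𝒯.cells, T.erase z ⊆ T' → T' = T) {y : Pt d}
    (hy : y ∈ convexHull ℝ ((T.erase z : Finset (Pt d)) : Set (Pt d)))
    (hpos : ∀ w ∈ T.erase z, 0 < baryCoord T w y) : y ∉ Ω := by
  intro hyΩ
  have sT := 𝒯.isSimplex hT
  -- Beyond the face, as seen from `z`, a point of `Ω` near `y` would lie in a second cell.
  obtain ⟨t, ⟨hcell, hmem⟩, ht⟩ := (((tendsto_lineMap_nhds y z (Set.Iio 0)).eventually
    ((𝒯.eventually_mem_cell_imp y).and (hΩ.mem_nhds hyΩ))).and self_mem_nhdsWithin).exists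
  obtain ⟨T', hT', hx⟩ := Set.mem_iUnion₂.1 (𝒯.iUnion_convexHull_cells.ge (subset_closure hmem))
  have hneg : baryCoord T z (AffineMap.lineMap y z t) < 0 := by
    rw [AffineMap.apply_lineMap, AffineMap.lineMap_apply_ring', sT.baryCoord_self hz,
      sT.baryCoord_eq_zero_of_mem_convexHull (Finset.erase_subset z T) hz
        (Finset.notMem_erase z T) hy, sub_zero, mul_one, add_zero]
    exact ht
  have hTT' : T' ≠ T := by
    rintro rfl
    exact (sT.mem_convexHull_iff.1 hx z hz).not_gt hneg
  refine hTT' (hbd T' hT' fun w hw => ?_)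
  by_contra hwT'
  exact (hpos w hw).ne' (𝒯.baryCoord_eq_zero_of_mem_inter hT hT'
    (convexHull_mono (Finset.coe_subset.2 (Finset.erase_subset z T)) hy) (hcell T' hT' hx)
    (Finset.mem_of_mem_erase hw) hwT')

theorem eq_zero_on_boundary_face [NeZero d] (hΩ : IsOpen Ω) (hT : T ∈ 𝒯.cells) {z : Pt d}
    (hz : z ∈ T) (hbd : ∀ T' ∈ 𝒯.cells, T.erase z ⊆ T' → T' = T) {φ : Pt d → ℝ}
    (hφ : Continuous φ) (hsupp : tsupport φ ⊆ Ω) {y : Pt d}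
    (hy : y ∈ convexHull ℝ ((T.erase z : Finset (Pt d)) : Set (Pt d))) : φ y = 0 := by
  have sT := 𝒯.isSimplex hT
  obtain ⟨y₀, hy₀, hpos⟩ := sT.exists_pos_of_mem_face z
  have hevent : ∀ᶠ t in 𝓝[>] (0 : ℝ), φ (AffineMap.lineMap y y₀ t) = 0 := by
    filter_upwards [Ioo_mem_nhdsGT (zero_lt_one (α := ℝ))] with t ht
    refine image_eq_zero_of_notMem_tsupport fun hmem => ?_
    refine 𝒯.notMem_of_pos_of_boundary_face hΩ hT hz hbd ((convex_convexHull ℝ _).lineMap_mem hy hy₀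
      (Set.Ioo_subset_Icc_self ht)) (fun w hw => ?_) (hsupp hmem)
    have hyw := sT.mem_convexHull_iff.1 (convexHull_mono
      (Finset.coe_subset.2 (Finset.erase_subset z T)) hy) w (Finset.mem_of_mem_erase hw)
    rw [AffineMap.apply_lineMap, AffineMap.lineMap_apply_ring]
    exact add_pos_of_nonneg_of_pos (mul_nonneg (by linarith [ht.2]) hyw) (mul_pos ht.1 (hpos w hw))
  have hlim := (hφ.tendsto y).comp (tendsto_lineMap_nhds y y₀ (Set.Ioi 0))
  exact tendsto_nhds_unique (hlim.congr' hevent) tendsto_const_nhds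

end Mesh

/-! ### Integration over a mesh -/

namespace Mesh

variable {d : ℕ} {Ω : Set (Pt d)} (𝒯 : Mesh Ω) {T T' : Finset (Pt d)}

instance : Fintype 𝒯.cells := 𝒯.finite_cells.fintype

theorem aedisjoint (hT : T ∈ 𝒯.cells) (hT' : T' ∈ 𝒯.cells) (hne : T ≠ T') :
    AEDisjoint volume (convexHull ℝ (T : Set (Pt d))) (convexHull ℝ (T' : Set (Pt d))) := by
  obtain ⟨z, hz, hzT'⟩ : ∃ z ∈ T, z ∉ T' := by
    by_contra! h
    exact hne (Finset.eq_of_subset_of_card_le h (by rw [hT.2, hT'.2]))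
  let H : AffineSubspace ℝ (Pt d) := (AffineSubspace.mk' (0 : ℝ) ⊥).comap (baryCoord T z)
  have mem_H (x : Pt d) : x ∈ H ↔ baryCoord T z x = 0 := by simp [H]
  have hH : H ≠ ⊤ := by
    intro htop
    have hzH : z ∈ H := htop ▸ AffineSubspace.mem_top ℝ (Pt d) z
    rw [mem_H, (𝒯.isSimplex hT).baryCoord_self hz] at hzH
    exact one_ne_zero hzH
  exact measure_mono_null
    (fun x hx => (mem_H x).2 (𝒯.baryCoord_eq_zero_of_mem_inter hT hT' hx.1 hx.2 hz hzT'))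
    (Measure.addHaar_affineSubspace volume H hH)

theorem ae_notMem_of_ne (hT : T ∈ 𝒯.cells) (hT' : T' ∈ 𝒯.cells) (hne : T ≠ T') :
    ∀ᵐ x ∂(volume.restrict (convexHull ℝ (T : Set (Pt d)))),
      x ∉ convexHull ℝ (T' : Set (Pt d)) := by
  rw [ae_restrict_iff' (isCompact_convexHull_finset T).measurableSet]
  filter_upwards [measure_eq_zero_iff_ae_notMem.1 (𝒯.aedisjoint hT hT' hne)] with x hx h h'
  exact hx ⟨h, h'⟩

theorem interior_cell_subset (hreg : interior (closure Ω) = Ω) (hT : T ∈ 𝒯.cells) :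
    interior (convexHull ℝ (T : Set (Pt d))) ⊆ Ω := by
  rw [← hreg, ← 𝒯.iUnion_convexHull_cells]
  exact interior_mono
    (Set.subset_biUnion_of_mem (u := fun T : Finset (Pt d) => convexHull ℝ (T : Set (Pt d))) hT)

theorem ae_eq_closure (𝒯 : Mesh Ω) (hreg : interior (closure Ω) = Ω) : Ω =ᵐ[volume] closure Ω := by
  refine subset_closure.eventuallyLE.antisymm (ae_le_set.2 ?_)
  have hsub : closure Ω \ Ω ⊆ ⋃ T ∈ 𝒯.cells, frontier (convexHull ℝ (T : Set (Pt d))) := by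
    rintro x ⟨hx, hxΩ⟩
    obtain ⟨T, hT, hxT⟩ := Set.mem_iUnion₂.1 (𝒯.iUnion_convexHull_cells.ge hx)
    exact Set.mem_iUnion₂.2
      ⟨T, hT, subset_closure hxT, fun hi => hxΩ (𝒯.interior_cell_subset hreg hT hi)⟩
  exact measure_mono_null hsub ((measure_biUnion_null_iff 𝒯.finite_cells.countable).2
    fun T _ => (convex_convexHull ℝ _).addHaar_frontier volume)

theorem restrict_eq_sum (hreg : interior (closure Ω) = Ω) :
    volume.restrict Ω
      = ∑ T : 𝒯.cells, volume.restrict (convexHull ℝ (T.1 : Set (Pt d))) := by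
  rw [Measure.restrict_congr_set (𝒯.ae_eq_closure hreg), ← 𝒯.iUnion_convexHull_cells,
    ← Measure.sum_fintype, ← Measure.restrict_iUnion_ae]
  · simp only [Set.iUnion_subtype]
  · exact fun T T' hne => 𝒯.aedisjoint T.2 T'.2 (Subtype.coe_injective.ne hne)
  · exact fun T => (isCompact_convexHull_finset _).measurableSet.nullMeasurableSet

theorem ae_restrict_iff_cells (hreg : interior (closure Ω) = Ω) {P : Pt d → Prop} :
    (∀ᵐ x ∂(volume.restrict Ω), P x) ↔
      ∀ T ∈ 𝒯.cells, ∀ᵐ x ∂(volume.restrict (convexHull ℝ (T : Set (Pt d)))), P x := by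
  simp only [𝒯.restrict_eq_sum hreg, ae_finsetSum_measure_iff, Finset.mem_univ, true_imp_iff,
    Subtype.forall]

theorem ae_mem_cell_imp_iff (hreg : interior (closure Ω) = Ω) (hT : T ∈ 𝒯.cells)
    {P : Pt d → Prop} :
    (∀ᵐ x ∂(volume.restrict Ω), x ∈ convexHull ℝ (T : Set (Pt d)) → P x) ↔
      ∀ᵐ x ∂(volume.restrict (convexHull ℝ (T : Set (Pt d)))), P x := by
  rw [𝒯.ae_restrict_iff_cells hreg]
  refine ⟨fun h => ?_, fun h T' hT' => ?_⟩
  · filter_upwards [h T hT, ae_restrict_mem (isCompact_convexHull_finset T).measurableSet]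
      with x hP hx using hP hx
  · obtain rfl | hne := eq_or_ne T T'
    · filter_upwards [h] with x hx _ using hx
    · filter_upwards [𝒯.ae_notMem_of_ne hT' hT hne.symm] with x hx hx' using absurd hx' hx

theorem integrable_cell (hreg : interior (closure Ω) = Ω) {F : Type*} [NormedAddCommGroup F]
    {f : Pt d → F} (hf : Integrable f (volume.restrict Ω)) (hT : T ∈ 𝒯.cells) :
    Integrable f (volume.restrict (convexHull ℝ (T : Set (Pt d)))) := by
  rw [𝒯.restrict_eq_sum hreg, integrable_finsetSum_measure] at hf
  exact hf ⟨T, hT⟩ (Finset.mem_univ _)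

theorem integral_eq_sum_cells (hreg : interior (closure Ω) = Ω) {F : Type*} [NormedAddCommGroup F]
    [NormedSpace ℝ F] {f : Pt d → F} (hf : Integrable f (volume.restrict Ω)) :
    ∫ x in Ω, f x = ∑ T : 𝒯.cells, ∫ x in convexHull ℝ (T.1 : Set (Pt d)), f x := by
  rw [𝒯.restrict_eq_sum hreg, integral_finsetSum_measure
    fun T _ => 𝒯.integrable_cell hreg hf T.2]

theorem exists_piecewise (hreg : interior (closure Ω) = Ω) {F : Type*} [NormedAddCommGroup F]
    (f : 𝒯.cells → Pt d → F) (hf : ∀ T, Continuous (f T)) :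
    ∃ v : Lp F 2 (volume.restrict Ω), ∀ T : 𝒯.cells,
      ∀ᵐ x ∂(volume.restrict (convexHull ℝ (T.1 : Set (Pt d)))), v x = f T x := by
  have hmem : MemLp (∑ T : 𝒯.cells, (convexHull ℝ (T.1 : Set (Pt d))).indicator (f T)) 2
      (volume.restrict Ω) := by
    refine memLp_finsetSum' _ fun T _ => ?_
    have hK := isCompact_convexHull_finset T.1
    obtain ⟨M, hM⟩ := hK.exists_bound_of_continuousOn (hf T).continuousOn
    have := isFiniteMeasure_restrict.2 (hK.measure_lt_top (μ := volume)).ne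
    rw [memLp_indicator_iff_restrict hK.measurableSet]
    exact (MemLp.of_bound (hf T).aestronglyMeasurable M
      (ae_restrict_of_forall_mem hK.measurableSet hM)).mono_measure
      (Measure.restrict_mono le_rfl Measure.restrict_le_self)
  refine ⟨hmem.toLp _, fun T => ?_⟩
  have hother : ∀ᵐ x ∂(volume.restrict (convexHull ℝ (T.1 : Set (Pt d)))),
      ∀ T' ∈ 𝒯.cells, T.1 ≠ T' → x ∉ convexHull ℝ (T' : Set (Pt d)) :=
    (ae_ball_iff 𝒯.finite_cells.countable).2 fun T' hT' =>
      eventually_imp_distrib_left.2 (𝒯.ae_notMem_of_ne T.2 hT')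
  filter_upwards [(𝒯.ae_restrict_iff_cells hreg).1 hmem.coeFn_toLp T T.2, hother,
    ae_restrict_mem (isCompact_convexHull_finset T.1).measurableSet] with x hx hx' hxT
  rw [hx, Finset.sum_apply, Finset.sum_eq_single T, Set.indicator_of_mem hxT]
  · exact fun T' _ hne =>
      Set.indicator_of_notMem (hx' T' T'.2 (Subtype.coe_injective.ne hne.symm)) _
  · exact fun h => absurd (Finset.mem_univ T) h

theorem mem_W_iff (hreg : interior (closure Ω) = Ω) {w : L2 Ω} :
    w ∈ 𝒯.W ↔ ∀ T ∈ 𝒯.cells, ∃ c : ℝ,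
      ∀ᵐ x ∂(volume.restrict (convexHull ℝ (T : Set (Pt d)))), w x = c :=
  forall₂_congr fun _ hT => exists_congr fun _ => 𝒯.ae_mem_cell_imp_iff hreg hT

theorem mem_V_iff (hreg : interior (closure Ω) = Ω) {v : L2v Ω} :
    v ∈ 𝒯.V ↔ v ∈ Hdiv Ω ∧ ∀ T ∈ 𝒯.cells, ∃ (a : Pt d) (b : ℝ),
      ∀ᵐ x ∂(volume.restrict (convexHull ℝ (T : Set (Pt d)))), v x = a + b • x :=
  and_congr_right fun _ => forall₂_congr fun _ hT => exists_congr fun _ => exists_congr fun _ =>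
    𝒯.ae_mem_cell_imp_iff hreg hT

end Mesh

/-! ### The weak divergence on one cell -/

section WeakDivCell

variable {E : Type*} [NormedAddCommGroup E] [NormedSpace ℝ E] [FiniteDimensional ℝ E]
  [MeasurableSpace E] [BorelSpace E] (μ : Measure E) [μ.IsAddHaarMeasure] {T : Finset E}

theorem IsSimplex.setIntegral_fderiv_sub (hT : IsSimplex T) (z : E) {φ : E → ℝ}
    (hφ : ContDiff ℝ 1 φ) :
    ∫ x in convexHull ℝ (T : Set E), fderiv ℝ φ x (x - z) ∂μ
      = μ.real (convexHull ℝ (T : Set E)) * meanRadialDiv μ φ T z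
        - Module.finrank ℝ E * ∫ x in convexHull ℝ (T : Set E), φ x ∂μ := by
  have hK := isCompact_convexHull_finset T
  have hrad := (continuous_radialDiv hφ z).continuousOn.integrableOn_compact (μ := μ) hK
  have hφint := (hφ.continuous.const_mul (Module.finrank ℝ E : ℝ)).continuousOn.integrableOn_compact
    (μ := μ) hK
  rw [meanRadialDiv, setAverage_eq, smul_eq_mul, mul_inv_cancel_left₀ (hT.addHaar_real_pos μ).ne',
    ← integral_const_mul, ← integral_sub hrad hφint]
  simp only [radialDiv, add_sub_cancel_left]

theorem IsSimplex.setIntegral_fderiv_sum (hT : IsSimplex T) (c : T → ℝ) {φ : E → ℝ}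
    (hφ : ContDiff ℝ 1 φ) :
    ∫ x in convexHull ℝ (T : Set E), fderiv ℝ φ x (∑ z, c z • (x - (z : E))) ∂μ
      = μ.real (convexHull ℝ (T : Set E)) * ∑ z, c z * meanRadialDiv μ φ T z
        - Module.finrank ℝ E * (∑ z, c z) * ∫ x in convexHull ℝ (T : Set E), φ x ∂μ := by
  have hintg (z : E) : IntegrableOn (fun x => fderiv ℝ φ x (x - z)) (convexHull ℝ (T : Set E)) μ :=
    ((hφ.continuous_fderiv one_ne_zero).clm_apply (by fun_prop)).continuousOn.integrableOn_compact
      (isCompact_convexHull_finset T)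
  simp only [map_sum, map_smul, smul_eq_mul]
  rw [integral_finsetSum _ fun (z : T) _ => (hintg z).const_mul (c z), Finset.mul_sum,
    Finset.mul_sum, Finset.sum_mul, ← Finset.sum_sub_distrib]
  refine Finset.sum_congr rfl fun z _ => ?_
  rw [integral_const_mul, hT.setIntegral_fderiv_sub μ z hφ]
  ring

theorem IsSimplex.setIntegral_fderiv_affine [Nontrivial E] (hT : IsSimplex T) {φ : E → ℝ}
    (hφ : ContDiff ℝ 1 φ) (h0 : ∀ x ∉ interior (convexHull ℝ (T : Set E)), φ x = 0)
    (a : E) (b : ℝ) :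
    ∫ x in convexHull ℝ (T : Set E), fderiv ℝ φ x (a + b • x) ∂μ
      = -(Module.finrank ℝ E * b) * ∫ x in convexHull ℝ (T : Set E), φ x ∂μ := by
  classical
  obtain ⟨c, rfl, hcx⟩ := hT.exists_sum_smul_sub_eq a b
  have hmean (z : T) : meanRadialDiv μ φ T z = 0 := by
    rw [hT.meanRadialDiv_congr μ z.2 hφ contDiff_const fun y hy => h0 y fun hyi => ?_]
    · simp [meanRadialDiv, radialDiv]
    · exact (hT.mem_interior_convexHull_iff.1 hyi z z.2).ne'
        (hT.baryCoord_eq_zero_of_mem_convexHull (Finset.erase_subset _ T) z.2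
          (Finset.notMem_erase _ T) hy)
  simp only [← hcx, hT.setIntegral_fderiv_sum μ c hφ, hmean, mul_zero,
    Finset.sum_const_zero, zero_sub, neg_mul]

end WeakDivCell

theorem Mesh.weakDiv_cell {d : ℕ} [NeZero d] {Ω : Set (Pt d)} (𝒯 : Mesh Ω)
    (hreg : interior (closure Ω) = Ω) {v : L2v Ω} {g : L2 Ω} (hv : HasWeakDiv v g)
    {T : Finset (Pt d)} (hT : T ∈ 𝒯.cells) {a : Pt d} {b : ℝ}
    (hab : ∀ᵐ x ∂(volume.restrict (convexHull ℝ (T : Set (Pt d)))), v x = a + b • x) :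
    ∀ᵐ x ∂(volume.restrict (convexHull ℝ (T : Set (Pt d)))), g x = d * b := by
  set K := convexHull ℝ (T : Set (Pt d))
  have hKΩ : interior K ⊆ Ω := 𝒯.interior_cell_subset hreg hT
  have hsub : LocallyIntegrable (fun x => g x - d * b) (volume.restrict Ω) :=
    ((Lp.memLp g).locallyIntegrable one_le_two).sub (locallyIntegrable_const _)
  have hae : ∀ᵐ x ∂(volume.restrict Ω), x ∈ interior K → g x - d * b = 0 := by
    refine isOpen_interior.ae_eq_zero_of_integral_contDiff_smul_eq_zero
      (hsub.locallyIntegrableOn _) fun φ hφ hφc hφK => ?_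
    have hφ1 : ContDiff ℝ 1 φ := hφ.of_le (by exact_mod_cast le_top)
    have hφ0 (x) (hx : x ∉ interior K) : φ x = 0 :=
      image_eq_zero_of_notMem_tsupport fun h => hx (hφK h)
    have hdφ0 (x) (hx : x ∉ interior K) : fderiv ℝ φ x = 0 :=
      Function.notMem_support.1 fun h => hx (hφK (support_fderiv_subset ℝ h))
    have hΩK (f : Pt d → ℝ) (hf : ∀ x ∉ interior K, f x = 0) : ∫ x in Ω, f x = ∫ x in K, f x := by
      rw [setIntegral_eq_integral_of_forall_compl_eq_zero fun x hx => hf x fun h => hx (hKΩ h),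
        setIntegral_eq_integral_of_forall_compl_eq_zero fun x hx =>
          hf x fun h => hx (interior_subset h)]
    have hweak : ∫ x in Ω, g x * φ x = d * b * ∫ x in Ω, φ x := by
      have h := hv φ hφ hφc (hφK.trans hKΩ)
      rw [hΩK _ fun x hx => by rw [hdφ0 x hx]; rfl, integral_congr_ae
        (hab.mono fun x hx => congrArg (fderiv ℝ φ x) hx),
        (𝒯.isSimplex hT).setIntegral_fderiv_affine volume hφ1 hφ0, finrank_euclideanSpace_fin] at h
      rw [hΩK φ hφ0]
      linarith
    have hgφ : Integrable (fun x => g x * φ x) (volume.restrict Ω) :=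
      (Lp.memLp g).integrable_mul (q := 2) (hφ.continuous.memLp_of_hasCompactSupport hφc)
    have hφint : Integrable φ (volume.restrict Ω) :=
      hφ.continuous.integrable_of_hasCompactSupport hφc
    calc ∫ x in Ω, φ x • (g x - d * b) = ∫ x in Ω, (g x * φ x - d * b * φ x) :=
          integral_congr_ae (ae_of_all _ fun x => by simp only [smul_eq_mul]; ring)
      _ = 0 := by
          rw [integral_sub hgφ (hφint.const_mul _), integral_const_mul, hweak, sub_self]
  have hKint : interior K =ᵐ[volume] K :=
    interior_ae_eq_of_null_frontier ((convex_convexHull ℝ _).addHaar_frontier volume)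
  rw [← Measure.restrict_congr_set hKint]
  filter_upwards [ae_mono (Measure.restrict_mono hKΩ le_rfl) hae,
    ae_restrict_mem isOpen_interior.measurableSet] with x hx hxK
  exact sub_eq_zero.1 (hx hxK)

/-! ### Flows on finite graphs -/

theorem le_of_sq_le_mul {x b : ℝ} (hb : 0 ≤ b) (h : x ^ 2 ≤ b * x) : x ≤ b := by
  by_contra! hx
  nlinarith

/-- A graph given by its half-edges: `base i` is the vertex to which the half-edge `i` is attached
and `flip i` the other half of its edge. The fixed points of `flip` are edges to the exterior. -/
structure HalfEdgeGraph (K I : Type*) where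
  base : I → K
  flip : I → I
  involutive_flip : Function.Involutive flip

namespace HalfEdgeGraph

variable {K I : Type*} (G : HalfEdgeGraph K I)

/-- The functions that are antisymmetric along the interior edges. -/
def IsFlow (g : I → ℝ) : Prop := ∀ i, G.flip i ≠ i → g (G.flip i) = -g i

variable {G}

theorem IsFlow.sq_flip {g : I → ℝ} (hg : G.IsFlow g) (i : I) : g (G.flip i) ^ 2 = g i ^ 2 := by
  by_cases hi : G.flip i = i
  · rw [hi]
  · rw [hg i hi, neg_sq]

variable (G)

/-- The jump of `p` along a half-edge. Across an edge to the exterior `p` is extended by odd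
reflection, which makes the summation by parts `IsFlow.sum_mul_jump` an identity. -/
def jump [DecidableEq I] (p : K → ℝ) (i : I) : ℝ :=
  if G.flip i = i then 2 * p (G.base i) else p (G.base i) - p (G.base (G.flip i))

theorem isFlow_jump [DecidableEq I] (p : K → ℝ) : G.IsFlow (G.jump p) := fun i hi => by
  rw [jump, jump, if_neg hi, if_neg (by rw [G.involutive_flip i]; exact hi.symm),
    G.involutive_flip i, neg_sub]

theorem isFlow_jump_div [DecidableEq I] {r : I → ℝ} (hflip : ∀ i, r (G.flip i) = r i)
    (p : K → ℝ) : G.IsFlow fun i => G.jump p i / r i := fun i hi => by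
  simp only [hflip, G.isFlow_jump p i hi, neg_div]

theorem abs_jump_sq_le [DecidableEq I] (p : K → ℝ) (i : I) :
    |G.jump (p ^ 2) i| ≤ |G.jump p i| * (|p (G.base i)| + |p (G.base (G.flip i))|) := by
  by_cases hi : G.flip i = i
  · simp only [jump, hi, if_true, Pi.pow_apply, abs_mul, abs_pow, abs_two]
    nlinarith [sq_nonneg |p (G.base i)|]
  · simp only [jump, hi, if_false, Pi.pow_apply, sq_sub_sq, abs_mul]
    rw [mul_comm]
    exact mul_le_mul_of_nonneg_left (abs_add_le _ _) (abs_nonneg _)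

variable [Fintype I]

theorem sum_flip (f : I → ℝ) : ∑ i, f (G.flip i) = ∑ i, f i :=
  Equiv.sum_comp G.involutive_flip.toPerm f

variable {G} in
theorem IsFlow.sum_mul_eq_zero {g m : I → ℝ} (hg : G.IsFlow g)
    (hm : ∀ i, G.flip i ≠ i → m (G.flip i) = m i) (hm0 : ∀ i, G.flip i = i → m i = 0) :
    ∑ i, g i * m i = 0 := by
  have hodd (i : I) : g (G.flip i) * m (G.flip i) = -(g i * m i) := by
    by_cases hi : G.flip i = i
    · rw [hi, hm0 i hi, mul_zero, neg_zero]
    · rw [hg i hi, hm i hi, neg_mul]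
  have hsum := G.sum_flip fun i => g i * m i
  simp only [hodd, Finset.sum_neg_distrib] at hsum
  linarith

variable [DecidableEq K]

/-- The total flow out of a vertex. -/
def outflow (g : I → ℝ) (k : K) : ℝ := ∑ i with G.base i = k, g i

theorem sum_outflow_mul [Fintype K] (g : I → ℝ) (p : K → ℝ) :
    ∑ k, G.outflow g k * p k = ∑ i, g i * p (G.base i) := by
  rw [← Finset.sum_fiberwise Finset.univ G.base]
  refine Finset.sum_congr rfl fun k _ => ?_
  rw [outflow, Finset.sum_mul]
  exact Finset.sum_congr rfl fun i hi => by rw [(Finset.mem_filter.1 hi).2]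

variable {G} [Fintype K]

theorem IsFlow.sum_mul_jump [DecidableEq I] {g : I → ℝ} (hg : G.IsFlow g) (p : K → ℝ) :
    ∑ i, g i * G.jump p i = 2 * ∑ k, G.outflow g k * p k := by
  rw [G.sum_outflow_mul, two_mul]
  nth_rewrite 2 [← G.sum_flip]
  rw [← Finset.sum_add_distrib]
  refine Finset.sum_congr rfl fun i _ => ?_
  by_cases hi : G.flip i = i
  · rw [hi, jump, if_pos hi]; ring
  · rw [hg i hi, jump, if_neg hi]; ring

section Resistance

variable {r : I → ℝ} (hr : ∀ i, 0 < r i) (hflip : ∀ i, r (G.flip i) = r i) {g : I → ℝ} {B : ℝ}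
  (hB : 0 ≤ B) (hgB : ∀ k, G.outflow (fun i => r i * g i ^ 2) k ≤ B * G.outflow g k)

include hflip hgB in
theorem IsFlow.sum_resistance_mul_le (hg : G.IsFlow g) (p : K → ℝ) :
    ∑ i, r i * g i ^ 2 * (p (G.base i) ^ 2 + p (G.base (G.flip i)) ^ 2)
      ≤ 2 * B * ∑ k, G.outflow g k * p k ^ 2 := by
  have hsymm : ∑ i, r i * g i ^ 2 * p (G.base (G.flip i)) ^ 2
      = ∑ i, r i * g i ^ 2 * p (G.base i) ^ 2 := by
    rw [← G.sum_flip]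
    simp only [hflip, hg.sq_flip, G.involutive_flip _]
  have hvertex : ∑ i, r i * g i ^ 2 * p (G.base i) ^ 2 ≤ B * ∑ k, G.outflow g k * p k ^ 2 := by
    rw [← G.sum_outflow_mul (fun i => r i * g i ^ 2) (fun k => p k ^ 2), Finset.mul_sum]
    refine Finset.sum_le_sum fun k _ => ?_
    rw [← mul_assoc]
    exact mul_le_mul_of_nonneg_right (hgB k) (sq_nonneg _)
  simp only [mul_add, Finset.sum_add_distrib]
  linarith

include hr hflip hB hgB in
/-- A discrete Poincaré inequality: a flow with positive sources and controlled energy density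
carries the value at every vertex to the exterior. -/
theorem IsFlow.sum_outflow_mul_sq_le [DecidableEq I] (hg : G.IsFlow g) (p : K → ℝ) :
    ∑ k, G.outflow g k * p k ^ 2 ≤ B * ∑ i, G.jump p i ^ 2 / r i := by
  set P := ∑ k, G.outflow g k * p k ^ 2
  set D := ∑ i, G.jump p i ^ 2 / r i
  set S : I → ℝ := fun i => |p (G.base i)| + |p (G.base (G.flip i))|
  have hD : 0 ≤ D := Finset.sum_nonneg fun i _ => div_nonneg (sq_nonneg _) (hr i).le
  have hP : 2 * P = ∑ i, g i * G.jump (p ^ 2) i := (hg.sum_mul_jump (p ^ 2)).symm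
  have hcauchy : (∑ i, g i * G.jump (p ^ 2) i) ^ 2 ≤ D * ∑ i, r i * g i ^ 2 * S i ^ 2 := by
    refine Finset.sum_sq_le_sum_mul_sum_of_sq_le_mul _
      (fun i _ => div_nonneg (sq_nonneg _) (hr i).le)
      (fun i _ => mul_nonneg (mul_nonneg (hr i).le (sq_nonneg _)) (sq_nonneg _)) fun i _ => ?_
    calc (g i * G.jump (p ^ 2) i) ^ 2 = g i ^ 2 * |G.jump (p ^ 2) i| ^ 2 := by
          rw [mul_pow, sq_abs]
      _ ≤ g i ^ 2 * (|G.jump p i| * S i) ^ 2 := by gcongr; exact G.abs_jump_sq_le p i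
      _ = G.jump p i ^ 2 / r i * (r i * g i ^ 2 * S i ^ 2) := by
          have := (hr i).ne'
          rw [mul_pow, sq_abs]
          field_simp
  have hS : ∑ i, r i * g i ^ 2 * S i ^ 2 ≤ 4 * B * P := by
    have hterm (i : I) : r i * g i ^ 2 * S i ^ 2
        ≤ 2 * (r i * g i ^ 2 * (p (G.base i) ^ 2 + p (G.base (G.flip i)) ^ 2)) := by
      have hi := hr i
      have hSi : S i ^ 2 ≤ 2 * (p (G.base i) ^ 2 + p (G.base (G.flip i)) ^ 2) := by
        simpa only [sq_abs] using add_sq_le (a := |p (G.base i)|) (b := |p (G.base (G.flip i))|)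
      rw [mul_left_comm]
      gcongr
    calc ∑ i, r i * g i ^ 2 * S i ^ 2 ≤ _ := Finset.sum_le_sum fun i _ => hterm i
      _ = _ := (Finset.mul_sum _ _ _).symm
      _ ≤ 4 * B * P := by linarith [hg.sum_resistance_mul_le hflip hgB p]
  refine le_of_sq_le_mul (mul_nonneg hB hD) ?_
  have := hcauchy.trans (mul_le_mul_of_nonneg_left hS hD)
  rw [← hP] at this
  linarith

end Resistance

/-- The weighted graph Laplacian, with conductances `1 / r i`. -/
def laplacian [DecidableEq I] (G : HalfEdgeGraph K I) (r : I → ℝ) : (K → ℝ) →ₗ[ℝ] (K → ℝ) where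
  toFun p := G.outflow fun i => G.jump p i / r i
  map_add' p q := by
    ext k
    simp only [outflow, Pi.add_apply, ← Finset.sum_add_distrib, ← add_div]
    refine Finset.sum_congr rfl fun i _ => ?_
    simp only [jump, Pi.add_apply]
    split_ifs <;> ring
  map_smul' a p := by
    ext k
    simp only [outflow, Pi.smul_apply, smul_eq_mul, RingHom.id_apply, Finset.mul_sum]
    refine Finset.sum_congr rfl fun i _ => ?_
    simp only [jump, Pi.smul_apply, smul_eq_mul]
    split_ifs <;> ring

section Laplacian

variable {r : I → ℝ} (hr : ∀ i, 0 < r i) (hflip : ∀ i, r (G.flip i) = r i)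

include hflip

theorem sum_jump_sq_div [DecidableEq I] (p : K → ℝ) :
    ∑ i, G.jump p i ^ 2 / r i = 2 * ∑ k, G.laplacian r p k * p k := by
  refine Eq.trans (Finset.sum_congr rfl fun i _ => ?_) ((G.isFlow_jump_div hflip p).sum_mul_jump p)
  ring

include hr

omit [Fintype K] in
theorem IsFlow.surjective_laplacian [DecidableEq I] [Finite K] {g : I → ℝ} {B : ℝ} (hB : 0 ≤ B)
    (hgB : ∀ k, G.outflow (fun i => r i * g i ^ 2) k ≤ B * G.outflow g k) (hg : G.IsFlow g)
    (hpos : ∀ k, 0 < G.outflow g k) : Function.Surjective (G.laplacian r) := by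
  cases nonempty_fintype K
  refine LinearMap.injective_iff_surjective.1 <| (injective_iff_map_eq_zero _).2 fun p hp =>
    funext fun k => ?_
  have hle := hg.sum_outflow_mul_sq_le hr hflip hB hgB p
  rw [sum_jump_sq_div hflip, hp] at hle
  simp only [Pi.zero_apply, zero_mul, Finset.sum_const_zero, mul_zero] at hle
  have hnonneg (k : K) : 0 ≤ G.outflow g k * p k ^ 2 := mul_nonneg (hpos k).le (sq_nonneg _)
  have hzero := (Finset.sum_eq_zero_iff_of_nonneg fun k _ => hnonneg k).1
    (hle.antisymm (Finset.sum_nonneg fun k _ => hnonneg k)) k (Finset.mem_univ k)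
  simpa [(hpos k).ne'] using hzero

theorem IsFlow.exists_outflow_eq {g : I → ℝ} {B : ℝ} (hB : 0 ≤ B)
    (hgB : ∀ k, G.outflow (fun i => r i * g i ^ 2) k ≤ B * G.outflow g k) (hg : G.IsFlow g)
    (hpos : ∀ k, 0 < G.outflow g k) (q : K → ℝ) :
    ∃ f : I → ℝ, G.IsFlow f ∧ G.outflow f = q ∧
      ∑ i, r i * f i ^ 2 ≤ 4 * B * ∑ k, q k ^ 2 / G.outflow g k := by
  classical
  obtain ⟨p, hp⟩ := hg.surjective_laplacian hr hflip hB hgB hpos q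
  refine ⟨fun i => G.jump p i / r i, G.isFlow_jump_div hflip p, hp, ?_⟩
  have henergy : ∑ i, r i * (G.jump p i / r i) ^ 2 = ∑ i, G.jump p i ^ 2 / r i :=
    Finset.sum_congr rfl fun i _ => by have := (hr i).ne'; field_simp
  have hq : 0 ≤ ∑ k, q k ^ 2 / G.outflow g k :=
    Finset.sum_nonneg fun k _ => div_nonneg (sq_nonneg _) (hpos k).le
  have hcauchy : (∑ k, q k * p k) ^ 2
      ≤ (∑ k, q k ^ 2 / G.outflow g k) * ∑ k, G.outflow g k * p k ^ 2 :=
    Finset.sum_sq_le_sum_mul_sum_of_sq_le_mul _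
      (fun k _ => div_nonneg (sq_nonneg _) (hpos k).le)
      (fun k _ => mul_nonneg (hpos k).le (sq_nonneg _)) fun k _ => by
        have := (hpos k).ne'
        exact le_of_eq (by field_simp)
  have hpoincare := hg.sum_outflow_mul_sq_le hr hflip hB hgB p
  have hwork : ∑ i, G.jump p i ^ 2 / r i = 2 * ∑ k, q k * p k := by
    rw [sum_jump_sq_div hflip, hp]
  rw [henergy]
  refine le_of_sq_le_mul (mul_nonneg (mul_nonneg zero_le_four hB) hq) ?_
  calc (∑ i, G.jump p i ^ 2 / r i) ^ 2 = 4 * (∑ k, q k * p k) ^ 2 := by rw [hwork]; ring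
    _ ≤ 4 * ((∑ k, q k ^ 2 / G.outflow g k) * (B * ∑ i, G.jump p i ^ 2 / r i)) := by
        have := hcauchy.trans (mul_le_mul_of_nonneg_left hpoincare hq)
        linarith
    _ = _ := by ring

end Laplacian

end HalfEdgeGraph

/-! ### Fields with given fluxes -/

section SquareIntegrable

variable {α E F : Type*} {mα : MeasurableSpace α} [NormedAddCommGroup F]

theorem norm_sq_eq_integral [InnerProductSpace ℝ F] {μ : Measure α} (v : Lp F 2 μ) :
    ‖v‖ ^ 2 = ∫ x, ‖v x‖ ^ 2 ∂μ := by
  rw [← real_inner_self_eq_norm_sq, L2.inner_def]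
  simp only [real_inner_self_eq_norm_sq]

theorem integrable_norm_sq {μ : Measure α} (v : Lp F 2 μ) : Integrable (fun x => ‖v x‖ ^ 2) μ :=
  (memLp_two_iff_integrable_sq_norm (Lp.memLp v).1).1 (Lp.memLp v)

variable [NormedAddCommGroup E] [NormedSpace ℝ E]

theorem integrable_fderiv_apply [FiniteDimensional ℝ E] [MeasurableSpace E] [BorelSpace E]
    {μ : Measure E} [IsFiniteMeasureOnCompacts μ] {φ : E → ℝ} (hφ : ContDiff ℝ 1 φ)
    (hsupp : HasCompactSupport φ) (v : Lp E 2 μ) : Integrable (fun x => fderiv ℝ φ x (v x)) μ := by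
  have hφ' : MemLp (fderiv ℝ φ) 2 μ :=
    (hφ.continuous_fderiv one_ne_zero).memLp_of_hasCompactSupport (hsupp.fderiv ℝ)
  refine memLp_one_iff_integrable.1 (MemLp.of_bilin (r := 1) (fun (f : E →L[ℝ] ℝ) x => f x) 1
    hφ' (Lp.memLp v) ?_ (ae_of_all _ fun x => ?_))
  · exact (ContinuousLinearMap.apply ℝ ℝ : E →L[ℝ] _).aestronglyMeasurable_comp₂
      (Lp.memLp v).1 hφ'.1
  · simpa using (fderiv ℝ φ x).le_opNNNorm (v x)

theorem norm_sum_smul_sub_sq_le {T : Finset E} (c : T → ℝ) {x : E}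
    (hx : x ∈ convexHull ℝ (T : Set E)) :
    ‖∑ z, c z • (x - (z : E))‖ ^ 2
      ≤ Metric.diam (convexHull ℝ (T : Set E)) ^ 2 * (T.card * ∑ z, c z ^ 2) := by
  set δ := Metric.diam (convexHull ℝ (T : Set E))
  have hdist (z : T) : ‖x - z‖ ≤ δ := by
    rw [← dist_eq_norm]
    exact Metric.dist_le_diam_of_mem (isCompact_convexHull_finset T).isBounded hx
      (subset_convexHull ℝ _ z.2)
  have hnorm : ‖∑ z, c z • (x - (z : E))‖ ≤ δ * ∑ z, |c z| := by
    rw [Finset.mul_sum]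
    refine norm_sum_le_of_le _ fun z _ => ?_
    rw [norm_smul, Real.norm_eq_abs, mul_comm]
    exact mul_le_mul_of_nonneg_right (hdist z) (abs_nonneg _)
  have hcard : (∑ z, |c z|) ^ 2 ≤ T.card * ∑ z, c z ^ 2 := by
    simpa using sq_sum_le_card_mul_sum_sq (s := Finset.univ) (f := fun z => |c z|)
  calc ‖∑ z, c z • (x - (z : E))‖ ^ 2 ≤ (δ * ∑ z, |c z|) ^ 2 := by gcongr
    _ = δ ^ 2 * (∑ z, |c z|) ^ 2 := mul_pow _ _ _
    _ ≤ _ := by gcongr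

end SquareIntegrable

namespace Mesh

variable {d : ℕ} {Ω : Set (Pt d)} (𝒯 : Mesh Ω)

/-- The facets of the cells, each given by a cell and the opposite vertex, so that an interior
facet occurs twice. -/
abbrev Facet := Σ T : 𝒯.cells, T.1

/-- The facets `i` and `j` are the same face, seen from different cells. -/
def Opposite (i j : 𝒯.Facet) : Prop := j.1 ≠ i.1 ∧ j.1.1.erase j.2.1 = i.1.1.erase i.2.1

open Classical in
/-- The same face seen from the neighbouring cell, or the facet itself if it lies on the
boundary. -/
def flip (i : 𝒯.Facet) : 𝒯.Facet := if h : ∃ j, 𝒯.Opposite i j then h.choose else i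

/-- The volume of a cell. -/
def vol (T : 𝒯.cells) : ℝ := volume.real (convexHull ℝ (T.1 : Set (Pt d)))

/-- The diameter of a cell. -/
def diam (T : 𝒯.cells) : ℝ := Metric.diam (convexHull ℝ (T.1 : Set (Pt d)))

variable {𝒯}

theorem Opposite.symm {i j : 𝒯.Facet} (h : 𝒯.Opposite i j) : 𝒯.Opposite j i :=
  ⟨h.1.symm, h.2.symm⟩

theorem Opposite.shareFace {i j : 𝒯.Facet} (h : 𝒯.Opposite i j) :
    ShareFace i.1.1 i.2.1 j.1.1 j.2.1 :=
  ⟨𝒯.isSimplex i.1.2, 𝒯.isSimplex j.1.2, i.2.2, j.2.2, h.2⟩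

theorem opposite_flip {i : 𝒯.Facet} (h : 𝒯.flip i ≠ i) : 𝒯.Opposite i (𝒯.flip i) := by
  by_cases hex : ∃ j, 𝒯.Opposite i j
  · rw [flip, dif_pos hex]
    exact hex.choose_spec
  · exact absurd (by rw [flip, dif_neg hex]) h

section Flip

variable [NeZero d]

theorem Opposite.eq {i j k : 𝒯.Facet} (hj : 𝒯.Opposite i j) (hk : 𝒯.Opposite i k) : j = k := by
  obtain ⟨hT, hz⟩ := 𝒯.opposite_unique i.1.2 j.1.2 k.1.2 (Subtype.coe_injective.ne hj.1)
    (Subtype.coe_injective.ne hk.1) hj.shareFace hk.shareFace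
  obtain ⟨⟨T₁, _⟩, ⟨z₁, _⟩⟩ := j
  obtain ⟨⟨T₂, _⟩, ⟨z₂, _⟩⟩ := k
  dsimp only at hT hz
  subst hT hz
  rfl

theorem Opposite.flip_eq {i j : 𝒯.Facet} (h : 𝒯.Opposite i j) : 𝒯.flip i = j := by
  have hex : ∃ j, 𝒯.Opposite i j := ⟨j, h⟩
  rw [flip, dif_pos hex]
  exact hex.choose_spec.eq h

variable (𝒯)

theorem involutive_flip : Function.Involutive 𝒯.flip := by
  intro i
  by_cases h : 𝒯.flip i = i
  · rw [h, h]
  · exact (opposite_flip h).symm.flip_eq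

theorem eq_of_flip_eq_of_subset {i : 𝒯.Facet} (h : 𝒯.flip i = i) {T : Finset (Pt d)}
    (hT : T ∈ 𝒯.cells) (hsub : i.1.1.erase i.2.1 ⊆ T) : T = i.1.1 := by
  by_contra hne
  obtain ⟨z, hz⟩ : ∃ z, T \ i.1.1.erase i.2.1 = {z} := by
    rw [← Finset.card_eq_one, Finset.card_sdiff_of_subset hsub, Finset.card_erase_of_mem i.2.2,
      hT.2, i.1.2.2]
    omega
  have hzT : z ∈ T := Finset.sdiff_subset (hz ▸ Finset.mem_singleton_self z)
  have hopp : 𝒯.Opposite i ⟨⟨T, hT⟩, ⟨z, hzT⟩⟩ := by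
    refine ⟨fun heq => hne (congrArg Subtype.val heq), ?_⟩
    dsimp only
    rw [Finset.erase_eq, ← hz, Finset.sdiff_sdiff_eq_self hsub]
  exact hopp.1 (congrArg Sigma.fst (hopp.flip_eq.symm.trans h))

/-- The dual graph of the mesh, whose vertices are the cells and whose half-edges are the facets. -/
def facetGraph : HalfEdgeGraph 𝒯.cells 𝒯.Facet where
  base := Sigma.fst
  flip := 𝒯.flip
  involutive_flip := 𝒯.involutive_flip

theorem outflow_facetGraph (g : 𝒯.Facet → ℝ) (T : 𝒯.cells) :
    𝒯.facetGraph.outflow g T = ∑ z : T.1, g ⟨T, z⟩ := by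
  rw [HalfEdgeGraph.outflow, Finset.sum_filter, Fintype.sum_sigma, Finset.sum_eq_single T]
  · exact Finset.sum_congr rfl fun z _ => if_pos rfl
  · exact fun T' _ hne => Finset.sum_eq_zero fun z _ => if_neg hne
  · exact fun h => absurd (Finset.mem_univ T) h

variable {𝒯} in
theorem sum_flow_mul_meanRadialDiv (hΩ : IsOpen Ω) {g : 𝒯.Facet → ℝ} (hg : 𝒯.facetGraph.IsFlow g)
    {φ : Pt d → ℝ} (hφ : ContDiff ℝ 1 φ) (hsupp : tsupport φ ⊆ Ω) :
    ∑ i : 𝒯.Facet, g i * meanRadialDiv volume φ i.1.1 i.2.1 = 0 := by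
  have hflip (i : 𝒯.Facet) (hi : 𝒯.flip i ≠ i) :
      meanRadialDiv volume φ (𝒯.flip i).1.1 (𝒯.flip i).2.1
        = meanRadialDiv volume φ i.1.1 i.2.1 :=
    (opposite_flip hi).shareFace.meanRadialDiv_eq volume hφ
  refine hg.sum_mul_eq_zero hflip fun i (hi : 𝒯.flip i = i) => ?_
  rw [(𝒯.isSimplex i.1.2).meanRadialDiv_congr volume i.2.2 hφ contDiff_const fun y hy =>
    𝒯.eq_zero_on_boundary_face hΩ i.1.2 i.2.2 (fun T hT => 𝒯.eq_of_flip_eq_of_subset hi hT)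
      hφ.continuous hsupp hy]
  simp [meanRadialDiv, radialDiv]

end Flip

variable (𝒯)

theorem vol_pos (T : 𝒯.cells) : 0 < 𝒯.vol T := (𝒯.isSimplex T.2).addHaar_real_pos volume

/-- The lowest order Raviart–Thomas field on the cell `T` whose flux through the facet `i` of `T`
is `g i`. -/
def fluxField (g : 𝒯.Facet → ℝ) (T : 𝒯.cells) (x : Pt d) : Pt d :=
  ∑ z : T.1, (g ⟨T, z⟩ / (d * 𝒯.vol T)) • (x - z.1)

section FluxField

variable {𝒯} [NeZero d] (hreg : interior (closure Ω) = Ω) {g : 𝒯.Facet → ℝ} {v : L2v Ω}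
  (hv : ∀ T : 𝒯.cells, ∀ᵐ x ∂(volume.restrict (convexHull ℝ (T.1 : Set (Pt d)))),
    v x = 𝒯.fluxField g T x)

include hreg hv

theorem hasWeakDiv_of_isFlow (hg : 𝒯.facetGraph.IsFlow g) {w : L2 Ω}
    (hw : ∀ T : 𝒯.cells, ∀ᵐ x ∂(volume.restrict (convexHull ℝ (T.1 : Set (Pt d)))),
      w x = 𝒯.facetGraph.outflow g T / 𝒯.vol T) : HasWeakDiv v w := by
  intro φ hφ hφc hφΩ
  have hφ1 : ContDiff ℝ 1 φ := hφ.of_le (by exact_mod_cast le_top)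
  have hcell (T : 𝒯.cells) : ∫ x in convexHull ℝ (T.1 : Set (Pt d)), fderiv ℝ φ x (v x)
      = (d : ℝ)⁻¹ * (∑ z : T.1, g ⟨T, z⟩ * meanRadialDiv volume φ T.1 z)
        - ∫ x in convexHull ℝ (T.1 : Set (Pt d)), w x * φ x := by
    have hd : (d : ℝ) ≠ 0 := NeZero.ne _
    have hvol := (𝒯.vol_pos T).ne'
    rw [integral_congr_ae ((hv T).mono fun x hx => congrArg (fderiv ℝ φ x) hx),
      integral_congr_ae ((hw T).mono fun x hx => congrArg (· * φ x) hx), integral_const_mul,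
      outflow_facetGraph]
    simp only [fluxField]
    rw [(𝒯.isSimplex T.2).setIntegral_fderiv_sum volume _ hφ1, ← vol, finrank_euclideanSpace_fin,
      ← Finset.sum_div, Finset.mul_sum, Finset.mul_sum]
    congr 1
    · refine Finset.sum_congr rfl fun z _ => ?_
      field_simp
    · field_simp
  have hwφ : Integrable (fun x => w x * φ x) (volume.restrict Ω) :=
    (Lp.memLp w).integrable_mul (q := 2) (hφ.continuous.memLp_of_hasCompactSupport hφc)
  rw [𝒯.integral_eq_sum_cells hreg (integrable_fderiv_apply hφ1 hφc v),
    𝒯.integral_eq_sum_cells hreg hwφ, Finset.sum_congr rfl fun T _ => hcell T,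
    Finset.sum_sub_distrib, ← Finset.mul_sum]
  have hzero := sum_flow_mul_meanRadialDiv (hreg ▸ isOpen_interior) hg hφ1 hφΩ
  rw [Fintype.sum_sigma] at hzero
  rw [hzero, mul_zero, zero_sub]

theorem norm_sq_le_sum_flux :
    ‖v‖ ^ 2 ≤ (d + 1) / d ^ 2 * ∑ i : 𝒯.Facet, 𝒯.diam i.1 ^ 2 / 𝒯.vol i.1 * g i ^ 2 := by
  rw [norm_sq_eq_integral, 𝒯.integral_eq_sum_cells hreg (integrable_norm_sq v),
    Fintype.sum_sigma, Finset.mul_sum]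
  refine Finset.sum_le_sum fun T _ => ?_
  have hK := isCompact_convexHull_finset T.1
  have := isFiniteMeasure_restrict.2 (hK.measure_lt_top (μ := volume)).ne
  have hbound : ∀ᵐ x ∂(volume.restrict (convexHull ℝ (T.1 : Set (Pt d)))),
      ‖v x‖ ^ 2 ≤ 𝒯.diam T ^ 2 * ((d + 1 : ℕ) * ∑ z : T.1, (g ⟨T, z⟩ / (d * 𝒯.vol T)) ^ 2) := by
    filter_upwards [hv T, ae_restrict_mem hK.measurableSet] with x hx hxT
    rw [hx, ← T.2.2]
    exact norm_sum_smul_sub_sq_le _ hxT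
  refine (integral_mono_ae (𝒯.integrable_cell hreg (integrable_norm_sq v) T.2)
    (integrable_const _) hbound).trans_eq ?_
  rw [integral_const, measureReal_restrict_apply_univ, smul_eq_mul, ← vol]
  have hd : (d : ℝ) ≠ 0 := NeZero.ne _
  have hvol := (𝒯.vol_pos T).ne'
  simp only [div_pow, ← Finset.sum_div, ← Finset.mul_sum]
  field_simp
  push_cast
  ring

end FluxField

theorem fluxField_eq_add_smul (g : 𝒯.Facet → ℝ) (T : 𝒯.cells) :
    ∃ (a : Pt d) (b : ℝ), ∀ x, 𝒯.fluxField g T x = a + b • x :=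
  ⟨-∑ z : T.1, (g ⟨T, z⟩ / (d * 𝒯.vol T)) • z.1, ∑ z : T.1, g ⟨T, z⟩ / (d * 𝒯.vol T), fun x => by
    simp only [fluxField, smul_sub, Finset.sum_sub_distrib, Finset.sum_smul]
    abel⟩

theorem exists_field_of_isFlow [NeZero d] (hreg : interior (closure Ω) = Ω) {g : 𝒯.Facet → ℝ}
    (hg : 𝒯.facetGraph.IsFlow g) {w : L2 Ω}
    (hw : ∀ T : 𝒯.cells, ∀ᵐ x ∂(volume.restrict (convexHull ℝ (T.1 : Set (Pt d)))),
      w x = 𝒯.facetGraph.outflow g T / 𝒯.vol T) :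
    ∃ v ∈ 𝒯.V, weakDiv v = w ∧
      ‖v‖ ^ 2 ≤ (d + 1) / d ^ 2 * ∑ i : 𝒯.Facet, 𝒯.diam i.1 ^ 2 / 𝒯.vol i.1 * g i ^ 2 := by
  obtain ⟨v, hv⟩ := 𝒯.exists_piecewise hreg (𝒯.fluxField g) fun T => by
    unfold fluxField
    fun_prop
  have hdiv := hasWeakDiv_of_isFlow hreg hv hg hw
  refine ⟨v, (𝒯.mem_V_iff hreg).2 ⟨⟨w, hdiv⟩, fun T hT => ?_⟩,
    hdiv.weakDiv_eq (hreg ▸ isOpen_interior), norm_sq_le_sum_flux hreg hv⟩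
  obtain ⟨a, b, hab⟩ := 𝒯.fluxField_eq_add_smul g ⟨T, hT⟩
  exact ⟨a, b, (hv ⟨T, hT⟩).mono fun x hx => hx.trans (hab x)⟩

theorem exists_cell_values (hreg : interior (closure Ω) = Ω) {w : L2 Ω} (hw : w ∈ 𝒯.W) :
    ∃ c : 𝒯.cells → ℝ, ∀ T : 𝒯.cells,
      ∀ᵐ x ∂(volume.restrict (convexHull ℝ (T.1 : Set (Pt d)))), w x = c T := by
  choose c hc using (𝒯.mem_W_iff hreg).1 hw
  exact ⟨fun T => c T T.2, fun T => hc T T.2⟩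

theorem norm_sq_eq_sum_vol (hreg : interior (closure Ω) = Ω) {w : L2 Ω} {c : 𝒯.cells → ℝ}
    (hc : ∀ T : 𝒯.cells, ∀ᵐ x ∂(volume.restrict (convexHull ℝ (T.1 : Set (Pt d)))),
      w x = c T) : ‖w‖ ^ 2 = ∑ T, 𝒯.vol T * c T ^ 2 := by
  rw [norm_sq_eq_integral, 𝒯.integral_eq_sum_cells hreg (integrable_norm_sq w)]
  refine Finset.sum_congr rfl fun T _ => ?_
  rw [integral_congr_ae ((hc T).mono fun x hx => congrArg (‖·‖ ^ 2) hx), integral_const,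
    measureReal_restrict_apply_univ, smul_eq_mul, ← vol, Real.norm_eq_abs, sq_abs]

end Mesh

/-! ### Uniform stability of the divergence -/

theorem addHaar_real_le_pow_mul {E : Type*} [NormedAddCommGroup E] [NormedSpace ℝ E]
    [FiniteDimensional ℝ E] [MeasurableSpace E] [BorelSpace E] (μ : Measure E) [μ.IsAddHaarMeasure]
    {s t : Set E} {x y : E} {κ r : ℝ} (hκ : 0 ≤ κ) (hr : 0 ≤ r)
    (hs : s ⊆ Metric.closedBall x (κ * r)) (ht : Metric.closedBall y r ⊆ t) (htop : μ t ≠ ⊤) :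
    μ.real s ≤ κ ^ Module.finrank ℝ E * μ.real t := by
  calc μ.real s ≤ μ.real (Metric.closedBall x (κ * r)) :=
        measureReal_mono hs measure_closedBall_lt_top.ne
    _ = κ ^ Module.finrank ℝ E * μ.real (Metric.closedBall y r) := by
        rw [Measure.addHaar_real_closedBall μ x (mul_nonneg hκ hr),
          Measure.addHaar_real_closedBall μ y hr, mul_pow, mul_assoc]
    _ ≤ _ := by gcongr

namespace Mesh

variable {d : ℕ} {Ω : Set (Pt d)} (𝒯 : Mesh Ω)

theorem diam_nonneg (T : 𝒯.cells) : 0 ≤ 𝒯.diam T := Metric.diam_nonneg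

theorem dist_le_diam (T : 𝒯.cells) {a b : Pt d} (ha : a ∈ T.1)
    (hb : b ∈ convexHull ℝ (T.1 : Set (Pt d))) : dist a b ≤ 𝒯.diam T :=
  Metric.dist_le_diam_of_mem (isCompact_convexHull_finset T.1).isBounded
    (subset_convexHull ℝ _ ha) hb

theorem diam_pos [NeZero d] (T : 𝒯.cells) : 0 < 𝒯.diam T := by
  obtain ⟨a, ha, b, hb, hab⟩ := Finset.one_lt_card.1
    (show 1 < T.1.card by rw [T.2.2]; exact Nat.succ_lt_succ (NeZero.pos d))
  exact (dist_pos.2 hab).trans_le (𝒯.dist_le_diam T ha (subset_convexHull ℝ _ hb))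

section Radius

variable {R : ℝ} (hR : Ω ⊆ Metric.closedBall 0 R)

include hR

theorem convexHull_cell_subset_closedBall (T : 𝒯.cells) :
    convexHull ℝ (T.1 : Set (Pt d)) ⊆ Metric.closedBall 0 R :=
  (Set.subset_iUnion₂ (s := fun T (_ : T ∈ 𝒯.cells) => convexHull ℝ (T : Set (Pt d))) T.1 T.2).trans
    (𝒯.iUnion_convexHull_cells.le.trans (closure_minimal hR Metric.isClosed_closedBall))

theorem norm_le_of_mem_cell (T : 𝒯.cells) {y : Pt d} (hy : y ∈ T.1) : ‖y‖ ≤ R :=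
  mem_closedBall_zero_iff.1
    (𝒯.convexHull_cell_subset_closedBall hR T (subset_convexHull ℝ _ hy))

theorem radius_nonneg (T : 𝒯.cells) : 0 ≤ R := by
  obtain ⟨y, hy⟩ := Finset.card_pos.1 (T.2.2.ge.trans_lt' d.succ_pos)
  exact (norm_nonneg y).trans (𝒯.norm_le_of_mem_cell hR T hy)

theorem diam_le_two_mul (T : 𝒯.cells) : 𝒯.diam T ≤ 2 * R :=
  Metric.diam_le_of_subset_closedBall (𝒯.radius_nonneg hR T)
    (𝒯.convexHull_cell_subset_closedBall hR T)

end Radius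

theorem ShapeRegular.diam_mul_vol_le {Ω : Set (Pt 1)} {𝒯 : Mesh Ω} {σ R : ℝ}
    (hσ : 𝒯.ShapeRegular σ) (hR : Ω ⊆ Metric.closedBall 0 R) (T T' : 𝒯.cells) :
    𝒯.diam T * 𝒯.vol T' ≤ 2 * R * σ * 𝒯.vol T := by
  obtain ⟨y, r, hr, hball, hdiam⟩ := hσ T.1 T.2
  have hR₀ := 𝒯.radius_nonneg hR T
  have hvol : 𝒯.vol T' ≤ R / r * 𝒯.vol T := by
    simpa only [vol, finrank_euclideanSpace_fin, pow_one] using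
      addHaar_real_le_pow_mul volume (div_nonneg hR₀ hr.le) hr.le
        ((𝒯.convexHull_cell_subset_closedBall hR T').trans_eq (by rw [div_mul_cancel₀ R hr.ne']))
        hball (isCompact_convexHull_finset T.1).measure_ne_top
  calc 𝒯.diam T * 𝒯.vol T' ≤ (σ * (2 * r)) * (R / r * 𝒯.vol T) := mul_le_mul hdiam hvol
        measureReal_nonneg ((𝒯.diam_nonneg T).trans hdiam)
    _ = _ := by field_simp

variable {𝒯}

namespace ShapeRegular

variable {σ : ℝ} (hσ : 𝒯.ShapeRegular σ)

include hσ

theorem nonneg (T : 𝒯.cells) : 0 ≤ σ := by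
  obtain ⟨_, r, hr, -, hdiam⟩ := hσ T.1 T.2
  exact nonneg_of_mul_nonneg_left ((𝒯.diam_nonneg T).trans hdiam) (by positivity)

/-- Two neighbouring cells have an edge in common, whose length is comparable to the diameters of
both of them. -/
theorem diam_opposite_le (hd : 2 ≤ d) {i j : 𝒯.Facet} (h : 𝒯.Opposite i j) :
    𝒯.diam j.1 ≤ σ * 𝒯.diam i.1 := by
  obtain ⟨y, r, hr, hball, hdiam⟩ := hσ j.1.1 j.1.2
  obtain ⟨a, ha, b, hb, hab⟩ := Finset.one_lt_card.1 (show 1 < (i.1.1.erase i.2.1).card by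
    rw [Finset.card_erase_of_mem i.2.2, i.1.2.2]; omega)
  have hedge : 2 * r ≤ dist a b := (𝒯.isSimplex j.1.2).two_mul_le_dist
    (Finset.mem_of_mem_erase (h.2 ▸ ha)) (Finset.mem_of_mem_erase (h.2 ▸ hb)) hab hr.le hball
  exact hdiam.trans (mul_le_mul_of_nonneg_left (hedge.trans (𝒯.dist_le_diam i.1
    (Finset.mem_of_mem_erase ha) (subset_convexHull ℝ _ (Finset.mem_of_mem_erase hb))))
    (hσ.nonneg i.1))

theorem vol_opposite_le (hd : 2 ≤ d) {i j : 𝒯.Facet} (h : 𝒯.Opposite i j) :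
    𝒯.vol j.1 ≤ (2 * σ ^ 2) ^ d * 𝒯.vol i.1 := by
  obtain ⟨y, r, hr, hball, hdiam⟩ := hσ i.1.1 i.1.2
  have hsub : convexHull ℝ (j.1.1 : Set (Pt d)) ⊆ Metric.closedBall j.2.1 (2 * σ ^ 2 * r) := by
    intro x hx
    rw [Metric.mem_closedBall, dist_comm]
    calc dist j.2.1 x ≤ 𝒯.diam j.1 := 𝒯.dist_le_diam j.1 j.2.2 hx
      _ ≤ σ * 𝒯.diam i.1 := hσ.diam_opposite_le hd h
      _ ≤ σ * (σ * (2 * r)) := mul_le_mul_of_nonneg_left hdiam (hσ.nonneg i.1)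
      _ = 2 * σ ^ 2 * r := by ring
  simpa only [vol, finrank_euclideanSpace_fin] using addHaar_real_le_pow_mul volume (by positivity)
    hr.le hsub hball (isCompact_convexHull_finset i.1.1).measure_ne_top

theorem vol_flip_le (hd : 2 ≤ d) (i : 𝒯.Facet) :
    𝒯.vol (𝒯.flip i).1 ≤ (1 + (2 * σ ^ 2) ^ d) * 𝒯.vol i.1 := by
  have hpos := 𝒯.vol_pos i.1
  rw [one_add_mul]
  by_cases h : 𝒯.flip i = i
  · rw [h]
    exact le_add_of_nonneg_right (by positivity)
  · exact (hσ.vol_opposite_le hd (opposite_flip h)).trans (le_add_of_nonneg_left hpos.le)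

variable {R : ℝ} (hR : Ω ⊆ Metric.closedBall 0 R)

include hR

theorem abs_baryCoord_zero_mul_diam_le [NeZero d] (i : 𝒯.Facet) :
    |baryCoord i.1.1 i.2.1 0| * 𝒯.diam i.1 ≤ σ * R := by
  have sT := 𝒯.isSimplex i.1.2
  obtain ⟨y, hy⟩ := sT.erase_nonempty i.2.1
  obtain ⟨z, r, hr, hball, hdiam⟩ := hσ i.1.1 i.1.2
  have hcoord : |baryCoord i.1.1 i.2.1 0| * (2 * r) ≤ R := by
    have h := sT.abs_baryCoord_sub_mul_le i.2.2 hr.le hball 0 y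
    rw [sT.baryCoord_of_mem_erase i.2.2 hy, sub_zero, dist_zero_left] at h
    exact h.trans (𝒯.norm_le_of_mem_cell hR i.1 (Finset.mem_of_mem_erase hy))
  calc |baryCoord i.1.1 i.2.1 0| * 𝒯.diam i.1
      ≤ |baryCoord i.1.1 i.2.1 0| * (σ * (2 * r)) := by gcongr; exact hdiam
    _ = σ * (|baryCoord i.1.1 i.2.1 0| * (2 * r)) := by ring
    _ ≤ σ * R := mul_le_mul_of_nonneg_left hcoord (hσ.nonneg i.1)

/-- In one dimension neighbouring cells need not be comparable, but then the diameter of a cell is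
comparable to its volume. -/
theorem diam_mul_vol_flip_le [NeZero d] (i : 𝒯.Facet) :
    𝒯.diam i.1 * 𝒯.vol (𝒯.flip i).1 ≤ 2 * R * (1 + σ + (2 * σ ^ 2) ^ d) * 𝒯.vol i.1 := by
  have hR₀ := 𝒯.radius_nonneg hR i.1
  have hσ₀ := hσ.nonneg i.1
  have hvol := 𝒯.vol_pos i.1
  obtain rfl | hd := (NeZero.one_le (n := d)).eq_or_lt
  · refine (hσ.diam_mul_vol_le hR i.1 (𝒯.flip i).1).trans ?_
    gcongr
    linarith [sq_nonneg σ]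
  · calc 𝒯.diam i.1 * 𝒯.vol (𝒯.flip i).1
        ≤ 2 * R * ((1 + (2 * σ ^ 2) ^ d) * 𝒯.vol i.1) :=
          mul_le_mul (𝒯.diam_le_two_mul hR i.1) (hσ.vol_flip_le hd i) measureReal_nonneg
            (by positivity)
      _ ≤ _ := by
          rw [← mul_assoc]
          gcongr
          linarith

end ShapeRegular

variable (𝒯)

/-- The flux of the field `x ↦ x / d` through a facet; this field has divergence one. -/
def radialFlux (i : 𝒯.Facet) : ℝ := 𝒯.vol i.1 * baryCoord i.1.1 i.2.1 0

/-- A flow whose source in a cell is the total volume of the cell and of its neighbours. It is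
the reference flow of the discrete Poincaré inequality on the dual graph. -/
def referenceFlux (i : 𝒯.Facet) : ℝ :=
  (d + 2) * 𝒯.radialFlux i + (𝒯.vol (𝒯.flip i).1 - 𝒯.vol i.1)

/-- The resistance of a facet in the dual graph, the sum of the contributions of the two adjacent
cells. It bounds the weight with which a flux enters the norm of its field. -/
def resistance (i : 𝒯.Facet) : ℝ :=
  𝒯.diam i.1 ^ 2 / 𝒯.vol i.1 + 𝒯.diam (𝒯.flip i).1 ^ 2 / 𝒯.vol (𝒯.flip i).1

section RadialFlux

variable [NeZero d]

theorem isFlow_radialFlux : 𝒯.facetGraph.IsFlow 𝒯.radialFlux := by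
  intro i (hi : 𝒯.flip i ≠ i)
  have hopp := opposite_flip hi
  have hneg := 𝒯.baryCoord_opposite_neg i.1.2 (𝒯.flip i).1.2 (Subtype.coe_injective.ne hopp.1)
    hopp.shareFace
  change 𝒯.radialFlux (𝒯.flip i) = _
  simp only [radialFlux, vol]
  rw [hopp.shareFace.measureReal_eq volume, abs_of_neg hneg, hopp.shareFace.baryCoord_eq_mul 0]
  ring

theorem outflow_radialFlux (T : 𝒯.cells) : 𝒯.facetGraph.outflow 𝒯.radialFlux T = 𝒯.vol T := by
  rw [outflow_facetGraph]
  simp only [radialFlux]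
  rw [← Finset.mul_sum, Finset.sum_coe_sort T.1 fun z => baryCoord T.1 z 0,
    (𝒯.isSimplex T.2).sum_baryCoord, mul_one]

theorem isFlow_referenceFlux : 𝒯.facetGraph.IsFlow 𝒯.referenceFlux := by
  intro i hi
  have hradial : 𝒯.radialFlux (𝒯.flip i) = -𝒯.radialFlux i := 𝒯.isFlow_radialFlux i hi
  change 𝒯.referenceFlux (𝒯.flip i) = _
  rw [referenceFlux, referenceFlux, hradial, 𝒯.involutive_flip i]
  ring

theorem outflow_referenceFlux (T : 𝒯.cells) :
    𝒯.facetGraph.outflow 𝒯.referenceFlux T = 𝒯.vol T + ∑ z, 𝒯.vol (𝒯.flip ⟨T, z⟩).1 := by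
  have hradial := 𝒯.outflow_radialFlux T
  rw [outflow_facetGraph] at hradial ⊢
  simp only [referenceFlux, Finset.sum_add_distrib, Finset.sum_sub_distrib, ← Finset.mul_sum,
    hradial, Finset.sum_const, Finset.card_univ, Fintype.card_coe, T.2.2, nsmul_eq_mul]
  push_cast
  ring

theorem vol_le_outflow_referenceFlux (T : 𝒯.cells) :
    𝒯.vol T ≤ 𝒯.facetGraph.outflow 𝒯.referenceFlux T := by
  rw [outflow_referenceFlux]
  exact le_add_of_nonneg_right (Finset.sum_nonneg fun _ _ => measureReal_nonneg)

theorem resistance_pos (i : 𝒯.Facet) : 0 < 𝒯.resistance i :=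
  add_pos (div_pos (pow_pos (𝒯.diam_pos _) 2) (𝒯.vol_pos _))
    (div_pos (pow_pos (𝒯.diam_pos _) 2) (𝒯.vol_pos _))

theorem resistance_flip (i : 𝒯.Facet) : 𝒯.resistance (𝒯.flip i) = 𝒯.resistance i := by
  rw [resistance, resistance, 𝒯.involutive_flip i, add_comm]

end RadialFlux

/-- The bound for the reference flux density, scaled by the diameter of the cell. -/
def fluxBound (d : ℕ) (σ R : ℝ) : ℝ :=
  (d + 2) * (σ * R) + 2 * R * (1 + σ + (2 * σ ^ 2) ^ d) + 2 * R

variable {𝒯} [NeZero d] {σ R : ℝ} (hσ : 𝒯.ShapeRegular σ) (hR : Ω ⊆ Metric.closedBall 0 R)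

include hσ hR

theorem ShapeRegular.abs_diam_div_vol_mul_referenceFlux_le (i : 𝒯.Facet) :
    |𝒯.diam i.1 / 𝒯.vol i.1 * 𝒯.referenceFlux i| ≤ fluxBound d σ R := by
  have hvol := 𝒯.vol_pos i.1
  have hdiam := 𝒯.diam_nonneg i.1
  have hsplit : 𝒯.diam i.1 / 𝒯.vol i.1 * 𝒯.referenceFlux i
      = (d + 2) * (baryCoord i.1.1 i.2.1 0 * 𝒯.diam i.1)
        + 𝒯.diam i.1 * 𝒯.vol (𝒯.flip i).1 / 𝒯.vol i.1 - 𝒯.diam i.1 := by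
    rw [referenceFlux, radialFlux]
    field_simp
    ring
  have hneighbour : 𝒯.diam i.1 * 𝒯.vol (𝒯.flip i).1 / 𝒯.vol i.1
      ≤ 2 * R * (1 + σ + (2 * σ ^ 2) ^ d) :=
    (div_le_iff₀ hvol).2 (hσ.diam_mul_vol_flip_le hR i)
  have hradial := hσ.abs_baryCoord_zero_mul_diam_le hR i
  rw [hsplit]
  refine (abs_sub _ _).trans (add_le_add ((abs_add_le _ _).trans (add_le_add ?_ ?_)) ?_)
  · rw [abs_mul, abs_mul, abs_of_nonneg hdiam, abs_of_nonneg (by positivity : (0 : ℝ) ≤ d + 2)]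
    gcongr
  · rwa [abs_of_nonneg (div_nonneg (mul_nonneg hdiam (𝒯.vol_pos _).le) hvol.le)]
  · rw [abs_of_nonneg hdiam]
    exact 𝒯.diam_le_two_mul hR i.1

theorem ShapeRegular.div_vol_mul_referenceFlux_sq_le (i : 𝒯.Facet) :
    𝒯.diam i.1 ^ 2 / 𝒯.vol i.1 * 𝒯.referenceFlux i ^ 2 ≤ fluxBound d σ R ^ 2 * 𝒯.vol i.1 := by
  have hvol := 𝒯.vol_pos i.1
  calc 𝒯.diam i.1 ^ 2 / 𝒯.vol i.1 * 𝒯.referenceFlux i ^ 2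
      = |𝒯.diam i.1 / 𝒯.vol i.1 * 𝒯.referenceFlux i| ^ 2 * 𝒯.vol i.1 := by
        rw [sq_abs]; field_simp
    _ ≤ _ := by gcongr; exact hσ.abs_diam_div_vol_mul_referenceFlux_le hR i

theorem ShapeRegular.resistance_mul_referenceFlux_sq_le (i : 𝒯.Facet) :
    𝒯.resistance i * 𝒯.referenceFlux i ^ 2
      ≤ fluxBound d σ R ^ 2 * (𝒯.vol i.1 + 𝒯.vol (𝒯.flip i).1) := by
  have hsq : 𝒯.referenceFlux (𝒯.flip i) ^ 2 = 𝒯.referenceFlux i ^ 2 :=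
    𝒯.isFlow_referenceFlux.sq_flip i
  have hflip := hσ.div_vol_mul_referenceFlux_sq_le hR (𝒯.flip i)
  rw [hsq] at hflip
  rw [resistance, add_mul, mul_add]
  exact add_le_add (hσ.div_vol_mul_referenceFlux_sq_le hR i) hflip

theorem ShapeRegular.outflow_resistance_le (T : 𝒯.cells) :
    𝒯.facetGraph.outflow (fun i => 𝒯.resistance i * 𝒯.referenceFlux i ^ 2) T
      ≤ (d + 1) * fluxBound d σ R ^ 2 * 𝒯.facetGraph.outflow 𝒯.referenceFlux T := by
  have hneighbours : 0 ≤ ∑ z, 𝒯.vol (𝒯.flip ⟨T, z⟩).1 :=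
    Finset.sum_nonneg fun _ _ => measureReal_nonneg
  rw [outflow_facetGraph, outflow_referenceFlux]
  calc ∑ z, 𝒯.resistance ⟨T, z⟩ * 𝒯.referenceFlux ⟨T, z⟩ ^ 2
      ≤ ∑ z, fluxBound d σ R ^ 2 * (𝒯.vol T + 𝒯.vol (𝒯.flip ⟨T, z⟩).1) :=
        Finset.sum_le_sum fun z _ => hσ.resistance_mul_referenceFlux_sq_le hR ⟨T, z⟩
    _ = fluxBound d σ R ^ 2 * ((d + 1) * 𝒯.vol T + ∑ z, 𝒯.vol (𝒯.flip ⟨T, z⟩).1) := by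
        rw [← Finset.mul_sum, Finset.sum_add_distrib, Finset.sum_const, Finset.card_univ,
          Fintype.card_coe, T.2.2, nsmul_eq_mul]
        push_cast
        ring
    _ ≤ fluxBound d σ R ^ 2 * ((d + 1) * 𝒯.vol T + (d + 1) * ∑ z, 𝒯.vol (𝒯.flip ⟨T, z⟩).1) := by
        gcongr
        exact le_mul_of_one_le_left hneighbours (by linarith [Nat.cast_nonneg (α := ℝ) d])
    _ = _ := by ring

theorem ShapeRegular.exists_flow_outflow_eq (c : 𝒯.cells → ℝ) :
    ∃ f, 𝒯.facetGraph.IsFlow f ∧ (∀ T, 𝒯.facetGraph.outflow f T = 𝒯.vol T * c T) ∧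
      ∑ i, 𝒯.diam i.1 ^ 2 / 𝒯.vol i.1 * f i ^ 2
        ≤ 4 * ((d + 1) * fluxBound d σ R ^ 2) * ∑ T, 𝒯.vol T * c T ^ 2 := by
  have hflip (i : 𝒯.Facet) : 𝒯.resistance (𝒯.facetGraph.flip i) = 𝒯.resistance i :=
    𝒯.resistance_flip i
  obtain ⟨f, hf, hout, henergy⟩ := 𝒯.isFlow_referenceFlux.exists_outflow_eq
    (B := (d + 1) * fluxBound d σ R ^ 2) 𝒯.resistance_pos hflip (by positivity)
    (hσ.outflow_resistance_le hR)
    (fun T => (𝒯.vol_pos T).trans_le (𝒯.vol_le_outflow_referenceFlux T)) fun T => 𝒯.vol T * c T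
  refine ⟨f, hf, congrFun hout, le_trans (Finset.sum_le_sum fun i _ => ?_) (henergy.trans ?_)⟩
  · exact mul_le_mul_of_nonneg_right
      (le_add_of_nonneg_right (div_nonneg (sq_nonneg _) (𝒯.vol_pos _).le)) (sq_nonneg _)
  · gcongr with T
    have hvol := 𝒯.vol_pos T
    calc (𝒯.vol T * c T) ^ 2 / 𝒯.facetGraph.outflow 𝒯.referenceFlux T
        ≤ (𝒯.vol T * c T) ^ 2 / 𝒯.vol T := by
          gcongr; exact 𝒯.vol_le_outflow_referenceFlux T
      _ = 𝒯.vol T * c T ^ 2 := by field_simp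

theorem ShapeRegular.exists_stable_field (hreg : interior (closure Ω) = Ω) {w : L2 Ω}
    (hw : w ∈ 𝒯.W) : ∃ v ∈ 𝒯.V, weakDiv v = w ∧
      ‖v‖ ^ 2 ≤ (d + 1) / d ^ 2 * (4 * ((d + 1) * fluxBound d σ R ^ 2)) * ‖w‖ ^ 2 := by
  obtain ⟨c, hc⟩ := 𝒯.exists_cell_values hreg hw
  obtain ⟨f, hf, hout, henergy⟩ := hσ.exists_flow_outflow_eq hR c
  obtain ⟨v, hv, hdiv, hnorm⟩ := 𝒯.exists_field_of_isFlow hreg hf (w := w) fun T => by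
    filter_upwards [hc T] with x hx
    rw [hx, hout T, mul_div_cancel_left₀ _ (𝒯.vol_pos T).ne']
  refine ⟨v, hv, hdiv, hnorm.trans ?_⟩
  rw [mul_assoc, 𝒯.norm_sq_eq_sum_vol hreg hc]
  exact mul_le_mul_of_nonneg_left henergy (by positivity)

/-- `C` is a stability constant of the divergence: it has a right inverse `W_h → V_h` of norm at
most `C`, not necessarily linear. -/
def DivStable (𝒯 : Mesh Ω) (C : ℝ) : Prop :=
  ∀ w ∈ 𝒯.W, ∃ v ∈ 𝒯.V, weakDiv v = w ∧ ‖v‖ ≤ C * ‖w‖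

end Mesh

theorem exists_divStable {d : ℕ} [NeZero d] {Ω : Set (Pt d)}
    (hbdd : Bornology.IsBounded Ω) (hreg : interior (closure Ω) = Ω) (σ : ℝ) :
    ∃ C : ℝ, 0 < C ∧ ∀ 𝒯 : Mesh Ω, 𝒯.ShapeRegular σ → 𝒯.DivStable C := by
  obtain ⟨R, hR⟩ := hbdd.subset_closedBall 0
  set A : ℝ := (d + 1) / d ^ 2 * (4 * ((d + 1) * Mesh.fluxBound d σ R ^ 2))
  have hA : 0 ≤ A := by positivity
  refine ⟨A + 1, by positivity, fun 𝒯 hσ w hw => ?_⟩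
  obtain ⟨v, hv, hdiv, hnorm⟩ := hσ.exists_stable_field hR hreg hw
  refine ⟨v, hv, hdiv, (sq_le_sq₀ (norm_nonneg v) (by positivity)).1 (hnorm.trans ?_)⟩
  rw [mul_pow]
  gcongr
  nlinarith

/-! ### Mixed problems -/

section SaddlePoint

variable {W V : Type*} [NormedAddCommGroup W] [InnerProductSpace ℝ W] [NormedAddCommGroup V]
  [InnerProductSpace ℝ V] {D : V →ₗ[ℝ] W}

/-- The operator `(p, u) ↦ (c p + D u, A u - Dᵀ p)` of a mixed problem, with values in the dual
spaces; the stabilisation `c p` is absent for `c = 0`. -/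
def saddlePointOperator (D : V →ₗ[ℝ] W) (A : V →ₗ[ℝ] V →ₗ[ℝ] ℝ) (c : ℝ) :
    W × V →ₗ[ℝ] Module.Dual ℝ W × Module.Dual ℝ V :=
  LinearMap.prod (LinearMap.coprod (c • innerₗ W) (innerₗ W ∘ₗ D))
    (LinearMap.coprod (-(LinearMap.lcomp ℝ ℝ D ∘ₗ innerₗ W)) A)

theorem saddlePointOperator_eq_iff {A : V →ₗ[ℝ] V →ₗ[ℝ] ℝ} {c : ℝ} {x : W × V}
    {g : Module.Dual ℝ W} {l : Module.Dual ℝ V} :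
    saddlePointOperator D A c x = (g, l) ↔
      (∀ w, c * inner ℝ x.1 w + inner ℝ (D x.2) w = g w) ∧
        ∀ v, A x.2 v - inner ℝ x.1 (D v) = l v := by
  simp [saddlePointOperator, LinearMap.ext_iff, Prod.ext_iff, sub_eq_neg_add]

theorem saddlePointOperator_injective (hD : Function.Surjective D) {A : V →ₗ[ℝ] V →ₗ[ℝ] ℝ}
    (hA : ∀ v, v ≠ 0 → 0 < A v v) {c : ℝ} (hc : 0 ≤ c) :
    Function.Injective (saddlePointOperator D A c) := by
  refine (injective_iff_map_eq_zero _).2 fun ⟨p, u⟩ hx => ?_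
  obtain ⟨hdiv, hflux⟩ := saddlePointOperator_eq_iff.1 hx
  have hu : u = 0 := by
    by_contra hne
    have hpu := hflux u
    have hpp := hdiv p
    simp only [LinearMap.zero_apply, real_inner_comm p (D u)] at hpu hpp
    linarith [hA u hne, mul_nonneg hc (real_inner_self_nonneg (x := p))]
  obtain ⟨v, hv⟩ := hD p
  have hp := hflux v
  simp only [hu, hv, map_zero, LinearMap.zero_apply, zero_sub, neg_eq_zero, inner_self_eq_zero]
    at hp
  rw [hp, hu, Prod.mk_zero_zero]

theorem existsUnique_saddlePoint [FiniteDimensional ℝ W] [FiniteDimensional ℝ V]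
    (hD : Function.Surjective D) {A : V →ₗ[ℝ] V →ₗ[ℝ] ℝ} (hA : ∀ v, v ≠ 0 → 0 < A v v) {c : ℝ}
    (hc : 0 ≤ c) (g : Module.Dual ℝ W) (l : Module.Dual ℝ V) :
    ∃! x : W × V, (∀ w, c * inner ℝ x.1 w + inner ℝ (D x.2) w = g w) ∧
      ∀ v, A x.2 v - inner ℝ x.1 (D v) = l v := by
  have hinj := saddlePointOperator_injective hD hA hc
  have hdim : Module.finrank ℝ (W × V) = Module.finrank ℝ (Module.Dual ℝ W × Module.Dual ℝ V) := by
    simp only [Module.finrank_prod, Subspace.dual_finrank_eq]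
  have hsurj := (LinearMap.injective_iff_surjective_of_finrank_eq_finrank hdim).1 hinj
  simp only [← saddlePointOperator_eq_iff]
  exact Function.Bijective.existsUnique ⟨hinj, hsurj⟩ (g, l)

theorem energy_le {E Q : Type*} [NormedAddCommGroup E] [InnerProductSpace ℝ E]
    [NormedAddCommGroup Q] [InnerProductSpace ℝ Q] {L τ g : ℝ} (hL : 0 < L) (hτ : 0 ≤ τ)
    {eΘ eΘ' es δ : E} {eq z : Q} (hs : ‖es‖ ^ 2 ≤ L * inner ℝ es eΘ')
    (hmass : L * inner ℝ (eΘ - eΘ') eΘ + inner ℝ es eΘ + τ * inner ℝ δ eΘ = 0)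
    (hflux : inner ℝ eq eq - inner ℝ eΘ δ = inner ℝ z eq) (hz : ‖z‖ ≤ g) :
    L * ‖eΘ‖ ^ 2 + ‖es‖ ^ 2 / L + 2 * τ * ‖eq‖ ^ 2 ≤ L * ‖eΘ'‖ ^ 2 + 2 * τ * (g * ‖eq‖) := by
  have hzq : τ * inner ℝ z eq ≤ τ * (g * ‖eq‖) := by
    gcongr
    exact (real_inner_le_norm z eq).trans (by gcongr)
  have hpolar : ‖eΘ - eΘ'‖ ^ 2 = 2 * inner ℝ (eΘ - eΘ') eΘ - ‖eΘ‖ ^ 2 + ‖eΘ'‖ ^ 2 := by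
    rw [norm_sub_sq_real, inner_sub_left, real_inner_self_eq_norm_sq, real_inner_comm]
    ring
  -- `⟨e_s, e_Θ'⟩` controls `‖e_s‖²`, of which one half absorbs the remaining `⟨e_s, e_Θ - e_Θ'⟩`
  have hsplit : ‖es‖ ^ 2 / L - L * ‖eΘ - eΘ'‖ ^ 2 ≤ 2 * inner ℝ es eΘ := by
    have hcross := norm_add_sq_real es (L • (eΘ - eΘ'))
    rw [norm_smul, mul_pow, Real.norm_of_nonneg hL.le, inner_smul_right, inner_sub_right] at hcross
    rw [sub_le_iff_le_add, div_le_iff₀ hL]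
    nlinarith [sq_nonneg ‖es + L • (eΘ - eΘ')‖]
  rw [real_inner_self_eq_norm_sq, real_inner_comm] at hflux
  rw [show inner ℝ δ eΘ = ‖eq‖ ^ 2 - inner ℝ z eq by linarith] at hmass
  linarith [congrArg (L * ·) hpolar]

end SaddlePoint

theorem contraction_of_energy {C L τ E E' Q S G c k : ℝ} (hC : 0 < C) (hL : 0 < L) (hτ : 0 < τ)
    (hq : 1 / (3 * C ^ 2) * E ^ 2 - c * S ^ 2 ≤ Q ^ 2)
    (henergy : L * E ^ 2 + S ^ 2 / L + 2 * τ * Q ^ 2 ≤ L * E' ^ 2 + 2 * τ * (G * Q))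
    (hG : 2 * G ^ 2 ≤ (k - c) * S ^ 2) :
    E ^ 2 + 3 * C ^ 2 * τ / (2 * (3 * C ^ 2 * L + τ)) * Q ^ 2
        + 3 * C ^ 2 * (1 - τ * L * k) / (L * (3 * C ^ 2 * L + τ)) * S ^ 2
      ≤ 3 * C ^ 2 * L / (3 * C ^ 2 * L + τ) * E' ^ 2 := by
  have hE : τ * E ^ 2 ≤ τ * (3 * C ^ 2 * (Q ^ 2 + c * S ^ 2)) := by
    gcongr
    rw [← inv_mul_le_iff₀ (by positivity), ← one_div]
    linarith
  have habsorb : τ * (2 * (G * Q)) ≤ τ * (Q ^ 2 / 2 + (k - c) * S ^ 2) := by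
    gcongr
    nlinarith [sq_nonneg (Q - 2 * G)]
  have hscaled : 3 * C ^ 2 * (L * E ^ 2 + S ^ 2 / L + 2 * τ * Q ^ 2)
      ≤ 3 * C ^ 2 * (L * E' ^ 2 + τ * (Q ^ 2 / 2 + (k - c) * S ^ 2)) :=
    mul_le_mul_of_nonneg_left (by linarith) (by positivity)
  calc _ = ((3 * C ^ 2 * L + τ) * E ^ 2 + 3 * C ^ 2 * τ / 2 * Q ^ 2
        + 3 * C ^ 2 * (S ^ 2 / L - τ * k * S ^ 2)) / (3 * C ^ 2 * L + τ) := by field_simp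
    _ ≤ 3 * C ^ 2 * L * E' ^ 2 / (3 * C ^ 2 * L + τ) := by
      gcongr
      linarith
    _ = _ := by ring

namespace Consts

variable {B : Consts} {C S U : ℝ}

theorem sq_le_C1_mul_sq (hlow : 0 < B.aLow) (hup : 0 < B.aUp)
    (h : B.aLow * U ^ 2 ≤ C * (B.aUp * U + (B.Mu * B.La + B.Lf3) * S) * (B.Lf2 * S)
      + (B.Mu * B.La + B.Lf3) * S * U) :
    U ^ 2 ≤ B.C1 C * S ^ 2 := by
  set m : ℝ := B.Mu * B.La + B.Lf3
  set A : ℝ := C * B.aUp * B.Lf2 with hA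
  have hyoung : B.aLow * U ^ 2 ≤ ((A + m) * S) ^ 2 / B.aLow + 2 * (A * m / B.aUp) * S ^ 2 := by
    have hsq : 0 ≤ (B.aLow * U - (A + m) * S) ^ 2 / B.aLow := by positivity
    have hexpand : (B.aLow * U - (A + m) * S) ^ 2 / B.aLow
        = B.aLow * U ^ 2 - 2 * ((A + m) * S * U) + ((A + m) * S) ^ 2 / B.aLow := by
      field_simp
      ring
    have hcross : C * (B.aUp * U + m * S) * (B.Lf2 * S) + m * S * U
        = (A + m) * S * U + A * m / B.aUp * S ^ 2 := by
      rw [hA]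
      field_simp
      ring
    linarith
  have hsum : (A + m) ^ 2 + A ^ 2
      ≤ 4 * ((B.Mu : ℝ) ^ 2 * B.La ^ 2 + B.Lf3 ^ 2 + 2 * B.aUp ^ 2 * C ^ 2 * B.Lf2 ^ 2) := by
    have hA_sq : B.aUp ^ 2 * C ^ 2 * (B.Lf2 : ℝ) ^ 2 = A ^ 2 := by rw [hA]; ring
    have hm_sq : m ^ 2 ≤ 2 * ((B.Mu * B.La : ℝ) ^ 2 + (B.Lf3 : ℝ) ^ 2) := add_sq_le
    linarith [hA_sq, hm_sq, sq_nonneg (A - m), sq_nonneg A, add_sq_le (a := A) (b := m),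
      mul_pow (B.Mu : ℝ) B.La 2]
  calc U ^ 2 = B.aLow * U ^ 2 / B.aLow := by field_simp
    _ ≤ (((A + m) * S) ^ 2 / B.aLow + 2 * (A * m / B.aUp) * S ^ 2) / B.aLow := by gcongr
    _ = ((A + m) ^ 2 / B.aLow ^ 2 + 2 * (A / B.aLow) * (m / B.aUp)) * S ^ 2 := by field_simp
    _ ≤ ((A + m) ^ 2 / B.aLow ^ 2 + ((A / B.aLow) ^ 2 + (m / B.aUp) ^ 2)) * S ^ 2 := by
      gcongr
      exact two_mul_le_add_sq _ _
    _ = (((A + m) ^ 2 + A ^ 2) / B.aLow ^ 2 + m ^ 2 / B.aUp ^ 2) * S ^ 2 := by ring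
    _ ≤ B.C1 C * S ^ 2 := by
      rw [C1]
      gcongr

theorem sq_le_C2_mul_sq {P : ℝ} (hP : 0 ≤ P)
    (h : P ≤ C * (B.aUp * U + (B.Mu * B.La + B.Lf3) * S)) (hU : U ^ 2 ≤ B.C1 C * S ^ 2) :
    P ^ 2 ≤ B.C2 C * S ^ 2 := by
  set m : ℝ := B.Mu * B.La + B.Lf3
  calc P ^ 2 ≤ (C * (B.aUp * U + m * S)) ^ 2 := by gcongr
    _ = C ^ 2 * (B.aUp * U + m * S) ^ 2 := by ring
    _ ≤ C ^ 2 * (2 * ((B.aUp * U) ^ 2 + (m * S) ^ 2)) := by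
      gcongr
      exact add_sq_le
    _ = 2 * C ^ 2 * B.aUp ^ 2 * U ^ 2 + 2 * C ^ 2 * m ^ 2 * S ^ 2 := by ring
    _ ≤ 2 * C ^ 2 * B.aUp ^ 2 * (B.C1 C * S ^ 2) + 2 * C ^ 2 * m ^ 2 * S ^ 2 := by gcongr
    _ = B.C2 C * S ^ 2 := by rw [C2]; ring

theorem sq_sub_C3_mul_sq_le {E Q : ℝ} (hC : 0 < C) (hE : 0 ≤ E)
    (h : E ≤ C * (Q + (B.Mfw * U + (B.Mu * B.Lfw + B.Lf1) * S))) (hU : U ^ 2 ≤ B.C1 C * S ^ 2) :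
    1 / (3 * C ^ 2) * E ^ 2 - B.C3 C * S ^ 2 ≤ Q ^ 2 := by
  set n : ℝ := B.Mu * B.Lfw + B.Lf1
  rw [sub_le_iff_le_add, one_div, inv_mul_le_iff₀ (by positivity)]
  calc E ^ 2 ≤ (C * (Q + (B.Mfw * U + n * S))) ^ 2 := by gcongr
    _ ≤ 3 * C ^ 2 * (Q ^ 2 + (B.Mfw ^ 2 * U ^ 2 + n ^ 2 * S ^ 2)) := by
      rw [mul_pow, mul_right_comm, mul_comm]
      gcongr
      nlinarith [sq_nonneg (Q - B.Mfw * U), sq_nonneg (Q - n * S), sq_nonneg (B.Mfw * U - n * S)]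
    _ ≤ 3 * C ^ 2 * (Q ^ 2 + (B.Mfw ^ 2 * (B.C1 C * S ^ 2) + n ^ 2 * S ^ 2)) := by gcongr
    _ = 3 * C ^ 2 * (Q ^ 2 + B.C3 C * S ^ 2) := by rw [C3]; ring

theorem two_mul_sq_le_K_sub_C3_mul_sq (hU : U ^ 2 ≤ B.C1 C * S ^ 2) :
    2 * (B.Mfw * U + (B.Mu * B.Lfw + B.Lf1) * S) ^ 2 ≤ (B.K C - B.C3 C) * S ^ 2 := by
  calc 2 * (B.Mfw * U + (B.Mu * B.Lfw + B.Lf1) * S) ^ 2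
      ≤ 4 * (B.Lf1 * S) ^ 2 + 8 * (B.Lfw * B.Mu * S) ^ 2 + 8 * (B.Mfw ^ 2 * U ^ 2) := by
        nlinarith [sq_nonneg (B.Lf1 * S - (B.Lfw * B.Mu * S + B.Mfw * U)),
          sq_nonneg (B.Lfw * B.Mu * S - B.Mfw * U)]
    _ ≤ 4 * (B.Lf1 * S) ^ 2 + 8 * (B.Lfw * B.Mu * S) ^ 2
        + 8 * (B.Mfw ^ 2 * (B.C1 C * S ^ 2)) := by gcongr
    _ = (B.K C - B.C3 C) * S ^ 2 := by rw [K]; ring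

end Consts

/-! ### The discrete spaces -/

section WeakDivergence

variable {d : ℕ} {Ω : Set (Pt d)}

theorem exists_inner_eq_integral_test {φ : Pt d → ℝ} (hφ : ContDiff ℝ 1 φ)
    (hsupp : HasCompactSupport φ) :
    ∃ (ψ : L2v Ω) (χ : L2 Ω), (∀ v : L2v Ω, ∫ x in Ω, fderiv ℝ φ x (v x) = inner ℝ ψ v) ∧
      ∀ g : L2 Ω, ∫ x in Ω, g x * φ x = inner ℝ χ g := by
  have hgrad : MemLp (fun x => (InnerProductSpace.toDual ℝ (Pt d)).symm (fderiv ℝ φ x)) 2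
      (volume.restrict Ω) :=
    Continuous.memLp_of_hasCompactSupport
      ((LinearIsometryEquiv.continuous _).comp (hφ.continuous_fderiv one_ne_zero))
      ((hsupp.fderiv ℝ).comp_left (map_zero _))
  have hval : MemLp φ 2 (volume.restrict Ω) := hφ.continuous.memLp_of_hasCompactSupport hsupp
  refine ⟨hgrad.toLp, hval.toLp, fun v => ?_, fun g => ?_⟩
  · rw [L2.inner_def]
    refine integral_congr_ae ?_
    filter_upwards [hgrad.coeFn_toLp] with x hx
    rw [hx, InnerProductSpace.toDual_symm_apply]
  · rw [L2.inner_def]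
    refine integral_congr_ae ?_
    filter_upwards [hval.coeFn_toLp] with x hx
    rw [hx, RCLike.inner_apply, conj_trivial]

/-- The graph of the weak divergence. -/
def weakDivGraph (Ω : Set (Pt d)) : Submodule ℝ (L2v Ω × L2 Ω) where
  carrier := {x | HasWeakDiv x.1 x.2}
  add_mem' {x y} hx hy φ hφ hsupp hΩ := by
    obtain ⟨ψ, χ, hψ, hχ⟩ :=
      exists_inner_eq_integral_test (Ω := Ω) (hφ.of_le (by exact_mod_cast le_top)) hsupp
    have hxφ := hx φ hφ hsupp hΩ
    have hyφ := hy φ hφ hsupp hΩ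
    simp only [hψ, hχ, Prod.fst_add, Prod.snd_add, inner_add_right] at hxφ hyφ ⊢
    linarith
  zero_mem' φ hφ hsupp _ := by
    obtain ⟨ψ, χ, hψ, hχ⟩ :=
      exists_inner_eq_integral_test (Ω := Ω) (hφ.of_le (by exact_mod_cast le_top)) hsupp
    simp only [hψ, hχ, Prod.fst_zero, Prod.snd_zero, inner_zero_right, neg_zero]
  smul_mem' a x hx φ hφ hsupp hΩ := by
    obtain ⟨ψ, χ, hψ, hχ⟩ :=
      exists_inner_eq_integral_test (Ω := Ω) (hφ.of_le (by exact_mod_cast le_top)) hsupp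
    have hxφ := hx φ hφ hsupp hΩ
    simp only [hψ, hχ, Prod.smul_fst, Prod.smul_snd, inner_smul_right] at hxφ ⊢
    rw [hxφ, mul_neg]

theorem mk_weakDiv_mem_weakDivGraph {v : L2v Ω} (hv : v ∈ Hdiv Ω) :
    (v, weakDiv v) ∈ weakDivGraph Ω := by
  have hex : ∃ g : L2 Ω, HasWeakDiv v g := hv
  rw [weakDiv, dif_pos hex]
  exact hex.choose_spec

theorem weakDiv_eq_of_mem_weakDivGraph (hΩ : IsOpen Ω) {v : L2v Ω} {g : L2 Ω}
    (h : (v, g) ∈ weakDivGraph Ω) : weakDiv v = g :=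
  HasWeakDiv.weakDiv_eq hΩ h

end WeakDivergence

namespace Mesh

variable {d : ℕ} {Ω : Set (Pt d)} (𝒯 : Mesh Ω)

/-- `W_h` as a vector space. -/
def Wsub : Submodule ℝ (L2 Ω) where
  carrier := 𝒯.W
  add_mem' {w w'} hw hw' T hT := by
    obtain ⟨c, hc⟩ := hw T hT
    obtain ⟨c', hc'⟩ := hw' T hT
    refine ⟨c + c', ?_⟩
    filter_upwards [hc, hc', Lp.coeFn_add w w'] with x hx hx' hadd hxT
    rw [hadd, Pi.add_apply, hx hxT, hx' hxT]
  zero_mem' T _ := ⟨0, by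
    filter_upwards [Lp.coeFn_zero ℝ 2 (volume.restrict Ω)] with x hx _ using hx⟩
  smul_mem' r w hw T hT := by
    obtain ⟨c, hc⟩ := hw T hT
    refine ⟨r • c, ?_⟩
    filter_upwards [hc, Lp.coeFn_smul r w] with x hx hsmul hxT
    rw [hsmul, Pi.smul_apply, hx hxT]

/-- `V_h` as a vector space. -/
def Vsub : Submodule ℝ (L2v Ω) where
  carrier := 𝒯.V
  add_mem' {v v'} hv hv' := by
    refine ⟨⟨_, (weakDivGraph Ω).add_mem (mk_weakDiv_mem_weakDivGraph hv.1)
      (mk_weakDiv_mem_weakDivGraph hv'.1)⟩, fun T hT => ?_⟩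
    obtain ⟨a, b, hab⟩ := hv.2 T hT
    obtain ⟨a', b', hab'⟩ := hv'.2 T hT
    refine ⟨a + a', b + b', ?_⟩
    filter_upwards [hab, hab', Lp.coeFn_add v v'] with x hx hx' hadd hxT
    rw [hadd, Pi.add_apply, hx hxT, hx' hxT]
    module
  zero_mem' := by
    refine ⟨⟨0, (weakDivGraph Ω).zero_mem⟩, fun T _ => ⟨0, 0, ?_⟩⟩
    filter_upwards [Lp.coeFn_zero (Pt d) 2 (volume.restrict Ω)] with x hx _
    rw [hx, Pi.zero_apply, zero_smul, add_zero]
  smul_mem' r v hv := by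
    refine ⟨⟨_, (weakDivGraph Ω).smul_mem r (mk_weakDiv_mem_weakDivGraph hv.1)⟩, fun T hT => ?_⟩
    obtain ⟨a, b, hab⟩ := hv.2 T hT
    refine ⟨r • a, r * b, ?_⟩
    filter_upwards [hab, Lp.coeFn_smul r v] with x hx hsmul hxT
    rw [hsmul, Pi.smul_apply, hx hxT]
    module

/-- The divergence as a linear map `V_h → W_h`. -/
def divL [NeZero d] (hreg : interior (closure Ω) = Ω) : 𝒯.Vsub →ₗ[ℝ] 𝒯.Wsub where
  toFun v := ⟨weakDiv v.1, (𝒯.mem_W_iff hreg).2 fun T hT => by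
    obtain ⟨a, b, hab⟩ := ((𝒯.mem_V_iff hreg).1 v.2).2 T hT
    exact ⟨d * b, 𝒯.weakDiv_cell hreg (mk_weakDiv_mem_weakDivGraph v.2.1) hT hab⟩⟩
  map_add' v v' := Subtype.ext <| weakDiv_eq_of_mem_weakDivGraph (hreg ▸ isOpen_interior) <|
    (weakDivGraph Ω).add_mem (mk_weakDiv_mem_weakDivGraph v.2.1)
      (mk_weakDiv_mem_weakDivGraph v'.2.1)
  map_smul' r v := Subtype.ext <| weakDiv_eq_of_mem_weakDivGraph (hreg ▸ isOpen_interior) <|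
    (weakDivGraph Ω).smul_mem r (mk_weakDiv_mem_weakDivGraph v.2.1)

theorem weakDiv_sub [NeZero d] (hreg : interior (closure Ω) = Ω) {v v' : L2v Ω} (hv : v ∈ 𝒯.V)
    (hv' : v' ∈ 𝒯.V) : weakDiv (v - v') = weakDiv v - weakDiv v' :=
  congrArg Subtype.val ((𝒯.divL hreg).map_sub ⟨v, hv⟩ ⟨v', hv'⟩)

theorem exists_linearMap_piecewise (hreg : interior (closure Ω) = Ω) {F G : Type*}
    [NormedAddCommGroup F] [NormedSpace ℝ F] [AddCommGroup G] [Module ℝ G]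
    (Φ : G →ₗ[ℝ] C(Pt d, F)) :
    ∃ Ψ : (𝒯.cells → G) →ₗ[ℝ] Lp F 2 (volume.restrict Ω), ∀ g (T : 𝒯.cells),
      ∀ᵐ x ∂(volume.restrict (convexHull ℝ (T.1 : Set (Pt d)))), Ψ g x = Φ (g T) x := by
  choose Ψ hΨ using fun g : 𝒯.cells → G =>
    𝒯.exists_piecewise hreg (fun T => Φ (g T)) fun T => (Φ (g T)).continuous
  refine ⟨{ toFun := Ψ, map_add' := fun g g' => ?_, map_smul' := fun r g => ?_ }, hΨ⟩
  · refine Lp.ext ((𝒯.ae_restrict_iff_cells hreg).2 fun T hT => ?_)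
    filter_upwards [hΨ (g + g') ⟨T, hT⟩, hΨ g ⟨T, hT⟩, hΨ g' ⟨T, hT⟩,
      (𝒯.ae_restrict_iff_cells hreg).1 (Lp.coeFn_add (Ψ g) (Ψ g')) T hT] with x hsum hg hg' hadd
    rw [hsum, hadd, Pi.add_apply, Pi.add_apply, hg, hg', map_add, ContinuousMap.add_apply]
  · refine Lp.ext ((𝒯.ae_restrict_iff_cells hreg).2 fun T hT => ?_)
    filter_upwards [hΨ (r • g) ⟨T, hT⟩, hΨ g ⟨T, hT⟩,
      (𝒯.ae_restrict_iff_cells hreg).1 (Lp.coeFn_smul r (Ψ g)) T hT] with x hmul hg hsmul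
    rw [hmul, RingHom.id_apply, hsmul, Pi.smul_apply, Pi.smul_apply, hg, map_smul,
      ContinuousMap.smul_apply]

theorem finiteDimensional_Vsub (hreg : interior (closure Ω) = Ω) :
    FiniteDimensional ℝ 𝒯.Vsub := by
  let Φ : Pt d × ℝ →ₗ[ℝ] C(Pt d, Pt d) :=
    { toFun := fun g => ⟨fun x => g.1 + g.2 • x, by fun_prop⟩
      map_add' := fun g g' => ContinuousMap.ext fun x =>
        show g.1 + g'.1 + (g.2 + g'.2) • x = g.1 + g.2 • x + (g'.1 + g'.2 • x) by module
      map_smul' := fun r g => ContinuousMap.ext fun x =>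
        show r • g.1 + (r * g.2) • x = r • (g.1 + g.2 • x) by module }
  obtain ⟨Ψ, hΨ⟩ := 𝒯.exists_linearMap_piecewise hreg Φ
  have hle : 𝒯.Vsub ≤ LinearMap.range Ψ := fun v hv => by
    choose a b hab using fun T : 𝒯.cells => ((𝒯.mem_V_iff hreg).1 hv).2 T.1 T.2
    refine ⟨fun T => (a T, b T), Lp.ext ((𝒯.ae_restrict_iff_cells hreg).2 fun T hT => ?_)⟩
    filter_upwards [hΨ (fun T => (a T, b T)) ⟨T, hT⟩, hab ⟨T, hT⟩] with x hx hv
    rw [hx, hv]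
    rfl
  exact Submodule.finiteDimensional_of_le hle

end Mesh

/-! ### Superposition operators -/

section Superposition

variable {α : Type*} [MeasurableSpace α] {μ : Measure α} {F E : Type*} [NormedAddCommGroup F]

theorem inner_eq_integral_mul (f g : Lp ℝ 2 μ) : inner ℝ f g = ∫ x, f x * g x ∂μ := by
  rw [L2.inner_def]
  exact integral_congr_ae (ae_of_all _ fun x => mul_comm (g x) (f x))

variable [IsFiniteMeasure μ] {q : ℝ≥0∞}

/-- The superposition operator `Θ ↦ f(Θ)`. As `f` is bounded and `μ` is finite, its values lie in
every `Lp`; those in `L^∞` act on `L²` by multiplication. -/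
def superpose [NormedAddCommGroup E] (f : BoundedContinuousFunction F E) (p : ℝ≥0∞) (Θ : Lp F q μ) :
    Lp E p μ :=
  (MemLp.of_bound (f.continuous.comp_aestronglyMeasurable (Lp.aestronglyMeasurable Θ)) ‖f‖
    (ae_of_all _ fun _ => f.norm_coe_le_norm _)).toLp (fun x => f (Θ x))

theorem coeFn_superpose [NormedAddCommGroup E] (f : BoundedContinuousFunction F E) (p : ℝ≥0∞)
    (Θ : Lp F q μ) : superpose f p Θ =ᵐ[μ] fun x => f (Θ x) :=
  MemLp.coeFn_toLp _

theorem norm_superpose_sub_le {G : Type*} [NormedAddCommGroup E] [NormedAddCommGroup G]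
    {f : BoundedContinuousFunction F E} {g : BoundedContinuousFunction F G} {K : ℝ}
    (hfg : ∀ y z, ‖f y - f z‖ ≤ K * ‖g y - g z‖) (p : ℝ≥0∞) (Θ Θ' : Lp F q μ) :
    ‖superpose f p Θ - superpose f p Θ'‖ ≤ K * ‖superpose g p Θ - superpose g p Θ'‖ := by
  refine Lp.norm_le_mul_norm_of_ae_le_mul ?_
  filter_upwards [coeFn_superpose f p Θ, coeFn_superpose f p Θ', coeFn_superpose g p Θ,
    coeFn_superpose g p Θ', Lp.coeFn_sub (superpose f p Θ) (superpose f p Θ'),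
    Lp.coeFn_sub (superpose g p Θ) (superpose g p Θ')] with x hf hf' hg hg' hsub hsub'
  rw [hsub, hsub', Pi.sub_apply, Pi.sub_apply, hf, hf', hg, hg']
  exact hfg _ _

theorem inner_superpose [NormedAddCommGroup E] [InnerProductSpace ℝ E]
    (f : BoundedContinuousFunction F E) (Θ : Lp F q μ) (v : Lp E 2 μ) :
    inner ℝ (superpose f 2 Θ) v = ∫ x, inner ℝ (f (Θ x)) (v x) ∂μ := by
  rw [L2.inner_def]
  refine integral_congr_ae ?_
  filter_upwards [coeFn_superpose f 2 Θ] with x hf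
  rw [hf]

section Multiplication

variable [NormedAddCommGroup E] {f : BoundedContinuousFunction F ℝ} {b K M : ℝ} {Θ Θ' : Lp F q μ}

/-- Multiplication by the superposition `f(Θ)`, as an operator on `Lp`. -/
def superposeMul [NormedSpace ℝ E] {r : ℝ≥0∞} [Fact (1 ≤ r)] (f : BoundedContinuousFunction F ℝ)
    (Θ : Lp F q μ) : Lp E r μ →L[ℝ] Lp E r μ :=
  (ContinuousLinearMap.lsmul ℝ ℝ).holderL μ ∞ r r (superpose f ∞ Θ)

theorem coeFn_superposeMul [NormedSpace ℝ E] {r : ℝ≥0∞} [Fact (1 ≤ r)]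
    (f : BoundedContinuousFunction F ℝ) (Θ : Lp F q μ) (v : Lp E r μ) :
    superposeMul f Θ v =ᵐ[μ] fun x => f (Θ x) • v x := by
  rw [superposeMul, ContinuousLinearMap.holderL_apply_apply]
  filter_upwards [(ContinuousLinearMap.lsmul ℝ ℝ).coeFn_holder (r := r) (superpose f ∞ Θ) v,
    coeFn_superpose f ∞ Θ] with x hmul hf
  rw [hmul, hf, ContinuousLinearMap.lsmul_apply]

theorem norm_superposeMul_apply_le [NormedSpace ℝ E] {r : ℝ≥0∞} [Fact (1 ≤ r)]
    (hb : ∀ y, |f y| ≤ b) (v : Lp E r μ) : ‖superposeMul f Θ v‖ ≤ b * ‖v‖ := by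
  refine Lp.norm_le_mul_norm_of_ae_le_mul ?_
  filter_upwards [coeFn_superposeMul f Θ v] with x hmul
  rw [hmul, norm_smul]
  gcongr
  exact hb _

theorem norm_superposeMul_sub_superposeMul_le [NormedSpace ℝ E] {G : Type*} [NormedAddCommGroup G]
    {r : ℝ≥0∞} [Fact (1 ≤ r)] {g : BoundedContinuousFunction F G} (hK : 0 ≤ K)
    (hfg : ∀ y z, ‖f y - f z‖ ≤ K * ‖g y - g z‖) {u : Lp E r μ} (hu : ∀ᵐ x ∂μ, ‖u x‖ ≤ M) :
    ‖superposeMul f Θ u - superposeMul f Θ' u‖ ≤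
      M * K * ‖superpose g r Θ - superpose g r Θ'‖ := by
  refine Lp.norm_le_mul_norm_of_ae_le_mul ?_
  filter_upwards [coeFn_superposeMul f Θ u, coeFn_superposeMul f Θ' u, coeFn_superpose g r Θ,
    coeFn_superpose g r Θ', Lp.coeFn_sub (superposeMul f Θ u) (superposeMul f Θ' u),
    Lp.coeFn_sub (superpose g r Θ) (superpose g r Θ'), hu] with x hf hf' hg hg' hsub hsub' hM
  rw [hsub, hsub', Pi.sub_apply, Pi.sub_apply, hf, hf', hg, hg', ← sub_smul, norm_smul]
  calc ‖f (Θ x) - f (Θ' x)‖ * ‖u x‖ ≤ K * ‖g (Θ x) - g (Θ' x)‖ * M := by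
        gcongr
        exact hfg _ _
    _ = M * K * ‖g (Θ x) - g (Θ' x)‖ := by ring

variable [InnerProductSpace ℝ E]

theorem inner_superposeMul (f : BoundedContinuousFunction F ℝ) (Θ : Lp F q μ) (u v : Lp E 2 μ) :
    inner ℝ (superposeMul f Θ u) v = ∫ x, inner ℝ (f (Θ x) • u x) (v x) ∂μ := by
  rw [L2.inner_def]
  refine integral_congr_ae ?_
  filter_upwards [coeFn_superposeMul f Θ u] with x hmul
  rw [hmul]

theorem mul_norm_sq_le_inner_superposeMul (hb : ∀ y, b ≤ f y) (v : Lp E 2 μ) :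
    b * ‖v‖ ^ 2 ≤ inner ℝ (superposeMul f Θ v) v := by
  rw [norm_sq_eq_integral, ← integral_const_mul, L2.inner_def]
  refine integral_mono_ae ((integrable_norm_sq v).const_mul b) (L2.integrable_inner _ _) ?_
  filter_upwards [coeFn_superposeMul f Θ v] with x hmul
  rw [hmul, real_inner_smul_left, real_inner_self_eq_norm_sq]
  exact mul_le_mul_of_nonneg_right (hb _) (sq_nonneg _)

end Multiplication

section Affine

variable {G : Type*} [NormedAddCommGroup E] [NormedAddCommGroup G]
  {f : BoundedContinuousFunction F ℝ} {g : BoundedContinuousFunction F E}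
  {h : BoundedContinuousFunction F G} {b K K' M : ℝ} {Θ Θ' : Lp F q μ}

/-- The map `u ↦ f(Θ) u + g(Θ)` on `Lp`: the form in which the coefficient functions enter the two
flux equations. -/
def superposeAffine [NormedSpace ℝ E] {r : ℝ≥0∞} [Fact (1 ≤ r)] (f : BoundedContinuousFunction F ℝ)
    (g : BoundedContinuousFunction F E) (Θ : Lp F q μ) (u : Lp E r μ) : Lp E r μ :=
  superposeMul f Θ u + superpose g r Θ

theorem superposeAffine_sub_eq_add_superposeMul [NormedSpace ℝ E] {r : ℝ≥0∞} [Fact (1 ≤ r)]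
    (u u' : Lp E r μ) :
    superposeAffine f g Θ u - superposeAffine f g Θ' u'
      = superposeAffine f g Θ u - superposeAffine f g Θ' u + superposeMul f Θ' (u - u') := by
  simp only [superposeAffine, map_sub]
  abel

theorem norm_superposeAffine_sub_self_le [NormedSpace ℝ E] {r : ℝ≥0∞} [Fact (1 ≤ r)] (hK : 0 ≤ K)
    (hf : ∀ y z, ‖f y - f z‖ ≤ K * ‖h y - h z‖) (hg : ∀ y z, ‖g y - g z‖ ≤ K' * ‖h y - h z‖)
    {u : Lp E r μ} (hu : ∀ᵐ x ∂μ, ‖u x‖ ≤ M) :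
    ‖superposeAffine f g Θ u - superposeAffine f g Θ' u‖ ≤
      (M * K + K') * ‖superpose h r Θ - superpose h r Θ'‖ := by
  rw [superposeAffine, superposeAffine, add_sub_add_comm, add_mul]
  exact norm_add_le_of_le (norm_superposeMul_sub_superposeMul_le hK hf hu)
    (norm_superpose_sub_le hg r Θ Θ')

theorem norm_superposeAffine_sub_le [NormedSpace ℝ E] {r : ℝ≥0∞} [Fact (1 ≤ r)]
    (hb : ∀ y, |f y| ≤ b) (hK : 0 ≤ K) (hf : ∀ y z, ‖f y - f z‖ ≤ K * ‖h y - h z‖)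
    (hg : ∀ y z, ‖g y - g z‖ ≤ K' * ‖h y - h z‖) {u : Lp E r μ} (hu : ∀ᵐ x ∂μ, ‖u x‖ ≤ M)
    (u' : Lp E r μ) :
    ‖superposeAffine f g Θ u - superposeAffine f g Θ' u'‖ ≤
      b * ‖u - u'‖ + (M * K + K') * ‖superpose h r Θ - superpose h r Θ'‖ := by
  rw [superposeAffine_sub_eq_add_superposeMul, add_comm]
  exact norm_add_le_of_le (norm_superposeMul_apply_le hb _)
    (norm_superposeAffine_sub_self_le hK hf hg hu)

theorem mul_norm_sub_sq_sub_le_inner_superposeAffine [InnerProductSpace ℝ E] (hb : ∀ y, b ≤ f y)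
    (hK : 0 ≤ K) (hf : ∀ y z, ‖f y - f z‖ ≤ K * ‖h y - h z‖)
    (hg : ∀ y z, ‖g y - g z‖ ≤ K' * ‖h y - h z‖) {u : Lp E 2 μ} (hu : ∀ᵐ x ∂μ, ‖u x‖ ≤ M)
    (u' : Lp E 2 μ) :
    b * ‖u - u'‖ ^ 2 - (M * K + K') * ‖superpose h 2 Θ - superpose h 2 Θ'‖ * ‖u - u'‖ ≤
      inner ℝ (superposeAffine f g Θ u - superposeAffine f g Θ' u') (u - u') := by
  have hperturb : -(‖superposeAffine f g Θ u - superposeAffine f g Θ' u‖ * ‖u - u'‖) ≤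
      inner ℝ (superposeAffine f g Θ u - superposeAffine f g Θ' u) (u - u') :=
    (abs_le.1 (abs_real_inner_le_norm _ _)).1
  have hnorm := mul_le_mul_of_nonneg_right
    (norm_superposeAffine_sub_self_le (Θ := Θ) (Θ' := Θ') hK hf hg hu) (norm_nonneg (u - u'))
  rw [superposeAffine_sub_eq_add_superposeMul, inner_add_left]
  linarith [mul_norm_sq_le_inner_superposeMul (Θ := Θ') hb (u - u')]

end Affine

theorem norm_superpose_sub_sq_le {g : BoundedContinuousFunction ℝ ℝ} (hmono : Monotone g) {L : ℝ}
    (hlip : ∀ y z, |g y - g z| ≤ L * |y - z|) (Θ Θ' : Lp ℝ 2 μ) :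
    ‖superpose g 2 Θ - superpose g 2 Θ'‖ ^ 2
      ≤ L * inner ℝ (superpose g 2 Θ - superpose g 2 Θ') (Θ - Θ') := by
  rw [norm_sq_eq_integral, L2.inner_def, ← integral_const_mul]
  refine integral_mono_ae (integrable_norm_sq _) ((L2.integrable_inner _ _).const_mul _) ?_
  filter_upwards [coeFn_superpose g 2 Θ, coeFn_superpose g 2 Θ',
    Lp.coeFn_sub (superpose g 2 Θ) (superpose g 2 Θ'), Lp.coeFn_sub Θ Θ'] with x hg hg' hsub hsub'
  rw [hsub, hsub', Pi.sub_apply, Pi.sub_apply, hg, hg', RCLike.inner_apply, conj_trivial,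
    Real.norm_eq_abs]
  have hsign : 0 ≤ (Θ x - Θ' x) * (g (Θ x) - g (Θ' x)) :=
    (monotone_id.monovary hmono).sub_mul_sub_nonneg (Θ' x) (Θ x)
  calc |g (Θ x) - g (Θ' x)| ^ 2 ≤ L * |Θ x - Θ' x| * |g (Θ x) - g (Θ' x)| := by
        rw [sq]
        gcongr
        exact hlip _ _
    _ = L * ((Θ x - Θ' x) * (g (Θ x) - g (Θ' x))) := by
        rw [mul_assoc, ← abs_mul, abs_of_nonneg hsign]

end Superposition

/-! ### The discrete problems as variational equations -/

namespace Coeffs.Admissible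

variable {d : ℕ} {c : Coeffs d} {B : Consts}

theorem aUp_pos (hc : c.Admissible B) : 0 < B.aUp :=
  hc.aLow_pos.trans_le ((hc.a_ge 0).trans (hc.a_le 0))

/-- The composition of a Lipschitz function with the saturation, which is bounded because the
saturation takes its values in `[0, 1]`. -/
def compSat {E : Type*} [PseudoMetricSpace E] (hc : c.Admissible B) {f : ℝ → E} {K : ℝ≥0}
    (hf : LipschitzWith K f) : BoundedContinuousFunction ℝ E :=
  .mkOfBound ⟨f ∘ c.s, hf.continuous.comp hc.s_lip.continuous⟩ K fun y z =>
    (hf.dist_le_mul _ _).trans <|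
      mul_le_of_le_one_right K.2 (Real.dist_le_of_mem_Icc_01 (hc.s_mem y) (hc.s_mem z))

theorem norm_compSat_sub_le {E : Type*} [SeminormedAddCommGroup E] (hc : c.Admissible B)
    {f : ℝ → E} {K : ℝ≥0} (hf : LipschitzWith K f) (y z : ℝ) :
    ‖hc.compSat hf y - hc.compSat hf z‖ ≤
      K * ‖hc.compSat LipschitzWith.id y - hc.compSat LipschitzWith.id z‖ :=
  hf.norm_sub_le _ _

variable {Ω : Set (Pt d)} [IsFiniteMeasure (volume.restrict Ω)]

/-- `s(Θ)` in `L²(Ω)`. -/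
def saturation (hc : c.Admissible B) (Θ : L2 Ω) : L2 Ω :=
  superpose (hc.compSat LipschitzWith.id) 2 Θ

/-- `f₂(s(Θ))` in `L²(Ω)`. -/
def source (hc : c.Admissible B) (Θ : L2 Ω) : L2 Ω :=
  superpose (hc.compSat hc.f2_lip) 2 Θ

/-- The convective flux `f_w(s(Θ)) u + f₁(s(Θ))`, that is, `q + ∇Θ` in the second equation. -/
def convection (hc : c.Admissible B) (Θ : L2 Ω) (u : L2v Ω) : L2v Ω :=
  superposeAffine (hc.compSat hc.fw_lip) (hc.compSat hc.f1_lip) Θ u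

/-- The driving force `a(s(Θ)) u + f₃(s(Θ))`, that is, `-∇p` in Darcy's law, the last equation. -/
def darcy (hc : c.Admissible B) (Θ : L2 Ω) (u : L2v Ω) : L2v Ω :=
  superposeAffine (hc.compSat hc.a_lip) (hc.compSat hc.f3_lip) Θ u

theorem coeFn_saturation_sub (hc : c.Admissible B) (Θ Θ' : L2 Ω) :
    hc.saturation Θ - hc.saturation Θ' =ᵐ[volume.restrict Ω] fun x => c.s (Θ x) - c.s (Θ' x) := by
  filter_upwards [coeFn_superpose (hc.compSat LipschitzWith.id) 2 Θ,
    coeFn_superpose (hc.compSat LipschitzWith.id) 2 Θ',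
    Lp.coeFn_sub (hc.saturation Θ) (hc.saturation Θ')] with x hΘ hΘ' hsub
  rw [hsub, Pi.sub_apply, saturation, saturation, hΘ, hΘ']
  rfl

theorem inner_saturation (hc : c.Admissible B) (Θ w : L2 Ω) :
    inner ℝ (hc.saturation Θ) w = ∫ x in Ω, c.s (Θ x) * w x :=
  (inner_superpose _ Θ w).trans <| integral_congr_ae <| ae_of_all _ fun _ => mul_comm _ _

theorem inner_saturation_sub (hc : c.Admissible B) (Θ Θ' w : L2 Ω) :
    inner ℝ (hc.saturation Θ - hc.saturation Θ') w
      = ∫ x in Ω, (c.s (Θ x) - c.s (Θ' x)) * w x := by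
  rw [inner_eq_integral_mul]
  refine integral_congr_ae ?_
  filter_upwards [hc.coeFn_saturation_sub Θ Θ'] with x hx
  rw [hx]

theorem inner_source (hc : c.Admissible B) (Θ w : L2 Ω) :
    inner ℝ (hc.source Θ) w = ∫ x in Ω, c.f2 (c.s (Θ x)) * w x :=
  (inner_superpose _ Θ w).trans <| integral_congr_ae <| ae_of_all _ fun _ => mul_comm _ _

theorem inner_convection (hc : c.Admissible B) (Θ : L2 Ω) (u v : L2v Ω) :
    inner ℝ (hc.convection Θ u) v = (∫ x in Ω, inner ℝ (c.fw (c.s (Θ x)) • u x) (v x))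
      + ∫ x in Ω, inner ℝ (c.f1 (c.s (Θ x))) (v x) :=
  (inner_add_left _ _ v).trans <|
    congrArg₂ (· + ·) (inner_superposeMul _ Θ u v) (inner_superpose _ Θ v)

theorem inner_darcy (hc : c.Admissible B) (Θ : L2 Ω) (u v : L2v Ω) :
    inner ℝ (hc.darcy Θ u) v = (∫ x in Ω, inner ℝ (c.a (c.s (Θ x)) • u x) (v x))
      + ∫ x in Ω, inner ℝ (c.f3 (c.s (Θ x))) (v x) :=
  (inner_add_left _ _ v).trans <|
    congrArg₂ (· + ·) (inner_superposeMul _ Θ u v) (inner_superpose _ Θ v)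

theorem satDistSq_eq (hc : c.Admissible B) (Θ Θ' : L2 Ω) :
    satDistSq c Θ Θ' = ‖hc.saturation Θ - hc.saturation Θ'‖ ^ 2 := by
  rw [norm_sq_eq_integral]
  refine integral_congr_ae ?_
  filter_upwards [hc.coeFn_saturation_sub Θ Θ'] with x hx
  rw [hx, Real.norm_eq_abs, sq_abs]

theorem norm_saturation_sub_sq_le (hc : c.Admissible B) {L : ℝ} (hL : B.Ls ≤ L) (Θ Θ' : L2 Ω) :
    ‖hc.saturation Θ - hc.saturation Θ'‖ ^ 2
      ≤ L * inner ℝ (hc.saturation Θ - hc.saturation Θ') (Θ - Θ') :=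
  norm_superpose_sub_sq_le hc.s_mono (fun y z => (hc.s_lip.norm_sub_le y z).trans <|
    mul_le_mul_of_nonneg_right hL (norm_nonneg _)) Θ Θ'

theorem norm_saturation_sub_le (hc : c.Admissible B) (Θ Θ' : L2 Ω) :
    ‖hc.saturation Θ - hc.saturation Θ'‖ ≤ B.Ls * ‖Θ - Θ'‖ := by
  refine le_of_sq_le_mul (by positivity) ((hc.norm_saturation_sub_sq_le le_rfl Θ Θ').trans ?_)
  rw [mul_assoc, mul_comm ‖Θ - Θ'‖]
  exact mul_le_mul_of_nonneg_left (real_inner_le_norm _ _) B.Ls.2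

theorem norm_source_sub_le (hc : c.Admissible B) (Θ Θ' : L2 Ω) :
    ‖hc.source Θ - hc.source Θ'‖ ≤ B.Lf2 * ‖hc.saturation Θ - hc.saturation Θ'‖ :=
  norm_superpose_sub_le (hc.norm_compSat_sub_le hc.f2_lip) 2 Θ Θ'

theorem norm_convection_sub_le (hc : c.Admissible B) (Θ Θ' : L2 Ω) {u : L2v Ω}
    (hu : ∀ᵐ x ∂(volume.restrict Ω), ‖u x‖ ≤ B.Mu) (u' : L2v Ω) :
    ‖hc.convection Θ u - hc.convection Θ' u'‖ ≤ B.Mfw * ‖u - u'‖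
      + (B.Mu * B.Lfw + B.Lf1) * ‖hc.saturation Θ - hc.saturation Θ'‖ :=
  norm_superposeAffine_sub_le (fun y => hc.fw_bdd (c.s y)) B.Lfw.2
    (hc.norm_compSat_sub_le hc.fw_lip) (hc.norm_compSat_sub_le hc.f1_lip) hu u'

theorem norm_darcy_sub_le (hc : c.Admissible B) (Θ Θ' : L2 Ω) {u : L2v Ω}
    (hu : ∀ᵐ x ∂(volume.restrict Ω), ‖u x‖ ≤ B.Mu) (u' : L2v Ω) :
    ‖hc.darcy Θ u - hc.darcy Θ' u'‖ ≤ B.aUp * ‖u - u'‖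
      + (B.Mu * B.La + B.Lf3) * ‖hc.saturation Θ - hc.saturation Θ'‖ := by
  refine norm_superposeAffine_sub_le (fun y => ?_) B.La.2 (hc.norm_compSat_sub_le hc.a_lip)
    (hc.norm_compSat_sub_le hc.f3_lip) hu u'
  exact (abs_of_pos (hc.aLow_pos.trans_le (hc.a_ge (c.s y)))).trans_le (hc.a_le (c.s y))

theorem aLow_mul_norm_sub_sq_sub_le_inner_darcy (hc : c.Admissible B) (Θ Θ' : L2 Ω) {u : L2v Ω}
    (hu : ∀ᵐ x ∂(volume.restrict Ω), ‖u x‖ ≤ B.Mu) (u' : L2v Ω) :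
    B.aLow * ‖u - u'‖ ^ 2
        - (B.Mu * B.La + B.Lf3) * ‖hc.saturation Θ - hc.saturation Θ'‖ * ‖u - u'‖ ≤
      inner ℝ (hc.darcy Θ u - hc.darcy Θ' u') (u - u') :=
  mul_norm_sub_sq_sub_le_inner_superposeAffine (fun y => hc.a_ge (c.s y)) B.La.2
    (hc.norm_compSat_sub_le hc.a_lip) (hc.norm_compSat_sub_le hc.f3_lip) hu u'

end Coeffs.Admissible

section Variational

variable {d : ℕ} {Ω : Set (Pt d)} [IsFiniteMeasure (volume.restrict Ω)] {𝒯 : Mesh Ω}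
  {c : Coeffs d} {B : Consts} {L τ : ℝ} {Θprev Θold : L2 Ω} {X : State Ω}

theorem integral_L_mul_sub_add_saturation_mul (hc : c.Admissible B) (w : L2 Ω) :
    ∫ x in Ω, (L * (X.Θ x - Θold x) + c.s (Θold x)) * w x =
      L * inner ℝ (X.Θ - Θold) w + inner ℝ (hc.saturation Θold) w := by
  rw [← real_inner_smul_left, ← inner_add_left, inner_eq_integral_mul]
  refine integral_congr_ae ?_
  filter_upwards [coeFn_superpose (hc.compSat LipschitzWith.id) 2 Θold, Lp.coeFn_sub X.Θ Θold,
    Lp.coeFn_smul L (X.Θ - Θold), Lp.coeFn_add (L • (X.Θ - Θold)) (hc.saturation Θold)]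
    with x hs hsub hsmul hadd
  rw [hadd, Pi.add_apply, hsmul, Pi.smul_apply, hsub, Pi.sub_apply, Coeffs.Admissible.saturation,
    hs, smul_eq_mul]
  rfl

theorem solvesLStep_iff (hc : c.Admissible B) :
    SolvesLStep 𝒯 c L τ Θprev Θold X ↔ X.Mem 𝒯 ∧
      (∀ w ∈ 𝒯.W, L * inner ℝ (X.Θ - Θold) w + inner ℝ (hc.saturation Θold) w
        + τ * inner ℝ (weakDiv X.q) w = inner ℝ (hc.saturation Θprev) w) ∧
      (∀ v ∈ 𝒯.V, inner ℝ X.q v - inner ℝ X.Θ (weakDiv v)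
        = inner ℝ (hc.convection Θold X.u) v) ∧
      (∀ w ∈ 𝒯.W, inner ℝ (weakDiv X.u) w = inner ℝ (hc.source Θold) w) ∧
      ∀ v ∈ 𝒯.V, inner ℝ (hc.darcy Θold X.u) v = inner ℝ X.p (weakDiv v) := by
  simp only [SolvesLStep, integral_L_mul_sub_add_saturation_mul hc, ← hc.inner_saturation,
    ← inner_eq_integral_mul (weakDiv _), ← inner_eq_integral_mul X.Θ, ← inner_eq_integral_mul X.p,
    ← L2.inner_def X.q, ← hc.inner_source, hc.inner_convection, hc.inner_darcy,
    sub_eq_iff_eq_add', sub_add_eq_add_sub, add_zero]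

theorem SolvesLStep.solvesNonlinear (hc : c.Admissible B)
    (h : SolvesLStep 𝒯 c L τ Θprev X.Θ X) : SolvesNonlinear 𝒯 c τ Θprev X := by
  refine ⟨h.1, fun w hw => ?_, h.2.2⟩
  have hmass := ((solvesLStep_iff hc).1 h).2.1 w hw
  rw [sub_self, inner_zero_left, mul_zero, zero_add] at hmass
  rw [← hc.inner_saturation_sub, inner_sub_left, ← inner_eq_integral_mul]
  linarith

end Variational

section SaddlePoint

variable {d : ℕ} {Ω : Set (Pt d)} {𝒯 : Mesh Ω}

/-- `x = (p, u)` solves the mixed problem `r p + ∇ · u = g`, `A u + ∇ p = l` in `W_h × V_h`. -/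
def Mesh.IsSaddlePoint (𝒯 : Mesh Ω) (A : L2v Ω →L[ℝ] L2v Ω) (r : ℝ) (g : L2 Ω) (l : L2v Ω)
    (x : L2 Ω × L2v Ω) : Prop :=
  (x.1 ∈ 𝒯.W ∧ x.2 ∈ 𝒯.V) ∧
    (∀ w ∈ 𝒯.W, r * inner ℝ x.1 w + inner ℝ (weakDiv x.2) w = inner ℝ g w) ∧
      ∀ v ∈ 𝒯.V, inner ℝ (A x.2) v - inner ℝ x.1 (weakDiv v) = inner ℝ l v

namespace Mesh.DivStable

variable {C : ℝ} (h𝒯 : 𝒯.DivStable C)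

include h𝒯

theorem norm_le_of_forall_inner_le (hC : 0 ≤ C) {b : ℝ} (hb : 0 ≤ b) {p : L2 Ω} (hp : p ∈ 𝒯.W)
    (h : ∀ v ∈ 𝒯.V, inner ℝ p (weakDiv v) ≤ b * ‖v‖) : ‖p‖ ≤ C * b := by
  obtain ⟨v, hv, hdiv, hnorm⟩ := h𝒯 p hp
  refine le_of_sq_le_mul (by positivity) ?_
  calc ‖p‖ ^ 2 = inner ℝ p (weakDiv v) := by rw [hdiv, real_inner_self_eq_norm_sq]
    _ ≤ b * (C * ‖p‖) := (h v hv).trans (by gcongr)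
    _ = C * b * ‖p‖ := by ring

variable [NeZero d] (hreg : interior (closure Ω) = Ω)

theorem surjective_divL : Function.Surjective (𝒯.divL hreg) := fun w => by
  obtain ⟨v, hv, hdiv, -⟩ := h𝒯 w.1 w.2
  exact ⟨⟨v, hv⟩, Subtype.ext hdiv⟩

include hreg

theorem finiteDimensional_Wsub : FiniteDimensional ℝ 𝒯.Wsub :=
  have := 𝒯.finiteDimensional_Vsub hreg
  Module.Finite.of_surjective _ (h𝒯.surjective_divL hreg)

theorem existsUnique_isSaddlePoint {A : L2v Ω →L[ℝ] L2v Ω}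
    (hA : ∀ v, v ≠ 0 → 0 < inner ℝ (A v) v) {r : ℝ} (hr : 0 ≤ r) (g : L2 Ω) (l : L2v Ω) :
    ∃! x, 𝒯.IsSaddlePoint A r g l x := by
  have := 𝒯.finiteDimensional_Vsub hreg
  have := h𝒯.finiteDimensional_Wsub hreg
  let a : 𝒯.Vsub →ₗ[ℝ] 𝒯.Vsub →ₗ[ℝ] ℝ :=
    (innerₗ (L2v Ω)).compl₁₂ (A.toLinearMap ∘ₗ 𝒯.Vsub.subtype) 𝒯.Vsub.subtype
  have ha : ∀ v, v ≠ 0 → 0 < a v v := fun v hv => hA v.1 fun h => hv (Subtype.ext h)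
  obtain ⟨⟨p, u⟩, ⟨hdiv, hflux⟩, hunique⟩ := existsUnique_saddlePoint (h𝒯.surjective_divL hreg) ha
    hr (innerₗ (L2 Ω) g ∘ₗ 𝒯.Wsub.subtype) (innerₗ (L2v Ω) l ∘ₗ 𝒯.Vsub.subtype)
  refine ⟨(p.1, u.1), ⟨⟨p.2, u.2⟩, fun w hw => hdiv ⟨w, hw⟩, fun v hv => hflux ⟨v, hv⟩⟩,
    fun y ⟨⟨hyW, hyV⟩, hydiv, hyflux⟩ => ?_⟩
  have hy := hunique (⟨y.1, hyW⟩, ⟨y.2, hyV⟩) ⟨fun w => hydiv w w.2, fun v => hyflux v v.2⟩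
  exact Prod.ext (congrArg (·.1.1) hy) (congrArg (·.2.1) hy)

end Mesh.DivStable

end SaddlePoint

section UniqueSolvability

variable {d : ℕ} {Ω : Set (Pt d)} [IsFiniteMeasure (volume.restrict Ω)] {𝒯 : Mesh Ω}
  {c : Coeffs d} {B : Consts} {L τ : ℝ}

theorem solvesLStep_iff_isSaddlePoint (hc : c.Admissible B) (hτ : τ ≠ 0) {Θprev Θold : L2 Ω}
    {X : State Ω} : SolvesLStep 𝒯 c L τ Θprev Θold X ↔
      𝒯.IsSaddlePoint (superposeMul (hc.compSat hc.a_lip) Θold) 0 (hc.source Θold)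
        (-superpose (hc.compSat hc.f3_lip) 2 Θold) (X.p, X.u) ∧
      𝒯.IsSaddlePoint (.id ℝ (L2v Ω)) (L / τ)
        (τ⁻¹ • (L • Θold - hc.saturation Θold + hc.saturation Θprev))
        (hc.convection Θold X.u) (X.Θ, X.q) := by
  have hmass (w : L2 Ω) : L * inner ℝ (X.Θ - Θold) w + inner ℝ (hc.saturation Θold) w
        + τ * inner ℝ (weakDiv X.q) w = inner ℝ (hc.saturation Θprev) w ↔
      L / τ * inner ℝ X.Θ w + inner ℝ (weakDiv X.q) w =
        inner ℝ (τ⁻¹ • (L • Θold - hc.saturation Θold + hc.saturation Θprev)) w := by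
    rw [real_inner_smul_left, inner_add_left, inner_sub_left, inner_sub_left, real_inner_smul_left]
    field_simp
    constructor <;> intro h <;> linarith
  have hdarcy (v : L2v Ω) : inner ℝ (hc.darcy Θold X.u) v = inner ℝ X.p (weakDiv v) ↔
      inner ℝ (superposeMul (hc.compSat hc.a_lip) Θold X.u) v - inner ℝ X.p (weakDiv v) =
        inner ℝ (-superpose (hc.compSat hc.f3_lip) 2 Θold) v := by
    rw [Coeffs.Admissible.darcy, superposeAffine, inner_add_left, inner_neg_left]
    constructor <;> intro h <;> linarith
  simp only [solvesLStep_iff hc, Mesh.IsSaddlePoint, State.Mem, hmass, hdarcy, zero_mul, zero_add,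
    ContinuousLinearMap.id_apply]
  tauto

theorem existsUnique_solvesLStep [NeZero d] (hreg : interior (closure Ω) = Ω) {C : ℝ}
    (h𝒯 : 𝒯.DivStable C) (hc : c.Admissible B) (hL : 0 ≤ L) (hτ : 0 < τ) (Θprev Θold : L2 Ω) :
    ∃! X : State Ω, SolvesLStep 𝒯 c L τ Θprev Θold X := by
  have ha : ∀ v : L2v Ω, v ≠ 0 → 0 < inner ℝ (superposeMul (hc.compSat hc.a_lip) Θold v) v :=
    fun v hv => (mul_pos hc.aLow_pos (by positivity)).trans_le <|
      mul_norm_sq_le_inner_superposeMul (fun y => hc.a_ge (c.s y)) v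
  obtain ⟨⟨p, u⟩, hpu, hpu_unique⟩ := h𝒯.existsUnique_isSaddlePoint hreg ha le_rfl
    (hc.source Θold) (-superpose (hc.compSat hc.f3_lip) 2 Θold)
  obtain ⟨⟨Θ, q⟩, hΘq, hΘq_unique⟩ := h𝒯.existsUnique_isSaddlePoint hreg
    (A := .id ℝ (L2v Ω)) (fun v hv => real_inner_self_pos.2 hv) (div_nonneg hL hτ.le)
    (τ⁻¹ • (L • Θold - hc.saturation Θold + hc.saturation Θprev)) (hc.convection Θold u)
  simp only [solvesLStep_iff_isSaddlePoint hc hτ.ne']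
  refine ⟨⟨Θ, q, p, u⟩, ⟨hpu, hΘq⟩, fun X ⟨hXpu, hXΘq⟩ => ?_⟩
  obtain ⟨hp, hu⟩ := Prod.mk.inj (hpu_unique _ hXpu)
  rw [hu] at hXΘq
  obtain ⟨hΘ, hq⟩ := Prod.mk.inj (hΘq_unique _ hXΘq)
  exact State.ext hΘ hq hp hu

end UniqueSolvability

/-! ### The difference of two steps of the scheme -/

section ErrorEquations

variable {d : ℕ} {Ω : Set (Pt d)} [IsFiniteMeasure (volume.restrict Ω)] {𝒯 : Mesh Ω}
  {c : Coeffs d} {B : Consts} {L τ : ℝ} {Θprev Θ Θ' : L2 Ω} {X Y : State Ω}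
  (hX : SolvesLStep 𝒯 c L τ Θprev Θ X) (hY : SolvesLStep 𝒯 c L τ Θprev Θ' Y)

include hX hY

theorem SolvesLStep.flux_sub (hc : c.Admissible B) {v : L2v Ω} (hv : v ∈ 𝒯.V) :
    inner ℝ (X.q - Y.q) v - inner ℝ (X.Θ - Y.Θ) (weakDiv v) =
      inner ℝ (hc.convection Θ X.u - hc.convection Θ' Y.u) v := by
  obtain ⟨-, -, hflux, -⟩ := (solvesLStep_iff hc).1 hX
  obtain ⟨-, -, hflux', -⟩ := (solvesLStep_iff hc).1 hY
  simp only [inner_sub_left, ← hflux v hv, ← hflux' v hv]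
  ring

theorem SolvesLStep.darcy_sub (hc : c.Admissible B) {v : L2v Ω} (hv : v ∈ 𝒯.V) :
    inner ℝ (hc.darcy Θ X.u - hc.darcy Θ' Y.u) v = inner ℝ (X.p - Y.p) (weakDiv v) := by
  obtain ⟨-, -, -, -, hdarcy⟩ := (solvesLStep_iff hc).1 hX
  obtain ⟨-, -, -, -, hdarcy'⟩ := (solvesLStep_iff hc).1 hY
  rw [inner_sub_left, inner_sub_left, hdarcy v hv, hdarcy' v hv]

theorem SolvesLStep.norm_Θ_sub_le (hc : c.Admissible B) {C : ℝ} (hC : 0 ≤ C)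
    (h𝒯 : 𝒯.DivStable C) (hu : ∀ᵐ x ∂(volume.restrict Ω), ‖X.u x‖ ≤ B.Mu) :
    ‖X.Θ - Y.Θ‖ ≤ C * (‖X.q - Y.q‖ + (B.Mfw * ‖X.u - Y.u‖
      + (B.Mu * B.Lfw + B.Lf1) * ‖hc.saturation Θ - hc.saturation Θ'‖)) := by
  refine h𝒯.norm_le_of_forall_inner_le hC (by positivity) (𝒯.Wsub.sub_mem hX.1.1 hY.1.1)
    fun v hv => ?_
  calc inner ℝ (X.Θ - Y.Θ) (weakDiv v)
      = inner ℝ (X.q - Y.q - (hc.convection Θ X.u - hc.convection Θ' Y.u)) v := by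
        rw [inner_sub_left (X.q - Y.q), ← hX.flux_sub hY hc hv, sub_sub_cancel]
    _ ≤ (‖X.q - Y.q‖ + ‖hc.convection Θ X.u - hc.convection Θ' Y.u‖) * ‖v‖ :=
        (real_inner_le_norm _ _).trans (by gcongr; exact norm_sub_le _ _)
    _ ≤ _ := by gcongr; exact hc.norm_convection_sub_le Θ Θ' hu Y.u

theorem SolvesLStep.norm_p_sub_le (hc : c.Admissible B) {C : ℝ} (hC : 0 ≤ C)
    (h𝒯 : 𝒯.DivStable C) (hu : ∀ᵐ x ∂(volume.restrict Ω), ‖X.u x‖ ≤ B.Mu) :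
    ‖X.p - Y.p‖ ≤ C * (B.aUp * ‖X.u - Y.u‖
      + (B.Mu * B.La + B.Lf3) * ‖hc.saturation Θ - hc.saturation Θ'‖) := by
  have hup := hc.aUp_pos
  refine h𝒯.norm_le_of_forall_inner_le hC (by positivity) (𝒯.Wsub.sub_mem hX.1.2.2.1 hY.1.2.2.1)
    fun v hv => ?_
  rw [← hX.darcy_sub hY hc hv]
  exact (real_inner_le_norm _ _).trans (by gcongr; exact hc.norm_darcy_sub_le Θ Θ' hu Y.u)

variable [NeZero d] (hreg : interior (closure Ω) = Ω)

include hreg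

theorem SolvesLStep.mass_sub (hc : c.Admissible B) {w : L2 Ω} (hw : w ∈ 𝒯.W) :
    L * inner ℝ (X.Θ - Y.Θ - (Θ - Θ')) w + inner ℝ (hc.saturation Θ - hc.saturation Θ') w
      + τ * inner ℝ (weakDiv (X.q - Y.q)) w = 0 := by
  obtain ⟨-, hmass, -⟩ := (solvesLStep_iff hc).1 hX
  obtain ⟨-, hmass', -⟩ := (solvesLStep_iff hc).1 hY
  rw [𝒯.weakDiv_sub hreg hX.1.2.1 hY.1.2.1]
  have h := (hmass w hw).trans (hmass' w hw).symm
  simp only [inner_sub_left] at h ⊢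
  linarith

theorem SolvesLStep.norm_weakDiv_u_sub_le (hc : c.Admissible B) :
    ‖weakDiv (X.u - Y.u)‖ ≤ B.Lf2 * ‖hc.saturation Θ - hc.saturation Θ'‖ := by
  obtain ⟨-, -, -, hdiv, -⟩ := (solvesLStep_iff hc).1 hX
  obtain ⟨-, -, -, hdiv', -⟩ := (solvesLStep_iff hc).1 hY
  set w := weakDiv (X.u - Y.u) with hw
  have hwW : w ∈ 𝒯.W := (𝒯.divL hreg ⟨_, 𝒯.Vsub.sub_mem hX.1.2.2.2 hY.1.2.2.2⟩).2
  have hsq : ‖w‖ ^ 2 = inner ℝ (hc.source Θ - hc.source Θ') w := by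
    rw [inner_sub_left, ← hdiv w hwW, ← hdiv' w hwW, ← inner_sub_left,
      ← 𝒯.weakDiv_sub hreg hX.1.2.2.2 hY.1.2.2.2, ← hw, real_inner_self_eq_norm_sq]
  refine (le_of_sq_le_mul (norm_nonneg _) ?_).trans (hc.norm_source_sub_le Θ Θ')
  exact hsq.trans_le (real_inner_le_norm _ _)

theorem SolvesLStep.norm_u_sub_sq_le (hc : c.Admissible B) {C : ℝ} (hC : 0 ≤ C)
    (h𝒯 : 𝒯.DivStable C) (hu : ∀ᵐ x ∂(volume.restrict Ω), ‖X.u x‖ ≤ B.Mu) :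
    ‖X.u - Y.u‖ ^ 2 ≤ B.C1 C * ‖hc.saturation Θ - hc.saturation Θ'‖ ^ 2 := by
  refine B.sq_le_C1_mul_sq hc.aLow_pos hc.aUp_pos ?_
  have hcoercive := hc.aLow_mul_norm_sub_sq_sub_le_inner_darcy Θ Θ' hu Y.u
  rw [hX.darcy_sub hY hc (𝒯.Vsub.sub_mem hX.1.2.2.2 hY.1.2.2.2)] at hcoercive
  have hpdiv := (real_inner_le_norm (X.p - Y.p) (weakDiv (X.u - Y.u))).trans <|
    mul_le_mul (hX.norm_p_sub_le hY hc hC h𝒯 hu) (hX.norm_weakDiv_u_sub_le hY hreg hc)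
      (norm_nonneg _) ((norm_nonneg _).trans (hX.norm_p_sub_le hY hc hC h𝒯 hu))
  linarith

theorem SolvesLStep.errorBounds (hc : c.Admissible B) {C : ℝ} (hC : 0 < C)
    (h𝒯 : 𝒯.DivStable C) (hLs : B.Ls ≤ L) (hL : 0 < L) (hτ : 0 < τ)
    (hu : ∀ᵐ x ∂(volume.restrict Ω), ‖X.u x‖ ≤ B.Mu) :
    ErrorBounds c B C L τ Θ Θ' X Y := by
  have hu_sq := hX.norm_u_sub_sq_le hY hreg hc hC.le h𝒯 hu
  have hq := B.sq_sub_C3_mul_sq_le hC (norm_nonneg _) (hX.norm_Θ_sub_le hY hc hC.le h𝒯 hu) hu_sq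
  have henergy := energy_le hL hτ.le (hc.norm_saturation_sub_sq_le hLs Θ Θ')
    (hX.mass_sub hY hreg hc (𝒯.Wsub.sub_mem hX.1.1 hY.1.1))
    (hX.flux_sub hY hc (𝒯.Vsub.sub_mem hX.1.2.1 hY.1.2.1)) (hc.norm_convection_sub_le Θ Θ' hu Y.u)
  constructor <;> rw [hc.satDistSq_eq]
  case u_bound => exact hu_sq
  case div_u_bound =>
    rw [← mul_pow]
    gcongr
    exact hX.norm_weakDiv_u_sub_le hY hreg hc
  case p_bound =>
    exact B.sq_le_C2_mul_sq (norm_nonneg _) (hX.norm_p_sub_le hY hc hC.le h𝒯 hu) hu_sq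
  case q_lower => exact hq
  case contraction =>
    exact contraction_of_energy hC hL hτ hq henergy (B.two_mul_sq_le_K_sub_C3_mul_sq hu_sq)

end ErrorEquations

/-! ### Convergence of the scheme -/

section Sequences

variable {E : Type*} [NormedAddCommGroup E]

theorem cauchySeq_of_norm_sub_sq_le {r : ℝ} (hr : 0 ≤ r) (hr1 : r < 1) {x : ℕ → E}
    (h : ∀ i, ‖x (i + 2) - x (i + 1)‖ ^ 2 ≤ r * ‖x (i + 1) - x i‖ ^ 2) : CauchySeq x := by
  have hstep : ∀ i, ‖x (i + 2) - x (i + 1)‖ ≤ √r * ‖x (i + 1) - x i‖ := fun i =>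
    (Real.le_sqrt_of_sq_le (h i)).trans_eq <| by
      rw [Real.sqrt_mul hr, Real.sqrt_sq (norm_nonneg _)]
  have hgeometric : ∀ i, ‖x (i + 1) - x i‖ ≤ ‖x 1 - x 0‖ * √r ^ i := fun i => by
    induction i with
    | zero => simp
    | succ i ih =>
      calc ‖x (i + 2) - x (i + 1)‖ ≤ √r * (‖x 1 - x 0‖ * √r ^ i) :=
            (hstep i).trans (by gcongr)
        _ = ‖x 1 - x 0‖ * √r ^ (i + 1) := by ring
  refine cauchySeq_of_le_geometric (√r) ‖x 1 - x 0‖ (by rwa [Real.sqrt_lt' one_pos, one_pow])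
    fun i => ?_
  rw [dist_comm, dist_eq_norm]
  exact hgeometric i

theorem tendsto_of_norm_sub_sq_le {x : ℕ → E} {y : E} {b : ℕ → ℝ} (hb : Tendsto b atTop (𝓝 0))
    (h : ∀ i, ‖x (i + 1) - y‖ ^ 2 ≤ b i) : Tendsto x atTop (𝓝 y) := by
  rw [← tendsto_add_atTop_iff_nat 1, tendsto_iff_norm_sub_tendsto_zero]
  exact squeeze_zero (fun _ => norm_nonneg _) (fun i => Real.le_sqrt_of_sq_le (h i))
    (by simpa using hb.sqrt)

end Sequences

section Contraction

variable {d : ℕ} {Ω : Set (Pt d)} {c : Coeffs d} {B : Consts} {C L τ : ℝ}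

theorem satDistSq_nonneg (c : Coeffs d) (Θ Θ' : L2 Ω) : 0 ≤ satDistSq c Θ Θ' :=
  integral_nonneg fun _ => sq_nonneg _

theorem ErrorBounds.norm_Θ_sub_sq_add_le {Θ Θ' : L2 Ω} {X Y : State Ω}
    (h : ErrorBounds c B C L τ Θ Θ' X Y) (hL : 0 < L) (hτ : 0 < τ) (hK : τ * (L * B.K C) ≤ 1) :
    ‖X.Θ - Y.Θ‖ ^ 2 + 3 * C ^ 2 * τ / (2 * (3 * C ^ 2 * L + τ)) * ‖X.q - Y.q‖ ^ 2
      ≤ 3 * C ^ 2 * L / (3 * C ^ 2 * L + τ) * ‖Θ - Θ'‖ ^ 2 := by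
  have hK' : 0 ≤ 1 - τ * L * B.K C := by rwa [mul_assoc, sub_nonneg]
  have hsat := satDistSq_nonneg c Θ Θ'
  exact (le_add_of_nonneg_right (by positivity)).trans h.contraction

theorem ErrorBounds.norm_Θ_sub_sq_le {Θ Θ' : L2 Ω} {X Y : State Ω}
    (h : ErrorBounds c B C L τ Θ Θ' X Y) (hL : 0 < L) (hτ : 0 < τ) (hK : τ * (L * B.K C) ≤ 1) :
    ‖X.Θ - Y.Θ‖ ^ 2 ≤ 3 * C ^ 2 * L / (3 * C ^ 2 * L + τ) * ‖Θ - Θ'‖ ^ 2 :=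
  (le_add_of_nonneg_right (by positivity)).trans (h.norm_Θ_sub_sq_add_le hL hτ hK)

theorem ErrorBounds.norm_q_sub_sq_le {Θ Θ' : L2 Ω} {X Y : State Ω}
    (h : ErrorBounds c B C L τ Θ Θ' X Y) (hC : 0 < C) (hL : 0 < L) (hτ : 0 < τ)
    (hK : τ * (L * B.K C) ≤ 1) :
    ‖X.q - Y.q‖ ^ 2 ≤ 2 * L / τ * ‖Θ - Θ'‖ ^ 2 := by
  have hq : 3 * C ^ 2 * τ / (2 * (3 * C ^ 2 * L + τ)) * ‖X.q - Y.q‖ ^ 2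
      ≤ 3 * C ^ 2 * L / (3 * C ^ 2 * L + τ) * ‖Θ - Θ'‖ ^ 2 :=
    (le_add_of_nonneg_left (sq_nonneg _)).trans (h.norm_Θ_sub_sq_add_le hL hτ hK)
  refine le_of_mul_le_mul_left (hq.trans_eq ?_)
    (show 0 < 3 * C ^ 2 * τ / (2 * (3 * C ^ 2 * L + τ)) by positivity)
  field_simp

theorem cauchySeq_of_errorBounds (hL : 0 < L) (hτ : 0 < τ) (hK : τ * (L * B.K C) ≤ 1)
    {X : ℕ → State Ω}
    (h : ∀ i, ErrorBounds c B C L τ (X (i + 1)).Θ (X i).Θ (X (i + 2)) (X (i + 1))) :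
    CauchySeq fun i => (X i).Θ :=
  cauchySeq_of_norm_sub_sq_le (by positivity) ((div_lt_one (by positivity)).2 (by linarith))
    fun i => (h i).norm_Θ_sub_sq_le hL hτ hK

variable [IsFiniteMeasure (volume.restrict Ω)]

theorem Coeffs.Admissible.tendsto_satDistSq (hc : c.Admissible B) {ι : Type*} {l : Filter ι}
    {Θ : ι → L2 Ω} {Θ' : L2 Ω} (hΘ : Tendsto Θ l (𝓝 Θ')) :
    Tendsto (fun i => satDistSq c (Θ i) Θ') l (𝓝 0) := by
  have hbound : Tendsto (fun i => (B.Ls * ‖Θ i - Θ'‖) ^ 2) l (𝓝 0) := by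
    simpa using ((tendsto_iff_norm_sub_tendsto_zero.1 hΘ).const_mul (B.Ls : ℝ)).pow 2
  refine squeeze_zero (fun i => satDistSq_nonneg c _ _) (fun i => ?_) hbound
  rw [hc.satDistSq_eq]
  gcongr
  exact hc.norm_saturation_sub_le _ _

theorem tendsto_of_errorBounds (hc : c.Admissible B) (hC : 0 < C) (hL : 0 < L) (hτ : 0 < τ)
    (hK : τ * (L * B.K C) ≤ 1) {X : ℕ → State Ω} {Θ : L2 Ω} {Y : State Ω}
    (hΘ : Tendsto (fun i => (X i).Θ) atTop (𝓝 Θ))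
    (h : ∀ i, ErrorBounds c B C L τ (X i).Θ Θ (X (i + 1)) Y) :
    Tendsto (fun i => (X i).Θ) atTop (𝓝 Y.Θ) ∧ Tendsto (fun i => (X i).q) atTop (𝓝 Y.q) ∧
      Tendsto (fun i => (X i).p) atTop (𝓝 Y.p) ∧ Tendsto (fun i => (X i).u) atTop (𝓝 Y.u) := by
  have hΘ_sq (b : ℝ) : Tendsto (fun i => b * ‖(X i).Θ - Θ‖ ^ 2) atTop (𝓝 0) := by
    simpa using ((tendsto_iff_norm_sub_tendsto_zero.1 hΘ).pow 2).const_mul b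
  have hsat (b : ℝ) : Tendsto (fun i => b * satDistSq c (X i).Θ Θ) atTop (𝓝 0) := by
    simpa using (hc.tendsto_satDistSq hΘ).const_mul b
  exact ⟨tendsto_of_norm_sub_sq_le (hΘ_sq _) fun i => (h i).norm_Θ_sub_sq_le hL hτ hK,
    tendsto_of_norm_sub_sq_le (hΘ_sq _) fun i => (h i).norm_q_sub_sq_le hC hL hτ hK,
    tendsto_of_norm_sub_sq_le (hsat _) fun i => (h i).p_bound,
    tendsto_of_norm_sub_sq_le (hsat _) fun i => (h i).u_bound⟩

theorem exists_solvesNonlinear_tendsto [NeZero d] {𝒯 : Mesh Ω} {Θprev : L2 Ω}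
    {X : ℕ → State Ω} (hreg : interior (closure Ω) = Ω) (hC : 0 < C) (h𝒯 : 𝒯.DivStable C)
    (hc : c.Admissible B) (hLs : B.Ls ≤ L) (hL : 0 < L) (hτ : 0 < τ) (hK : τ * (L * B.K C) ≤ 1)
    (hX : ∀ i, SolvesLStep 𝒯 c L τ Θprev (X i).Θ (X (i + 1)))
    (hu : ∀ i, ∀ᵐ x ∂(volume.restrict Ω), ‖(X (i + 1)).u x‖ ≤ B.Mu) :
    ∃ Y : State Ω, SolvesNonlinear 𝒯 c τ Θprev Y ∧
      Tendsto (fun i => (X i).Θ) atTop (𝓝 Y.Θ) ∧ Tendsto (fun i => (X i).q) atTop (𝓝 Y.q) ∧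
      Tendsto (fun i => (X i).p) atTop (𝓝 Y.p) ∧ Tendsto (fun i => (X i).u) atTop (𝓝 Y.u) ∧
      ∀ i, ErrorBounds c B C L τ (X i).Θ Y.Θ (X (i + 1)) Y := by
  have hcauchy : CauchySeq fun i => (X i).Θ := cauchySeq_of_errorBounds hL hτ hK fun i =>
    (hX (i + 1)).errorBounds (hX i) hreg hc hC h𝒯 hLs hL hτ (hu (i + 1))
  obtain ⟨Θ, hΘ⟩ := cauchySeq_tendsto_of_complete hcauchy
  obtain ⟨Y, hY, -⟩ := existsUnique_solvesLStep hreg h𝒯 hc hL.le hτ Θprev Θ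
  have herr : ∀ i, ErrorBounds c B C L τ (X i).Θ Θ (X (i + 1)) Y := fun i =>
    (hX i).errorBounds hY hreg hc hC h𝒯 hLs hL hτ (hu i)
  obtain ⟨hYΘ, hq, hp, hu'⟩ := tendsto_of_errorBounds hc hC hL hτ hK hΘ herr
  obtain rfl : Y.Θ = Θ := tendsto_nhds_unique hYΘ hΘ
  exact ⟨Y, hY.solvesNonlinear hc, hYΘ, hq, hp, hu', herr⟩

end Contraction

end TwoPhase

end

theorem mainTheorem2 {d : ℕ} (hd : 1 ≤ d) (Ω : Set (TwoPhase.Pt d))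
    (hbdd : Bornology.IsBounded Ω) (hreg : interior (closure Ω) = Ω) (σ : ℝ) :
    ∃ C : ℝ, 0 < C ∧ ∀ 𝒯 : TwoPhase.Mesh Ω, 𝒯.ShapeRegular σ →
      -- `C` is a stability constant of the divergence, uniformly over the meshes
      (∀ w ∈ 𝒯.W, ∃ v ∈ 𝒯.V, TwoPhase.weakDiv v = w ∧ ‖v‖ ≤ C * ‖w‖) ∧
      ∀ (c : TwoPhase.Coeffs d) (B : TwoPhase.Consts), c.Admissible B →
      ∀ (L τ : ℝ), (B.Ls : ℝ) ≤ L → 0 < L → 0 < τ → τ * (L * B.K C) ≤ 1 →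
      ∀ Θprev : TwoPhase.L2 Ω,
        -- every step of the scheme is uniquely solvable
        (∀ Θold ∈ 𝒯.W, ∃! X : TwoPhase.State Ω,
          TwoPhase.SolvesLStep 𝒯 c L τ Θprev Θold X) ∧
        -- any sequence of iterates with bounded total fluxes converges linearly
        ∀ X : ℕ → TwoPhase.State Ω, (X 0).Θ ∈ 𝒯.W →
          (∀ i, TwoPhase.SolvesLStep 𝒯 c L τ Θprev (X i).Θ (X (i + 1))) →
          (∀ i, ∀ᵐ x ∂(volume.restrict Ω), ‖(X (i + 1)).u x‖ ≤ B.Mu) →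
          -- bounds for the increments of the iteration
          (∀ i, TwoPhase.ErrorBounds c B C L τ (X (i + 1)).Θ (X i).Θ (X (i + 2)) (X (i + 1))) ∧
          (∀ i, ‖(X (i + 2)).Θ - (X (i + 1)).Θ‖ ^ 2
              + 3 * C ^ 2 * τ / (2 * (3 * C ^ 2 * L + τ)) * ‖(X (i + 2)).q - (X (i + 1)).q‖ ^ 2
            ≤ 3 * C ^ 2 * L / (3 * C ^ 2 * L + τ) * ‖(X (i + 1)).Θ - (X i).Θ‖ ^ 2) ∧
          -- the limit exists, solves the nonlinear problem, and is approached linearly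
          ∃ Y : TwoPhase.State Ω, TwoPhase.SolvesNonlinear 𝒯 c τ Θprev Y ∧
            Tendsto (fun i => (X i).Θ) atTop (𝓝 Y.Θ) ∧
            Tendsto (fun i => (X i).q) atTop (𝓝 Y.q) ∧
            Tendsto (fun i => (X i).p) atTop (𝓝 Y.p) ∧
            Tendsto (fun i => (X i).u) atTop (𝓝 Y.u) ∧
            (∀ i, TwoPhase.ErrorBounds c B C L τ (X i).Θ Y.Θ (X (i + 1)) Y) ∧
            (∀ i, ‖(X (i + 1)).Θ - Y.Θ‖ ^ 2
                + 3 * C ^ 2 * τ / (2 * (3 * C ^ 2 * L + τ)) * ‖(X (i + 1)).q - Y.q‖ ^ 2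
              ≤ 3 * C ^ 2 * L / (3 * C ^ 2 * L + τ) * ‖(X i).Θ - Y.Θ‖ ^ 2) := by
  have : NeZero d := ⟨by omega⟩
  have : IsFiniteMeasure (volume.restrict Ω) :=
    isFiniteMeasure_restrict.2 hbdd.measure_lt_top.ne
  obtain ⟨C, hC, hstable⟩ := TwoPhase.exists_divStable hbdd hreg σ
  refine ⟨C, hC, fun 𝒯 hσ => ⟨hstable 𝒯 hσ, fun c B hc L τ hLs hL hτ hK Θprev =>
    ⟨fun Θold _ => TwoPhase.existsUnique_solvesLStep hreg (hstable 𝒯 hσ) hc hL.le hτ Θprev Θold,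
      fun X _ hX hu => ?_⟩⟩⟩
  have hincrement := fun i =>
    (hX (i + 1)).errorBounds (hX i) hreg hc hC (hstable 𝒯 hσ) hLs hL hτ (hu (i + 1))
  obtain ⟨Y, hY, hΘ, hq, hp, hu', herror⟩ :=
    TwoPhase.exists_solvesNonlinear_tendsto hreg hC (hstable 𝒯 hσ) hc hLs hL hτ hK hX hu
  exact ⟨hincrement, fun i => (hincrement i).norm_Θ_sub_sq_add_le hL hτ hK,
    Y, hY, hΘ, hq, hp, hu', herror, fun i => (herror i).norm_Θ_sub_sq_add_le hL hτ hK⟩
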